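/- Let $W=\langle f_1,f_2,f_3\rangle$ be a completely odd complex vector space with reduced symmetric coalgebra $S(W)=\bigoplus_{n\ge1}S^n(W)$, and let $L_n=\operatorname{Hom}(S^n(W),W)$ for $n\ge 1$ (so $L_0=0$) and $L=\operatorname{Hom}(S(W),W)=\bigoplus_{n=1}^3L_n$, identified with the Lie superalgebra of coderivations of $S(W)$. For $I\in\{0,1\}^3\setminus\{0\}$ let $\varphi^I_j\in L_{|I|}$ be the cochain with $\varphi^I_j(f^I)=f_j$ and $\varphi^I_j(f^J)=0$ for $J\ne I$, where $f^I=f_1^{i_1}f_2^{i_2}f_3^{i_3}$; it has parity $|I|+1$. Let $d_1=\varphi^{011}_1$ (the Heisenberg Lie algebra), $D(\varphi)=[\varphi,d_1]$, $H^n=\ker(D|_{L_n})/D(L_{n-1})$ and $h_n=\dim H^n$. A formal base is a supercommutative augmented local $\mathbb C$-algebra $A$, with maximal ideal $\mathfrak m$, such that $A=\varprojlim A/\mathfrak m^n$; it is infinitesimal if $\mathfrak m^2=0$. A deformation of $d_1$ with base $A$ is an odd $A$-linear coderivation $\tilde d$ of $S(W)\otimes A$ with $\tilde d^2=0$ that reduces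 to $d_1$ under the augmentation. Two deformations are equivalent if they are conjugate under an even $A$-coalgebra automorphism of $S(W)\otimes A$ that reduces to the identity under the augmentation. A deformation $\tilde d$ with formal base $A$ is versal if for every deformation $\tilde d'$ with formal base $B$ there is a morphism $f:A\to B$ of augmented superalgebras with $f_*\tilde d\sim\tilde d'$; it is miniversal if moreover $f$ is unique whenever $B$ is infinitesimal. Then the following hold. 1. $h_1=6$, $h_2=5$, $h_3=2$. With $$\delta=\bigl(\varphi^{110}_1,\ \varphi^{101}_1,\ \varphi^{110}_2-\varphi^{101}_3,\ \varphi^{110}_3,\ \varphi^{101}_2,\ \varphi^{100}_1+\varphi^{010}_2,\ \varphi^{010}_2-\varphi^{001}_3,\ \varphi^{010}_1,\ \varphi^{010}_3,\ \varphi^{001}_1,\ \varphi^{001}_2,\ \varphi^{111}_2,\ \varphi^{111}_3\bigr),$$ $$\beta=\bigl(\varphi^{011}_1,\ -\varphi^{101}_1+\varphi^{011}_2,\ \varphi^{110}_1+\varphi^{011}_3,\ \varphi^{111}_1\bigr),\qquad \gamma=\bigl(\varphi^{100}_1,\ \varphi^{100}_2,\ \varphi^{100}_3,\ \varphi^{110}_2\bigr),$$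 the $\delta_i,\beta_k,\gamma_k$ together form a basis of $L$, $D(\delta_i)=0$ and $D(\gamma_k)=\beta_k$, $D(\beta_k)=0$; so the $\delta_i$ represent a basis of the cohomology. 2. Let $t_1,\dots,t_5$ be even and $\theta_1,\dots,\theta_8$ odd parameters, let $(u^i)=(t_1,\dots,t_5,\theta_1,\dots,\theta_8)$, and put, over $\mathbb C[[t_1,\dots,t_5,\theta_1,\dots,\theta_8]]$, $$d_1^1=d_1+\sum_i\delta_iu^i,$$ $$d_1^2=d_1^1+\varphi^{100}_2(-t_3\theta_5+t_5\theta_3)+\varphi^{100}_3(-t_3\theta_3-t_4\theta_5)+\varphi^{100}_1(-t_1\theta_5+t_2\theta_3)-\varphi^{110}_2(\theta_3\theta_7+\theta_5\theta_8),$$ $$d_1^3=d_1^2-\varphi^{100}_2\,\theta_3\theta_5\theta_7 .$$ Call second-order relations the coefficients of the $\delta_i$ in $\tfrac12[d_1^1,d_1^1]$, expanded in the basis $\delta,\beta,\gamma$. If all odd parameters are set to zero, those of $\varphi^{111}_2$ and $\varphi^{111}_3$ become $t_1t_5-t_2t_3$ and $-t_1t_3-t_2t_4$, and the other eleven become $0$;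 that is, the second-order relations reduce to $t_1t_5-t_2t_3=0$ and $-t_1t_3-t_2t_4=0$. 3. The construction stops at third order. For an odd cochain $x$ with $\tfrac12[x,x]=\sum\delta_ir_i+\sum\beta_kb_k+\sum\gamma_kc_k$ let $x^+=x+\sum_k(-1)^{|\gamma_k|}\gamma_kb_k$ (the terms that cancel the coboundaries $\beta_kb_k$ against $d_1$). Then $(d_1^1)^+=d_1^2$, $(d_1^2)^+=d_1^3\neq d_1^2$ and $(d_1^3)^+=d_1^3$. Moreover, if $R_i$ is the coefficient of $\delta_i$ in $\tfrac12[d_1^3,d_1^3]$, then all coefficients of $[d_1^3,d_1^3]$ lie in the ideal $(R_i)$. 4. $d_1^3$ is a miniversal deformation of $d_1$, with base $\mathbb C[[t_1,\dots,t_5,\theta_1,\dots,\theta_8]]/(R_i)$. -/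

import Mathlib

universe u v

namespace HeisenbergDef

/-! ## The symmetric coalgebra of the odd space `W = ⟨f₁, f₂, f₃⟩`

`S(W)` (reduced) has the basis `f_I = f_{i₁} ⋯ f_{iₖ}` (`i₁ < ⋯ < iₖ`), where `I` runs over the
non-empty subsets of the index set; `f_I` has parity `|I|`.  The indices `1, 2, 3` are
represented by `0, 1, 2 : Fin 3`. -/

/-- Indices of the monomial basis of `S(W)`. -/
abbrev Mon : Type := {I : Finset (Fin 3) // I.Nonempty}

/-- The index of the monomial `f_j` of degree one. -/
def single (j : Fin 3) : Mon := ⟨{j}, Finset.singleton_nonempty j⟩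

/-- The degree of a monomial; its class modulo 2 is the parity. -/
def deg (I : Mon) : ℕ := I.1.card

/-- The sign with `f_I f_J = sgn I J • f_{I ∪ J}` for disjoint `I`, `J`. -/
def sgn (I J : Finset (Fin 3)) : ℤ :=
  (-1) ^ ((I ×ˢ J).filter fun p => p.2 < p.1).card

/-- The coefficient of `f_J ⊗ f_K` in `Δ(f_I)`; unshuffles of the factors of `f_I` correspond to
the ways to write `I` as a disjoint union of non-empty sets `J`, `K`. -/
def comul (I J K : Mon) : ℤ :=
  if Disjoint J.1 K.1 ∧ J.1 ∪ K.1 = I.1 then sgn J.1 K.1 else 0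

/-! ## Augmented local superalgebras -/

section Bases

/-- A `ℤ/2`-grading and an augmentation on a `ℂ`-algebra. -/
structure BaseData (A : Type u) [Ring A] [Algebra ℂ A] where
  /-- even (`0`) and odd (`1`) elements -/
  part : ZMod 2 → Submodule ℂ A
  /-- the augmentation -/
  aug : A →ₐ[ℂ] ℂ

variable {A : Type u} [Ring A] [Algebra ℂ A]

/-- The augmentation ideal, as a subspace (so that for `n ≥ 1` its power `m ^ n` is spanned by the
`n`-fold products of its elements, i.e. it is the `n`-th power of the ideal). -/
def BaseData.m (X : BaseData A) : Submodule ℂ A := LinearMap.ker X.aug.toLinearMap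

/-- Supercommutative augmented local algebra: the maximal ideal is the augmentation ideal. -/
structure BaseData.IsLocalBase (X : BaseData A) : Prop where
  graded : SetLike.GradedMonoid X.part
  internal : DirectSum.IsInternal X.part
  supercomm : ∀ i j : ZMod 2, ∀ a ∈ X.part i, ∀ b ∈ X.part j,
    b * a = (-1) ^ (i * j).val * (a * b)
  isUnit : ∀ a : A, X.aug a ≠ 0 → IsUnit a

/-- `A = lim A / m ^ n`: every compatible sequence of classes comes from exactly one element. -/
structure BaseData.IsFormalBase (X : BaseData A) : Prop extends X.IsLocalBase where
  complete : ∀ s : ℕ → A, (∀ n, s (n + 1) - s n ∈ X.m ^ (n + 1)) →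
    ∃! a : A, ∀ n, a - s n ∈ X.m ^ (n + 1)

/-- `m ^ 2 = 0`. -/
structure BaseData.IsInfinitesimalBase (X : BaseData A) : Prop extends X.IsLocalBase where
  sq_zero : ∀ a ∈ X.m, ∀ b ∈ X.m, a * b = 0

/-- Morphisms of augmented superalgebras. -/
structure IsBaseHom {B : Type*} [Ring B] [Algebra ℂ B] (X : BaseData A) (Y : BaseData B)
    (f : A →ₐ[ℂ] B) : Prop where
  part : ∀ i, ∀ a ∈ X.part i, f a ∈ Y.part i
  aug : ∀ a, Y.aug (f a) = X.aug a

/-! ## Coderivations and coalgebra morphisms of `S(W) ⊗ A`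

An `A`-linear endomorphism `M` of the free right `A`-module `S(W) ⊗ A` is the matrix with
`M (f_I) = ∑ K, f_K · M K I`; composition is the product of matrices. -/

/-- Odd endomorphism. -/
def IsOddEnd (X : BaseData A) (M : Matrix Mon Mon A) : Prop :=
  ∀ K I, M K I ∈ X.part ((1 + deg K + deg I : ℕ) : ZMod 2)

/-- Even endomorphism. -/
def IsEvenEnd (X : BaseData A) (M : Matrix Mon Mon A) : Prop :=
  ∀ K I, M K I ∈ X.part ((deg K + deg I : ℕ) : ZMod 2)

/-- `Δ ∘ M = (M ⊗ 1 + 1 ⊗ M) ∘ Δ` for an odd endomorphism `M`; compared are the coefficients of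
`f_J ⊗ f_K` in the images of `f_I`, and the signs come from moving `M`, respectively a coefficient
of `M`, past a basis monomial. -/
def IsOddCoderivation (M : Matrix Mon Mon A) : Prop :=
  ∀ I J K : Mon,
    ∑ L, (comul L J K : A) * M L I =
      ∑ L, (comul I L K : A) * ((-1) ^ ((1 + deg J + deg L) * deg K) * M J L) +
      ∑ L, (comul I J L : A) * ((-1) ^ deg J * M K L)

/-- `Δ ∘ g = (g ⊗ g) ∘ Δ` for an even endomorphism `g`. -/
def IsCoalgebraHom (g : Matrix Mon Mon A) : Prop :=
  ∀ I J K : Mon,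
    ∑ L, (comul L J K : A) * g L I =
      ∑ L, ∑ N, (comul I L N : A) * ((-1) ^ ((deg J + deg L) * deg K) * (g J L * g K N))

/-! ## Cochains -/

/-- Cochains with coefficients in `A`: the family `c` stands for `∑ φ^J_j c J j` in
`Hom(S(W), W) ⊗ A`, where `φ^J_j (f_K) = f_j` if `K = J`, and `0` otherwise.  The parity of `φ^J_j`
is `|J| + 1`. -/
abbrev Cochain (A : Type u) : Type u := Mon → Fin 3 → A

/-- The matrix of the coderivation of `S(W)` determined by `φ^J_j`:
`f_I ↦ ± φ^J_j(f_J) f_{I \ J}` if `J ⊆ I`, the sum over unshuffles having at most one nonzero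
term. -/
def coderBasis (J : Mon) (j : Fin 3) : Matrix Mon Mon ℤ := fun K I =>
  if J.1 ⊆ I.1 ∧ j ∉ I.1 \ J.1 ∧ K.1 = insert j (I.1 \ J.1) then
    sgn J.1 (I.1 \ J.1) * sgn {j} (I.1 \ J.1)
  else 0

/-- The coderivation of `S(W) ⊗ A` determined by an odd cochain `∑ φ^J_j c J j`.  The coefficient
`c J j` has parity `|J|`, and `(φ a)(w) = (-1)^{|a||w|} φ(w) a`. -/
def oddCoder (c : Cochain A) : Matrix Mon Mon A := fun K I =>
  ∑ J, ∑ j, (-1) ^ (deg J * deg I) * ((coderBasis J j K I : A) * c J j)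

/-- `½[x, x]` for an odd cochain `x`: the even cochain whose coderivation is the square of that
of `x`. -/
def halfBracket (c : Cochain A) : Cochain A := fun J j =>
  (oddCoder c * oddCoder c) (single j) J

/-- The cochain `φ^{i₁ i₂ i₃}_j a`, for an exponent vector `i` with entries in `{0, 1}` and
`j ∈ {1, 2, 3}`. -/
def phi (i : Fin 3 → ℕ) (j : ℕ) (a : A) : Cochain A := fun J k =>
  if (∀ q, i q = if q ∈ J.1 then 1 else 0) ∧ (k : ℕ) + 1 = j then a else 0

/-! ## Deformations -/

/-- A deformation with base `A` of the codifferential given by the odd cochain `d`: an odd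
codifferential of `S(W) ⊗ A` which the augmentation maps to that of `d`. -/
structure IsDeformation (d : Cochain ℂ) (X : BaseData A) (M : Matrix Mon Mon A) : Prop where
  odd : IsOddEnd X M
  coder : IsOddCoderivation M
  square : M * M = 0
  aug : M.map X.aug = oddCoder d

/-- Equivalence of deformations: `M' = g⁻¹ M g` for a coalgebra automorphism `g` of `S(W) ⊗ A`
over `A` which the augmentation maps to the identity. -/
def Equivalent (X : BaseData A) (M M' : Matrix Mon Mon A) : Prop :=
  ∃ g : Matrix Mon Mon A, IsEvenEnd X g ∧ IsCoalgebraHom g ∧ IsUnit g ∧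
    g.map X.aug = 1 ∧ M * g = g * M'

end Bases

/-- Versal deformations: formal deformations from which every formal deformation is induced, up to
equivalence, by a morphism of the bases. -/
structure IsVersal (d : Cochain ℂ) {A : Type v} [Ring A] [Algebra ℂ A] (X : BaseData A)
    (M : Matrix Mon Mon A) : Prop where
  formal : X.IsFormalBase
  deformation : IsDeformation d X M
  induces : ∀ (B : Type u) [Ring B] [Algebra ℂ B] (Y : BaseData B), Y.IsFormalBase →
    ∀ N : Matrix Mon Mon B, IsDeformation d Y N →
      ∃ f : A →ₐ[ℂ] B, IsBaseHom X Y f ∧ Equivalent Y (M.map f) N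

/-- Miniversal deformations: the morphism is unique when the other base is infinitesimal. -/
structure IsMiniversal (d : Cochain ℂ) {A : Type v} [Ring A] [Algebra ℂ A] (X : BaseData A)
    (M : Matrix Mon Mon A) : Prop extends IsVersal.{u, v} d X M where
  unique : ∀ (B : Type u) [Ring B] [Algebra ℂ B] (Y : BaseData B), Y.IsInfinitesimalBase →
    ∀ N : Matrix Mon Mon B, IsDeformation d Y N →
      ∀ f f' : A →ₐ[ℂ] B, IsBaseHom X Y f → IsBaseHom X Y f' →
        Equivalent Y (M.map f) N → Equivalent Y (M.map f') N → f = f'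

/-! ## Cohomology -/

/-- The Lie superbracket on `L = Hom(S(W), W)`, by
`[φ^J_j, φ^K_k] = φ^J_j φ^K_k - (-1)^{(|J|+1)(|K|+1)} φ^K_k φ^J_j` (as coderivations). -/
def bracket (a b : Cochain ℂ) : Cochain ℂ := fun I l =>
  ∑ J, ∑ j, ∑ K, ∑ k, a J j * b K k *
    (((coderBasis J j * coderBasis K k -
      (-1 : ℤ) ^ ((deg J + 1) * (deg K + 1)) • (coderBasis K k * coderBasis J j))
        (single l) I : ℤ) : ℂ)

/-- `D(φ) = [φ, d]`. -/
def coboundary (d : Cochain ℂ) : Cochain ℂ →ₗ[ℂ] Cochain ℂ where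
  toFun a := bracket a d
  map_add' a b := by
    funext I l
    simp only [bracket, Pi.add_apply, add_mul, Finset.sum_add_distrib]
  map_smul' r a := by
    funext I l
    simp only [bracket, Pi.smul_apply, smul_eq_mul, Finset.mul_sum, RingHom.id_apply, mul_assoc]

/-- `L_n = Hom(S^n(W), W)`. -/
def cochains (n : ℕ) : Submodule ℂ (Cochain ℂ) where
  carrier := {a | ∀ J j, deg J ≠ n → a J j = 0}
  add_mem' {a b} ha hb J j h := by simp [ha J j h, hb J j h]
  zero_mem' _ _ _ := rfl
  smul_mem' r a ha J j h := by simp [ha J j h]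

/-- `n`-cocycles, the kernel of `D` on `L_n`. -/
def cocycles (d : Cochain ℂ) (n : ℕ) : Submodule ℂ (Cochain ℂ) :=
  cochains n ⊓ LinearMap.ker (coboundary d)

/-- `D(L_{n-1})`, for `n ≥ 1` (there are no cochains of degree zero: `L_0 = 0`). -/
def coboundaries (d : Cochain ℂ) (n : ℕ) : Submodule ℂ (Cochain ℂ) :=
  (cochains (n - 1)).map (coboundary d)

/-- The `n`-th cohomology space, for `n ≥ 1`. -/
abbrev Cohomology (d : Cochain ℂ) (n : ℕ) : Type :=
  cocycles d n ⧸ (coboundaries d n).submoduleOf (cocycles d n)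

/-! ## The codifferential `d₁` and a basis of the cochains adapted to it -/

/-- `d₁ = φ^{011}_1`. -/
def d1 : Cochain ℂ := phi ![0, 1, 1] 1 1

/-- The cocycles `δ_i` which represent a basis of the cohomology of `d₁`. -/
def delta : Fin 13 → Cochain ℂ :=
  ![phi ![1, 1, 0] 1 1,
    phi ![1, 0, 1] 1 1,
    phi ![1, 1, 0] 2 1 - phi ![1, 0, 1] 3 1,
    phi ![1, 1, 0] 3 1,
    phi ![1, 0, 1] 2 1,
    phi ![1, 0, 0] 1 1 + phi ![0, 1, 0] 2 1,
    phi ![0, 1, 0] 2 1 - phi ![0, 0, 1] 3 1,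
    phi ![0, 1, 0] 1 1,
    phi ![0, 1, 0] 3 1,
    phi ![0, 0, 1] 1 1,
    phi ![0, 0, 1] 2 1,
    phi ![1, 1, 1] 2 1,
    phi ![1, 1, 1] 3 1]

/-- The basis `β_k` of the coboundaries. -/
def beta : Fin 4 → Cochain ℂ :=
  ![phi ![0, 1, 1] 1 1,
    -phi ![1, 0, 1] 1 1 + phi ![0, 1, 1] 2 1,
    phi ![1, 1, 0] 1 1 + phi ![0, 1, 1] 3 1,
    phi ![1, 1, 1] 1 1]

/-- Cochains `γ_k` with `D(γ_k) = β_k`. -/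
def gamma : Fin 4 → Cochain ℂ :=
  ![phi ![1, 0, 0] 1 1, phi ![1, 0, 0] 2 1, phi ![1, 0, 0] 3 1, phi ![1, 1, 0] 2 1]

/-- The parity of `γ_k`. -/
def gammaParity : Fin 4 → ℕ := ![0, 0, 0, 1]

section Coordinates

variable {A : Type u} [Ring A] [Algebra ℂ A]

/-- The cochain `φ a` for `φ` in `L` and a coefficient `a`. -/
def tensor (c : Cochain ℂ) (a : A) : Cochain A := fun J j => c J j • a

/-- The coefficient of `φ^{i₁ i₂ i₃}_j`; here `I` is the set of the positions of the ones among
`i₁, i₂, i₃`, counted from zero, and `j` is also counted from zero. -/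
def coeffAt (c : Cochain A) (I : Finset (Fin 3)) (hI : I.Nonempty) (j : Fin 3) : A := c ⟨I, hI⟩ j

/-- The coefficients of the `δ_i` in a cochain, with respect to the basis `δ, β, γ`. -/
def deltaCoord (c : Cochain A) : Fin 13 → A :=
  ![coeffAt c {0, 1} (by simp) 0 - coeffAt c {1, 2} (by simp) 2,
    coeffAt c {0, 2} (by simp) 0 + coeffAt c {1, 2} (by simp) 1,
    -coeffAt c {0, 2} (by simp) 2,
    coeffAt c {0, 1} (by simp) 2,
    coeffAt c {0, 2} (by simp) 1,
    coeffAt c {1} (by simp) 1 + coeffAt c {2} (by simp) 2,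
    -coeffAt c {2} (by simp) 2,
    coeffAt c {1} (by simp) 0,
    coeffAt c {1} (by simp) 2,
    coeffAt c {2} (by simp) 0,
    coeffAt c {2} (by simp) 1,
    coeffAt c {0, 1, 2} (by simp) 1,
    coeffAt c {0, 1, 2} (by simp) 2]

/-- The coefficients of the `β_k`. -/
def betaCoord (c : Cochain A) : Fin 4 → A :=
  ![coeffAt c {1, 2} (by simp) 0,
    coeffAt c {1, 2} (by simp) 1,
    coeffAt c {1, 2} (by simp) 2,
    coeffAt c {0, 1, 2} (by simp) 0]

/-- The coefficients of the `γ_k`. -/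
def gammaCoord (c : Cochain A) : Fin 4 → A :=
  ![coeffAt c {0} (by simp) 0 - coeffAt c {1} (by simp) 1 - coeffAt c {2} (by simp) 2,
    coeffAt c {0} (by simp) 1,
    coeffAt c {0} (by simp) 2,
    coeffAt c {0, 1} (by simp) 1 + coeffAt c {0, 2} (by simp) 2]

/-- One step of the construction: `x` is replaced by `x + ∑ γ_k s_k`, with `s_k` such that the
terms `β_k b_k` of `½[x, x]` are cancelled by `[d, γ_k s_k] = (-1)^{|γ_k|+1} D(γ_k) s_k`. -/
def nextOrder (x : Cochain A) : Cochain A :=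
  x + ∑ k, tensor (gamma k) ((-1) ^ gammaParity k * betaCoord (halfBracket x) k)

end Coordinates

/-! ## The parameter algebra and the deformations of order one, two, three -/

/-- `ℂ[[t₁, …, t₅]]`. -/
abbrev PowS : Type := MvPowerSeries (Fin 5) ℂ

/-- `ℂ[[t₁, …, t₅, θ₁, …, θ₈]]`, with even `t_i` and odd `θ_i`. -/
abbrev Par : Type := ExteriorAlgebra PowS (Fin 8 → PowS)

/-- The even parameters. -/
noncomputable def evenPar (i : Fin 5) : Par := algebraMap PowS Par (MvPowerSeries.X i)

/-- The odd parameters. -/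
noncomputable def oddPar (i : Fin 8) : Par := ExteriorAlgebra.ι PowS (Pi.single i 1)

noncomputable def t₁ : Par := evenPar 0
noncomputable def t₂ : Par := evenPar 1
noncomputable def t₃ : Par := evenPar 2
noncomputable def t₄ : Par := evenPar 3
noncomputable def t₅ : Par := evenPar 4
noncomputable def θ₁ : Par := oddPar 0
noncomputable def θ₂ : Par := oddPar 1
noncomputable def θ₃ : Par := oddPar 2
noncomputable def θ₄ : Par := oddPar 3
noncomputable def θ₅ : Par := oddPar 4
noncomputable def θ₆ : Par := oddPar 5
noncomputable def θ₇ : Par := oddPar 6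
noncomputable def θ₈ : Par := oddPar 7

/-- The parameter of each `δ_i`. -/
noncomputable def par : Fin 13 → Par := ![t₁, t₂, t₃, t₄, t₅, θ₁, θ₂, θ₃, θ₄, θ₅, θ₆, θ₇, θ₈]

/-- Setting all odd parameters equal to zero. -/
noncomputable def ignoreOdd : Par →ₐ[ℂ] PowS :=
  (ExteriorAlgebra.algebraMapInv (R := PowS) (M := Fin 8 → PowS)).restrictScalars ℂ

/-- The constant term. -/
noncomputable def parAug : Par →ₐ[ℂ] ℂ :=
  AlgHom.comp
    { (MvPowerSeries.constantCoeff : PowS →+* ℂ) with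
      commutes' := fun r => by simp [MvPowerSeries.algebraMap_apply] } ignoreOdd

/-- The parameter algebra as an augmented superalgebra. -/
noncomputable def parBase : BaseData Par where
  part i := (CliffordAlgebra.evenOdd (0 : QuadraticForm PowS (Fin 8 → PowS)) i).restrictScalars ℂ
  aug := parAug

/-- The universal infinitesimal deformation `d₁¹ = d₁ + ∑ δ_i u^i`. -/
noncomputable def d1_ord1 : Cochain Par := tensor d1 1 + ∑ i, tensor (delta i) (par i)

/-- The second order deformation `d₁²`. -/
noncomputable def d1_ord2 : Cochain Par :=
  d1_ord1 + phi ![1, 0, 0] 2 (-(t₃ * θ₅) + t₅ * θ₃)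
    + phi ![1, 0, 0] 3 (-(t₃ * θ₃) - t₄ * θ₅)
    + phi ![1, 0, 0] 1 (-(t₁ * θ₅) + t₂ * θ₃)
    - phi ![1, 1, 0] 2 (θ₃ * θ₇ + θ₅ * θ₈)

/-- The third order deformation `d₁³`. -/
noncomputable def d1_ord3 : Cochain Par :=
  d1_ord2 - phi ![1, 0, 0] 2 (θ₃ * θ₅ * θ₇)

/-- The ideal generated by the relations `R_i`, the coefficients of the `δ_i` in `½[x, x]`. -/
noncomputable def relIdeal (x : Cochain Par) : Ideal Par :=
  (TwoSidedIdeal.span (Set.range (deltaCoord (halfBracket x)))).asIdeal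

instance (x : Cochain Par) : (relIdeal x).IsTwoSided := by
  unfold relIdeal; infer_instance

/-- The algebra `ℂ[[u^i]]/(R_i)` of the relations of `d₁³`. -/
abbrev MiniBase : Type := Par ⧸ relIdeal d1_ord3

/-! ### The augmentation kills the relations -/

section
variable {A B : Type*} [Ring A] [Algebra ℂ A] [Ring B] [Algebra ℂ B]

theorem map_halfBracket (f : A →ₐ[ℂ] B) (c : Cochain A) (J : Mon) (j : Fin 3) :
    f (halfBracket c J j) = halfBracket (fun J j => f (c J j)) J j := by
  simp [halfBracket, Matrix.mul_apply, oddCoder]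

theorem map_deltaCoord (f : A →ₐ[ℂ] B) (c : Cochain A) (i : Fin 13) :
    f (deltaCoord c i) = deltaCoord (fun J j => f (c J j)) i := by
  fin_cases i <;> simp [deltaCoord, coeffAt]
end

theorem parAug_evenPar (i : Fin 5) : parAug (evenPar i) = 0 := by
  simp [parAug, ignoreOdd, evenPar, ExteriorAlgebra.algebraMapInv]
theorem parAug_oddPar (i : Fin 8) : parAug (oddPar i) = 0 := by
  simp [parAug, ignoreOdd, oddPar, ExteriorAlgebra.algebraMapInv]

theorem parAug_par (i : Fin 13) : parAug (par i) = 0 := by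
  fin_cases i <;> first | exact parAug_evenPar _ | exact parAug_oddPar _

theorem parAug_phi (i : Fin 3 → ℕ) (j : ℕ) (a : Par) (J : Mon) (k : Fin 3) (h : parAug a = 0) :
    parAug (phi i j a J k) = 0 := by
  unfold phi; split_ifs <;> simp [h]

theorem parAug_d1_ord3 : (fun J j => parAug (d1_ord3 J j)) = d1 := by
  funext J j
  have h (i) : parAug (par i) = 0 := parAug_par i
  have h1 : parAug t₁ = 0 := parAug_evenPar _
  have h2 : parAug t₂ = 0 := parAug_evenPar _
  have h3 : parAug t₃ = 0 := parAug_evenPar _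
  have h4 : parAug t₄ = 0 := parAug_evenPar _
  have h5 : parAug t₅ = 0 := parAug_evenPar _
  have h6 : parAug θ₃ = 0 := parAug_oddPar _
  have h7 : parAug θ₅ = 0 := parAug_oddPar _
  simp [d1_ord3, d1_ord2, d1_ord1, parAug_phi, tensor, h, h1, h2, h3, h4, h5, h6, h7]


theorem d1_apply (J : Mon) (j : Fin 3) :
    d1 J j = if J = ⟨{1, 2}, by simp⟩ ∧ j = 0 then 1 else 0 := by
  have key : ∀ (J : Mon) (j : Fin 3),
      ((∀ q, (![0, 1, 1] : Fin 3 → ℕ) q = if q ∈ J.1 then 1 else 0) ∧ (j : ℕ) + 1 = 1) ↔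
        (J = ⟨{1, 2}, by simp⟩ ∧ j = 0) := by
    decide +kernel
  simp only [d1, phi, key]

theorem oddCoder_d1 : oddCoder d1 = (coderBasis ⟨{1, 2}, by simp⟩ 0).map (Int.cast : ℤ → ℂ) := by
  funext K I
  simp only [oddCoder, d1_apply, Matrix.map_apply]
  rw [Finset.sum_eq_single ⟨{1, 2}, by simp⟩]
  · rw [Finset.sum_eq_single 0]
    · simp [deg, pow_mul]
    · intro j _ hj; simp [hj]
    · simp
  · intro J _ hJ; simp [hJ]
  · simp

theorem coderBasis_sq : coderBasis ⟨{1, 2}, by simp⟩ 0 * coderBasis ⟨{1, 2}, by simp⟩ 0 = 0 := by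
  decide +kernel

theorem halfBracket_d1 : halfBracket d1 = 0 := by
  funext J j
  have h := congrArg (fun M : Matrix Mon Mon ℤ => M.map (Int.castRingHom ℂ)) coderBasis_sq
  simp only [Matrix.map_mul] at h
  simp only [halfBracket, oddCoder_d1]
  exact (congrFun (congrFun h (single j)) J).trans (by simp)

theorem parAug_relIdeal (a : Par) (ha : a ∈ relIdeal d1_ord3) : parAug a = 0 := by
  have hle : TwoSidedIdeal.span (Set.range (deltaCoord (halfBracket d1_ord3))) ≤
      TwoSidedIdeal.ker parAug.toRingHom := by
    rw [TwoSidedIdeal.span_le]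
    rintro _ ⟨i, rfl⟩
    rw [SetLike.mem_coe, TwoSidedIdeal.mem_ker]
    have h := map_deltaCoord parAug (halfBracket d1_ord3) i
    simp only [map_halfBracket, parAug_d1_ord3, halfBracket_d1] at h
    refine h.trans ?_
    fin_cases i <;> simp [deltaCoord, coeffAt]
  exact (TwoSidedIdeal.mem_ker _).1 (hle (TwoSidedIdeal.mem_asIdeal.1 ha))

/-- The algebra of the relations of `d₁³` as an augmented superalgebra: grading and augmentation are
induced from the parameter algebra. -/
noncomputable def miniBase : BaseData MiniBase where
  part i := (parBase.part i).map (Ideal.Quotient.mkₐ ℂ (relIdeal d1_ord3)).toLinearMap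
  aug := Ideal.Quotient.liftₐ (relIdeal d1_ord3) parAug parAug_relIdeal

/-- `d₁³` as an endomorphism of `S(W) ⊗ ℂ[[u^i]]/(R_i)`. -/
noncomputable def miniversalDef : Matrix Mon Mon MiniBase :=
  (oddCoder d1_ord3).map (Ideal.Quotient.mkₐ ℂ (relIdeal d1_ord3))

end HeisenbergDef

namespace HeisenbergDef

set_option linter.unusedSimpArgs false

/-! ## The monomial basis -/

/-! The differential `D` has rank four and pairs `γ_k` with `β_k`. So `L` splits into
representatives `δ` of the cohomology, the coboundaries `β`, and a complement `γ` on which `D` is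
injective (`coboundary_d1`, `eq_sum_coord`). Along this splitting the equation `x² = 0` is solved
exactly instead of order by order.

Over a local base the four `γ`-directions integrate to an explicit group of coalgebra automorphisms
(`gauge`). In any deformation the coefficient of `φ^{011}_1` is a unit, so one such automorphism
brings the `β`-coordinates to those of `d₁` (`IsDeformation.exists_slice`). The `β`-coordinates of
`x² = 0` then form a triangular system, which expresses the `γ`-coordinates of `x` as polynomials in
its `δ`-coordinates `u` (`eq_slice`); the solution is `slice u`. For the universal parameters it is
`d₁³` (`slice_par_eq`). This explains why the construction stops: the only cubic term comes from
substituting the corrected coefficient of `φ^{110}_2` into that of `φ^{100}_2`.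

The `δ`-coordinates of `x²` are the relations. Its `γ`-coordinates vanish with them by a Bianchi
identity: `x²` commutes with `x`, and the coefficient 1 of `d₁` in `x` isolates them
(`halfBracket_slice_eq_zero`). Hence a normal form is a deformation exactly when its parameters
satisfy the relations. Over a formal base, completeness allows substitution of the parameters into
power series (`exists_par_hom`), the resulting morphism factors through the relations, and versality
follows.

If `m² = 0`, an equivalence changes a deformation by a commutator with `d₁`. This has no
`δ`-coordinates, so the parameters are determined (`slice_parameters_unique`), and they determine
the morphism (`mini_hom_ext`).

The quotient by the relations is a formal base: the relations are homogeneous, so the grading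
descends. The quotient is finite over the power series, and because products of nine odd parameters
vanish, its `m`-adic topology is that of the ideal of the variables (`miniBase_isFormalBase`).

Identities of coderivations and coalgebra maps are reduced to identities between integer structure
constants, which are decided. -/

/-- `f₁` -/
def e1 : Mon := ⟨{0}, by simp⟩
/-- `f₂` -/
def e2 : Mon := ⟨{1}, by simp⟩
/-- `f₃` -/
def e3 : Mon := ⟨{2}, by simp⟩
/-- `f₁ f₂` -/
def e12 : Mon := ⟨{0, 1}, by simp⟩
/-- `f₁ f₃` -/
def e13 : Mon := ⟨{0, 2}, by simp⟩
/-- `f₂ f₃` -/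
def e23 : Mon := ⟨{1, 2}, by simp⟩
/-- `f₁ f₂ f₃` -/
def e123 : Mon := ⟨{0, 1, 2}, by simp⟩

@[simp] theorem single_zero : single 0 = e1 := rfl
@[simp] theorem single_one : single 1 = e2 := rfl
@[simp] theorem single_two : single 2 = e3 := rfl
@[simp] theorem deg_single (j : Fin 3) : deg (single j) = 1 := rfl
@[simp] theorem deg_e1 : deg e1 = 1 := rfl
@[simp] theorem deg_e2 : deg e2 = 1 := rfl
@[simp] theorem deg_e3 : deg e3 = 1 := rfl
@[simp] theorem deg_e12 : deg e12 = 2 := rfl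
@[simp] theorem deg_e13 : deg e13 = 2 := rfl
@[simp] theorem deg_e23 : deg e23 = 2 := rfl
@[simp] theorem deg_e123 : deg e123 = 3 := rfl

theorem Mon.univ_eq : (Finset.univ : Finset Mon) = {e1, e2, e3, e12, e13, e23, e123} := by
  decide +kernel

theorem Mon.sum_eq {A : Type*} [AddCommMonoid A] (F : Mon → A) :
    ∑ J, F J = F e1 + (F e2 + (F e3 + (F e12 + (F e13 + (F e23 + F e123))))) := by
  rw [Mon.univ_eq]
  repeat rw [Finset.sum_insert (by decide)]
  rw [Finset.sum_singleton]

theorem Mon.cases {p : Mon → Prop} (h1 : p e1) (h2 : p e2) (h3 : p e3) (h12 : p e12)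
    (h13 : p e13) (h23 : p e23) (h123 : p e123) (I : Mon) : p I := by
  have : I ∈ (Finset.univ : Finset Mon) := Finset.mem_univ I
  rw [Mon.univ_eq] at this
  simp only [Finset.mem_insert, Finset.mem_singleton] at this
  rcases this with rfl | rfl | rfl | rfl | rfl | rfl | rfl <;> assumption

section Ring

variable {A : Type u} [Ring A] [Algebra ℂ A]

/-! ## The matrix of a coderivation -/

/-- The integer coefficient of `c J j` in the entry `K, I` of `oddCoder c`. -/
def coderCoeff (J : Mon) (j : Fin 3) (K I : Mon) : ℤ :=
  (-1) ^ (deg J * deg I) * coderBasis J j K I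

omit [Algebra ℂ A] in
theorem oddCoder_eq (c : Cochain A) (K I : Mon) :
    oddCoder c K I = ∑ J, ∑ j, (coderCoeff J j K I : A) * c J j := by
  simp [oddCoder, coderCoeff, mul_assoc]

-- Turns the evaluation of an entry over an arbitrary ring into a decidable identity of integers;
-- the list contains the nonzero structure constants.
omit [Algebra ℂ A] in
theorem oddCoder_eq_sum_list (c : Cochain A) (K I : Mon) (l : List (ℤ × Mon × Fin 3))
    (h : ∀ J j, coderCoeff J j K I = (l.map fun t => if t.2 = (J, j) then t.1 else 0).sum) :
    oddCoder c K I = (l.map fun t => (t.1 : A) * c t.2.1 t.2.2).sum := by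
  rw [oddCoder_eq]
  simp only [h]
  rw [← Fintype.sum_prod_type' (f := fun J j =>
    (((l.map fun t => if t.2 = (J, j) then t.1 else 0).sum : ℤ) : A) * c J j)]
  clear h
  induction l with
  | nil => simp
  | cons t l ih =>
    simp only [List.map_cons, List.sum_cons, Int.cast_add, add_mul, Finset.sum_add_distrib, ih]
    congr 1
    rw [Finset.sum_eq_single t.2]
    · simp
    · intro b _ hb
      simp [hb.symm]
    · simp

variable (c : Cochain A)

omit [Algebra ℂ A]

/-- The corestriction to `W` recovers the cochain. The sign comes from moving a coefficient of
parity `|I|` past `f_I`, since `|I|² ≡ |I|`. -/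
theorem coderCoeff_single : ∀ (l : Fin 3) (J : Mon) (j : Fin 3) (I : Mon),
    coderCoeff J j (single l) I = if J = I ∧ j = l then (-1) ^ deg I else 0 := by
  decide +kernel

theorem oddCoder_single (j : Fin 3) (I : Mon) :
    oddCoder c (single j) I = (-1) ^ deg I * c I j := by
  rw [oddCoder_eq]
  simp only [coderCoeff_single]
  rw [Finset.sum_eq_single I, Finset.sum_eq_single j] <;> simp +contextual

@[simp] theorem oddCoder_e1 (I : Mon) : oddCoder c e1 I = (-1) ^ deg I * c I 0 :=
  oddCoder_single c 0 I
@[simp] theorem oddCoder_e2 (I : Mon) : oddCoder c e2 I = (-1) ^ deg I * c I 1 :=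
  oddCoder_single c 1 I
@[simp] theorem oddCoder_e3 (I : Mon) : oddCoder c e3 I = (-1) ^ deg I * c I 2 :=
  oddCoder_single c 2 I

theorem coderCoeff_eq_zero_of_deg_lt : ∀ (J : Mon) (j : Fin 3) (K I : Mon), deg I < deg K →
    coderCoeff J j K I = 0 := by
  decide +kernel

theorem oddCoder_eq_zero_of_deg_lt {K I : Mon} (h : deg I < deg K) : oddCoder c K I = 0 := by
  rw [oddCoder_eq]
  simp [coderCoeff_eq_zero_of_deg_lt _ _ K I h]

@[simp] theorem oddCoder_e12_e1 : oddCoder c e12 e1 = 0 :=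
  oddCoder_eq_zero_of_deg_lt c (by decide)

@[simp] theorem oddCoder_e12_e2 : oddCoder c e12 e2 = 0 :=
  oddCoder_eq_zero_of_deg_lt c (by decide)

@[simp] theorem oddCoder_e12_e3 : oddCoder c e12 e3 = 0 :=
  oddCoder_eq_zero_of_deg_lt c (by decide)

@[simp] theorem oddCoder_e12_e12 : oddCoder c e12 e12 = c e1 0 + c e2 1 :=
  (oddCoder_eq_sum_list c _ _
    [(1, e1, 0), (1, e2, 1)] (by decide +kernel)).trans (by simp [sub_eq_add_neg, add_assoc])

@[simp] theorem oddCoder_e12_e13 : oddCoder c e12 e13 = c e3 1 :=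
  (oddCoder_eq_sum_list c _ _
    [(1, e3, 1)] (by decide +kernel)).trans (by simp)

@[simp] theorem oddCoder_e12_e23 : oddCoder c e12 e23 = -c e3 0 :=
  (oddCoder_eq_sum_list c _ _
    [(-1, e3, 0)] (by decide +kernel)).trans (by simp)

@[simp] theorem oddCoder_e12_e123 : oddCoder c e12 e123 = -c e13 0 - c e23 1 :=
  (oddCoder_eq_sum_list c _ _
    [(-1, e13, 0), (-1, e23, 1)] (by decide +kernel)).trans (by simp [sub_eq_add_neg, add_assoc])

@[simp] theorem oddCoder_e13_e1 : oddCoder c e13 e1 = 0 :=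
  oddCoder_eq_zero_of_deg_lt c (by decide)

@[simp] theorem oddCoder_e13_e2 : oddCoder c e13 e2 = 0 :=
  oddCoder_eq_zero_of_deg_lt c (by decide)

@[simp] theorem oddCoder_e13_e3 : oddCoder c e13 e3 = 0 :=
  oddCoder_eq_zero_of_deg_lt c (by decide)

@[simp] theorem oddCoder_e13_e12 : oddCoder c e13 e12 = c e2 2 :=
  (oddCoder_eq_sum_list c _ _
    [(1, e2, 2)] (by decide +kernel)).trans (by simp)

@[simp] theorem oddCoder_e13_e13 : oddCoder c e13 e13 = c e1 0 + c e3 2 :=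
  (oddCoder_eq_sum_list c _ _
    [(1, e1, 0), (1, e3, 2)] (by decide +kernel)).trans (by simp [sub_eq_add_neg, add_assoc])

@[simp] theorem oddCoder_e13_e23 : oddCoder c e13 e23 = c e2 0 :=
  (oddCoder_eq_sum_list c _ _
    [(1, e2, 0)] (by decide +kernel)).trans (by simp)

@[simp] theorem oddCoder_e13_e123 : oddCoder c e13 e123 = c e12 0 - c e23 2 :=
  (oddCoder_eq_sum_list c _ _
    [(1, e12, 0), (-1, e23, 2)] (by decide +kernel)).trans (by simp [sub_eq_add_neg, add_assoc])

@[simp] theorem oddCoder_e23_e1 : oddCoder c e23 e1 = 0 :=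
  oddCoder_eq_zero_of_deg_lt c (by decide)

@[simp] theorem oddCoder_e23_e2 : oddCoder c e23 e2 = 0 :=
  oddCoder_eq_zero_of_deg_lt c (by decide)

@[simp] theorem oddCoder_e23_e3 : oddCoder c e23 e3 = 0 :=
  oddCoder_eq_zero_of_deg_lt c (by decide)

@[simp] theorem oddCoder_e23_e12 : oddCoder c e23 e12 = -c e1 2 :=
  (oddCoder_eq_sum_list c _ _
    [(-1, e1, 2)] (by decide +kernel)).trans (by simp)

@[simp] theorem oddCoder_e23_e13 : oddCoder c e23 e13 = c e1 1 :=
  (oddCoder_eq_sum_list c _ _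
    [(1, e1, 1)] (by decide +kernel)).trans (by simp)

@[simp] theorem oddCoder_e23_e23 : oddCoder c e23 e23 = c e2 1 + c e3 2 :=
  (oddCoder_eq_sum_list c _ _
    [(1, e2, 1), (1, e3, 2)] (by decide +kernel)).trans (by simp [sub_eq_add_neg, add_assoc])

@[simp] theorem oddCoder_e23_e123 : oddCoder c e23 e123 = c e12 1 + c e13 2 :=
  (oddCoder_eq_sum_list c _ _
    [(1, e12, 1), (1, e13, 2)] (by decide +kernel)).trans (by simp [sub_eq_add_neg, add_assoc])

@[simp] theorem oddCoder_e123_e1 : oddCoder c e123 e1 = 0 :=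
  oddCoder_eq_zero_of_deg_lt c (by decide)

@[simp] theorem oddCoder_e123_e2 : oddCoder c e123 e2 = 0 :=
  oddCoder_eq_zero_of_deg_lt c (by decide)

@[simp] theorem oddCoder_e123_e3 : oddCoder c e123 e3 = 0 :=
  oddCoder_eq_zero_of_deg_lt c (by decide)

@[simp] theorem oddCoder_e123_e12 : oddCoder c e123 e12 = 0 :=
  oddCoder_eq_zero_of_deg_lt c (by decide)

@[simp] theorem oddCoder_e123_e13 : oddCoder c e123 e13 = 0 :=
  oddCoder_eq_zero_of_deg_lt c (by decide)

@[simp] theorem oddCoder_e123_e23 : oddCoder c e123 e23 = 0 :=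
  oddCoder_eq_zero_of_deg_lt c (by decide)

@[simp] theorem oddCoder_e123_e123 : oddCoder c e123 e123 = -c e1 0 - c e2 1 - c e3 2 :=
  (oddCoder_eq_sum_list c _ _
    [(-1, e1, 0), (-1, e2, 1), (-1, e3, 2)] (by decide +kernel)).trans (by simp [sub_eq_add_neg, add_assoc])

/-! ## The half bracket -/

/-- The square is expanded only at the monomials that enter the `δ`- and `β`-coordinates; `f₁`
enters neither. -/
theorem halfBracket_e2 (j : Fin 3) :
    halfBracket c e2 j = c e1 j * c e2 0 + c e2 j * c e2 1 + c e3 j * c e2 2 := by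
  simp [halfBracket, Matrix.mul_apply, Mon.sum_eq, oddCoder_single, pow_succ]
  try abel

theorem halfBracket_e3 (j : Fin 3) :
    halfBracket c e3 j = c e1 j * c e3 0 + c e2 j * c e3 1 + c e3 j * c e3 2 := by
  simp [halfBracket, Matrix.mul_apply, Mon.sum_eq, oddCoder_single, pow_succ]
  try abel

theorem halfBracket_e12 (j : Fin 3) :
    halfBracket c e12 j = -(c e1 j * c e12 0) - c e2 j * c e12 1 - c e3 j * c e12 2
      + c e12 j * (c e1 0 + c e2 1) + c e13 j * c e2 2 - c e23 j * c e1 2 := by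
  simp [halfBracket, Matrix.mul_apply, Mon.sum_eq, oddCoder_single, pow_succ]
  try abel

theorem halfBracket_e13 (j : Fin 3) :
    halfBracket c e13 j = -(c e1 j * c e13 0) - c e2 j * c e13 1 - c e3 j * c e13 2
      + c e12 j * c e3 1 + c e13 j * (c e1 0 + c e3 2) + c e23 j * c e1 1 := by
  simp [halfBracket, Matrix.mul_apply, Mon.sum_eq, oddCoder_single, pow_succ]
  try abel

theorem halfBracket_e23 (j : Fin 3) :
    halfBracket c e23 j = -(c e1 j * c e23 0) - c e2 j * c e23 1 - c e3 j * c e23 2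
      - c e12 j * c e3 0 + c e13 j * c e2 0 + c e23 j * (c e2 1 + c e3 2) := by
  simp [halfBracket, Matrix.mul_apply, Mon.sum_eq, oddCoder_single, pow_succ]
  try abel

theorem halfBracket_e123 (j : Fin 3) :
    halfBracket c e123 j = c e1 j * c e123 0 + c e2 j * c e123 1 + c e3 j * c e123 2
      - c e12 j * (c e13 0 + c e23 1) + c e13 j * (c e12 0 - c e23 2)
      + c e23 j * (c e12 1 + c e13 2) + c e123 j * (c e1 0 + c e2 1 + c e3 2) := by
  simp [halfBracket, Matrix.mul_apply, Mon.sum_eq, oddCoder_single,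
    pow_succ]
  noncomm_ring

end Ring

/-! ## Signs and supercommutativity -/

/-- Koszul signs depend only on parities, so sign identities below become polynomial identities over
`ZMod 2`, decided by enumeration. -/
theorem neg_one_pow_congr {R : Type*} [Ring R] {m n : ℕ} (h : (m : ZMod 2) = n) :
    (-1 : R) ^ m = (-1) ^ n := by
  rw [neg_one_pow_eq_pow_mod_two m, neg_one_pow_eq_pow_mod_two n,
    (ZMod.natCast_eq_natCast_iff' m n 2).1 h]

theorem neg_one_pow_mul_comm {R : Type*} [Ring R] (n : ℕ) (a : R) :
    a * (-1) ^ n = (-1) ^ n * a :=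
  ((Commute.neg_one_right a).pow_right n).eq

theorem neg_one_pow_mul_comm_left {R : Type*} [Ring R] (n : ℕ) (a b : R) :
    a * ((-1) ^ n * b) = (-1) ^ n * (a * b) := by
  rw [← mul_assoc, neg_one_pow_mul_comm, mul_assoc]

namespace BaseData.IsLocalBase

variable {A : Type u} [Ring A] [Algebra ℂ A] {X : BaseData A} (hX : X.IsLocalBase)
include hX

theorem mul_comm_sign {m n : ℕ} {a b : A} (ha : a ∈ X.part m) (hb : b ∈ X.part n) :
    b * a = (-1) ^ (m * n) * (a * b) := by
  rw [hX.supercomm m n a ha b hb]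
  congr 1
  apply neg_one_pow_congr
  simp

theorem one_mem : (1 : A) ∈ X.part 0 := hX.graded.one_mem

theorem mul_mem {i j : ZMod 2} {a b : A} (ha : a ∈ X.part i) (hb : b ∈ X.part j) :
    a * b ∈ X.part (i + j) := hX.graded.mul_mem ha hb

theorem intCast_mem (n : ℤ) : (n : A) ∈ X.part 0 := by
  rw [← zsmul_one]
  exact zsmul_mem hX.one_mem n

theorem neg_one_pow_mem (n : ℕ) : ((-1) ^ n : A) ∈ X.part 0 := by
  have := hX.intCast_mem ((-1) ^ n)
  simpa using this

theorem isCompl : IsCompl (X.part 0) (X.part 1) :=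
  hX.internal.isCompl zero_ne_one (by
    ext i
    simp only [Set.mem_univ, Set.mem_insert_iff, Set.mem_singleton_iff, true_iff]
    revert i
    decide)

theorem exists_add (a : A) : ∃ b ∈ X.part 0, ∃ c ∈ X.part 1, b + c = a :=
  Submodule.mem_sup.1 (hX.isCompl.sup_eq_top ▸ Submodule.mem_top)

theorem eq_zero_of_mem {a : A} (h0 : a ∈ X.part 0) (h1 : a ∈ X.part 1) : a = 0 :=
  Submodule.disjoint_def.1 hX.isCompl.disjoint a h0 h1

/-- Even elements are central. -/
theorem even_comm {a : A} (ha : a ∈ X.part 0) (b : A) : a * b = b * a := by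
  obtain ⟨b0, h0, b1, h1, rfl⟩ := hX.exists_add b
  have e0 := hX.supercomm 0 0 a ha b0 h0
  have e1 := hX.supercomm 0 1 a ha b1 h1
  simp only [mul_zero, zero_mul, ZMod.val_zero, pow_zero, one_mul] at e0 e1
  rw [mul_add, add_mul, e0, e1]

theorem odd_comm {a b : A} (ha : a ∈ X.part 1) (hb : b ∈ X.part 1) : b * a = -(a * b) := by
  have e := hX.mul_comm_sign (m := 1) (n := 1) (by simpa using ha) (by simpa using hb)
  simpa using e

/-- Anticommutation gives `2a² = 0`, and 2 is invertible because of the complex scalars. -/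
theorem odd_sq {a : A} (ha : a ∈ X.part 1) : a * a = 0 := by
  have e := hX.odd_comm ha ha
  have h2 : (2 : ℂ) • (a * a) = 0 := by
    rw [two_smul]
    nth_rw 1 [e]
    exact neg_add_cancel _
  exact (smul_eq_zero.1 h2).resolve_left two_ne_zero

/-- An odd element squares to zero, and `ℂ` has no nilpotents. -/
theorem aug_odd {a : A} (ha : a ∈ X.part 1) : X.aug a = 0 := by
  have := congrArg X.aug (hX.odd_sq ha)
  simpa using this

end BaseData.IsLocalBase

/-! ## Coderivations and coalgebra morphisms as matrix identities -/

section Matrices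

variable {A : Type u} [Ring A]

/-- The matrix of the comultiplication. -/
def comulMatrix (A : Type u) [Ring A] : Matrix (Mon × Mon) Mon A := fun p L => comul L p.1 p.2

/-- The matrix of `M ⊗ 1 + 1 ⊗ M` for an odd endomorphism `M`. -/
def oddTensor (M : Matrix Mon Mon A) : Matrix (Mon × Mon) (Mon × Mon) A := fun p q =>
  (if p.2 = q.2 then (-1) ^ ((1 + deg p.1 + deg q.1) * deg p.2) * M p.1 q.1 else 0) +
    if p.1 = q.1 then (-1) ^ deg p.1 * M p.2 q.2 else 0

/-- The matrix of `M ⊗ 1 + 1 ⊗ M` for an even endomorphism `M`. -/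
def evenTensor (M : Matrix Mon Mon A) : Matrix (Mon × Mon) (Mon × Mon) A := fun p q =>
  (if p.2 = q.2 then (-1) ^ ((deg p.1 + deg q.1) * deg p.2) * M p.1 q.1 else 0) +
    if p.1 = q.1 then M p.2 q.2 else 0

/-- The matrix of `g ⊗ g` for an even endomorphism `g`. -/
def homTensor (g : Matrix Mon Mon A) : Matrix (Mon × Mon) (Mon × Mon) A := fun p q =>
  (-1) ^ ((deg p.1 + deg q.1) * deg p.2) * (g p.1 q.1 * g p.2 q.2)

/-- In this form, conjugating and squaring coderivations is just associativity of matrix products.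
-/
theorem isOddCoderivation_iff (M : Matrix Mon Mon A) :
    IsOddCoderivation M ↔ comulMatrix A * M = oddTensor M * comulMatrix A := by
  have key : ∀ I J K : Mon, (oddTensor M * comulMatrix A) (J, K) I =
      ∑ L, (comul I L K : A) * ((-1) ^ ((1 + deg J + deg L) * deg K) * M J L) +
      ∑ L, (comul I J L : A) * ((-1) ^ deg J * M K L) := by
    intro I J K
    simp only [Matrix.mul_apply, oddTensor, comulMatrix, Fintype.sum_prod_type, add_mul, ite_mul,
      zero_mul, Finset.sum_add_distrib]
    congr 1
    · refine Finset.sum_congr rfl fun L _ => ?_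
      simp [Int.cast_comm]
    · rw [Finset.sum_comm]
      refine Finset.sum_congr rfl fun L _ => ?_
      simp [Int.cast_comm]
  constructor
  · intro h
    ext ⟨J, K⟩ I
    rw [key, ← h I J K]
    rfl
  · intro h I J K
    rw [← key, ← h]
    rfl

theorem isCoalgebraHom_iff (g : Matrix Mon Mon A) :
    IsCoalgebraHom g ↔ comulMatrix A * g = homTensor g * comulMatrix A := by
  have key : ∀ I J K : Mon, (homTensor g * comulMatrix A) (J, K) I =
      ∑ L, ∑ N, (comul I L N : A) * ((-1) ^ ((deg J + deg L) * deg K) * (g J L * g K N)) := by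
    intro I J K
    simp only [Matrix.mul_apply, homTensor, comulMatrix, Fintype.sum_prod_type, Int.cast_comm]
  constructor
  · intro h
    ext ⟨J, K⟩ I
    rw [key, ← h I J K]
    rfl
  · intro h I J K
    rw [← key, ← h]
    rfl

/-- Splitting a monomial of degree at least two into two proper factors determines it. This drives
the induction behind cofreeness of `S(W)`. -/
theorem comul_single_sdiff : ∀ K : Mon, deg K ≠ 1 → ∃ J N : Mon, deg J < deg K ∧ deg N < deg K ∧
    comul K J N ≠ 0 ∧ ∀ L, L ≠ K → comul L J N = 0 := by
  decide +kernel

theorem exists_single_eq : ∀ K : Mon, deg K = 1 → ∃ j, K = single j := by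
  decide +kernel

theorem comul_sq : ∀ K J N : Mon, comul K J N ≠ 0 → comul K J N * comul K J N = 1 := by
  decide +kernel

/-- An endomorphism with vanishing corestriction to `W` that satisfies an identity of
coderivation type vanishes. -/
theorem eq_zero_of_comul (M : Matrix Mon Mon A) (h0 : ∀ j I, M (single j) I = 0)
    (h : ∀ I J K, (∀ L, M J L = 0) → (∀ L, M K L = 0) → ∑ L, (comul L J K : A) * M L I = 0) :
    M = 0 := by
  suffices H : ∀ n, ∀ K, deg K = n → ∀ I, M K I = 0 by
    ext K I
    exact H _ K rfl I
  intro n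
  induction n using Nat.strong_induction_on with
  | _ n ih =>
    intro K hK I
    by_cases h1 : deg K = 1
    · obtain ⟨j, rfl⟩ := exists_single_eq K h1
      exact h0 j I
    · obtain ⟨J, N, hJ, hN, hc, hL⟩ := comul_single_sdiff K h1
      -- The rows of both factors vanish by induction, so the identity reduces to a sign times the
      -- entry in question.
      have e := h I J N (ih _ (hK ▸ hJ) J rfl) (ih _ (hK ▸ hN) N rfl)
      rw [Finset.sum_eq_single K (fun L _ hne => by simp [hL L hne]) (by simp)] at e
      have e2 := congrArg (fun x => (comul K J N : A) * x) e
      simp only [mul_zero, ← mul_assoc, ← Int.cast_mul, comul_sq K J N hc, Int.cast_one,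
        one_mul] at e2
      exact e2

theorem evenTensor_mul_comulMatrix (M : Matrix Mon Mon A) (I J K : Mon) :
    (evenTensor M * comulMatrix A) (J, K) I =
      ∑ L, (comul I L K : A) * ((-1) ^ ((deg J + deg L) * deg K) * M J L) +
      ∑ L, (comul I J L : A) * M K L := by
  simp only [Matrix.mul_apply, evenTensor, comulMatrix, Fintype.sum_prod_type, add_mul, ite_mul,
    zero_mul, Finset.sum_add_distrib]
  congr 1
  · refine Finset.sum_congr rfl fun L _ => ?_
    simp [Int.cast_comm]
  · rw [Finset.sum_comm]
    refine Finset.sum_congr rfl fun L _ => ?_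
    simp [Int.cast_comm]

theorem eq_zero_of_evenCoderivation (M : Matrix Mon Mon A) (h0 : ∀ j I, M (single j) I = 0)
    (h : comulMatrix A * M = evenTensor M * comulMatrix A) : M = 0 := by
  refine eq_zero_of_comul M h0 fun I J K hJ hK => ?_
  have := congrFun (congrFun h (J, K)) I
  rw [evenTensor_mul_comulMatrix] at this
  simpa [hJ, hK, Matrix.mul_apply, comulMatrix] using this

/-- Cofreeness: where the rows of two coderivations agree at both factors, the right-hand sides of
their defining identities agree. -/
theorem eq_of_isOddCoderivation {M N : Matrix Mon Mon A} (hM : IsOddCoderivation M)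
    (hN : IsOddCoderivation N) (h0 : ∀ j I, M (single j) I = N (single j) I) : M = N := by
  rw [← sub_eq_zero]
  refine eq_zero_of_comul _ (fun j I => sub_eq_zero.2 (h0 j I)) fun I J K hJ hK => ?_
  have hJ' : ∀ L, M J L = N J L := fun L => sub_eq_zero.1 (hJ L)
  have hK' : ∀ L, M K L = N K L := fun L => sub_eq_zero.1 (hK L)
  simp only [Matrix.sub_apply, mul_sub, Finset.sum_sub_distrib]
  rw [hM I J K, hN I J K]
  simp [hJ', hK']

theorem sign_mul_sign_mul (m n : ℕ) (a b : A) :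
    (-1) ^ m * a * ((-1) ^ n * b) = (-1) ^ (m + n) * (a * b) := by
  rw [mul_assoc, ← mul_assoc a, neg_one_pow_mul_comm, pow_add]
  simp only [mul_assoc]

theorem neg_sign_mul (n : ℕ) (a : A) : -((-1) ^ n * a) = (-1) ^ (n + 1) * a := by
  rw [pow_succ', mul_assoc, neg_one_mul]

/-- The summand `M ⊗ 1` of `oddTensor M`. -/
def oddLeft (M : Matrix Mon Mon A) : Matrix (Mon × Mon) (Mon × Mon) A := fun p q =>
  if p.2 = q.2 then (-1) ^ ((1 + deg p.1 + deg q.1) * deg p.2) * M p.1 q.1 else 0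

/-- The summand `1 ⊗ M` of `oddTensor M`. -/
def oddRight (M : Matrix Mon Mon A) : Matrix (Mon × Mon) (Mon × Mon) A := fun p q =>
  if p.1 = q.1 then (-1) ^ deg p.1 * M p.2 q.2 else 0

theorem oddTensor_eq (M : Matrix Mon Mon A) : oddTensor M = oddLeft M + oddRight M := rfl

theorem oddLeft_mul_apply (M : Matrix Mon Mon A) (Z : Matrix (Mon × Mon) (Mon × Mon) A)
    (J K : Mon) (q : Mon × Mon) : (oddLeft M * Z) (J, K) q =
      ∑ P, (-1) ^ ((1 + deg J + deg P) * deg K) * M J P * Z (P, K) q := by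
  simp [Matrix.mul_apply, oddLeft, Fintype.sum_prod_type, ite_mul]

theorem oddRight_mul_apply (M : Matrix Mon Mon A) (Z : Matrix (Mon × Mon) (Mon × Mon) A)
    (J K : Mon) (q : Mon × Mon) : (oddRight M * Z) (J, K) q =
      ∑ Q, (-1) ^ deg J * M K Q * Z (J, Q) q := by
  simp only [Matrix.mul_apply, oddRight, Fintype.sum_prod_type, ite_mul, zero_mul]
  rw [Finset.sum_comm]
  simp

theorem mul_oddLeft_apply (M : Matrix Mon Mon A) (Z : Matrix (Mon × Mon) (Mon × Mon) A)
    (p : Mon × Mon) (L N : Mon) : (Z * oddLeft M) p (L, N) =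
      ∑ P, Z p (P, N) * ((-1) ^ ((1 + deg P + deg L) * deg N) * M P L) := by
  simp [Matrix.mul_apply, oddLeft, Fintype.sum_prod_type, mul_ite]

theorem mul_oddRight_apply (M : Matrix Mon Mon A) (Z : Matrix (Mon × Mon) (Mon × Mon) A)
    (p : Mon × Mon) (L N : Mon) : (Z * oddRight M) p (L, N) =
      ∑ Q, Z p (L, Q) * ((-1) ^ deg L * M Q N) := by
  simp only [Matrix.mul_apply, oddRight, Fintype.sum_prod_type, mul_ite, mul_zero]
  rw [Finset.sum_comm]
  simp

variable [Algebra ℂ A] {X : BaseData A} (hX : X.IsLocalBase)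
include hX

/-- For odd `M` the operators `M ⊗ 1` and `1 ⊗ M` anticommute, so the mixed terms `h3` and `h4`
cancel; this uses that the entries of `M` supercommute. -/
theorem oddTensor_sq {M : Matrix Mon Mon A} (hM : IsOddEnd X M) :
    oddTensor M * oddTensor M = evenTensor (M * M) := by
  ext ⟨J, K⟩ ⟨L, N⟩
  rw [oddTensor_eq, add_mul, mul_add, mul_add]
  simp only [Matrix.add_apply, oddLeft_mul_apply, oddRight_mul_apply]
  have h1 : ∑ P, (-1) ^ ((1 + deg J + deg P) * deg K) * M J P * oddLeft M (P, K) (L, N) =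
      if K = N then (-1) ^ ((deg J + deg L) * deg K) * (M * M) J L else 0 := by
    split_ifs with h
    · subst h
      rw [Matrix.mul_apply, Finset.mul_sum]
      refine Finset.sum_congr rfl fun P _ => ?_
      simp only [oddLeft, if_true, sign_mul_sign_mul]
      congr 1
      apply neg_one_pow_congr
      push_cast
      generalize (deg J : ZMod 2) = x, (deg K : ZMod 2) = y, (deg L : ZMod 2) = z,
        (deg P : ZMod 2) = w
      revert x y z w
      decide
    · simp [oddLeft, h]
  have h2 : ∑ Q, (-1) ^ deg J * M K Q * oddRight M (J, Q) (L, N) =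
      if J = L then (M * M) K N else 0 := by
    split_ifs with h
    · subst h
      rw [Matrix.mul_apply]
      refine Finset.sum_congr rfl fun P _ => ?_
      simp only [oddRight, if_true, sign_mul_sign_mul, ← two_mul, pow_mul]
      simp
    · simp [oddRight, h]
  have h3 : ∑ P, (-1) ^ ((1 + deg J + deg P) * deg K) * M J P * oddRight M (P, K) (L, N) =
      (-1) ^ ((1 + deg J + deg L) * deg K + deg L) * (M J L * M K N) := by
    simp [oddRight, mul_ite, sign_mul_sign_mul]
  have h4 : ∑ Q, (-1) ^ deg J * M K Q * oddLeft M (J, Q) (L, N) =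
      -((-1) ^ ((1 + deg J + deg L) * deg K + deg L) * (M J L * M K N)) := by
    simp only [oddLeft, mul_ite, mul_zero, Finset.sum_ite_eq', Finset.mem_univ, if_true,
      sign_mul_sign_mul]
    rw [hX.mul_comm_sign (hM J L) (hM K N), ← mul_assoc, ← pow_add, neg_sign_mul]
    congr 1
    apply neg_one_pow_congr
    push_cast
    generalize (deg J : ZMod 2) = x, (deg K : ZMod 2) = y, (deg L : ZMod 2) = z,
      (deg N : ZMod 2) = w
    revert x y z w
    decide
  rw [h1, h2, h3, h4]
  simp only [evenTensor]
  abel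

/-- Both `(M' ⊗ 1)(g ⊗ g) = M'g ⊗ g` and `(g ⊗ g)(M ⊗ 1) = gM ⊗ g` hold up to Koszul signs, and
likewise for the second factor. -/
theorem homTensor_comm {M M' g : Matrix Mon Mon A} (hM : IsOddEnd X M) (hM' : IsOddEnd X M')
    (hg : IsEvenEnd X g) (h : M' * g = g * M) :
    oddTensor M' * homTensor g = homTensor g * oddTensor M := by
  ext ⟨J, K⟩ ⟨L, N⟩
  rw [oddTensor_eq, oddTensor_eq, add_mul, mul_add]
  simp only [Matrix.add_apply, oddLeft_mul_apply, oddRight_mul_apply, mul_oddLeft_apply,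
    mul_oddRight_apply, homTensor, sign_mul_sign_mul]
  congr 1
  · have e : (-1 : A) ^ ((1 + deg J + deg L) * deg K) * ((M' * g) J L * g K N) =
        (-1) ^ ((1 + deg J + deg L) * deg K) * ((g * M) J L * g K N) := by rw [h]
    simp only [Matrix.mul_apply, Finset.sum_mul, Finset.mul_sum] at e
    refine Eq.trans (Finset.sum_congr rfl fun P _ => ?_)
      (e.trans (Finset.sum_congr rfl fun P _ => ?_))
    · rw [mul_assoc (M' J P)]
      congr 1
      apply neg_one_pow_congr
      push_cast
      generalize (deg J : ZMod 2) = x, (deg K : ZMod 2) = y, (deg L : ZMod 2) = z,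
        (deg P : ZMod 2) = w
      revert x y z w
      decide
    · rw [mul_assoc (g J P), mul_assoc (g J P), hX.mul_comm_sign (hM P L) (hg K N),
        neg_one_pow_mul_comm_left, ← mul_assoc ((-1) ^ _) ((-1) ^ _), ← pow_add]
      congr 1
      apply neg_one_pow_congr
      push_cast
      generalize (deg J : ZMod 2) = x, (deg K : ZMod 2) = y, (deg L : ZMod 2) = z,
        (deg P : ZMod 2) = w, (deg N : ZMod 2) = v
      revert x y z w v
      decide
  · have e : (-1 : A) ^ (deg J + (deg J + deg L) * (1 + deg K)) * (g J L * (M' * g) K N) =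
        (-1) ^ (deg J + (deg J + deg L) * (1 + deg K)) * (g J L * (g * M) K N) := by rw [h]
    simp only [Matrix.mul_apply, Finset.mul_sum] at e
    refine Eq.trans (Finset.sum_congr rfl fun P _ => ?_)
      (e.trans (Finset.sum_congr rfl fun P _ => ?_))
    · rw [← mul_assoc (M' K P), hX.mul_comm_sign (hg J L) (hM' K P), mul_assoc, mul_assoc,
        ← mul_assoc ((-1) ^ _) ((-1) ^ _), ← pow_add]
      congr 1
      apply neg_one_pow_congr
      push_cast
      generalize (deg J : ZMod 2) = x, (deg K : ZMod 2) = y, (deg L : ZMod 2) = z,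
        (deg P : ZMod 2) = w
      revert x y z w
      decide
    · rw [mul_assoc (g J L)]
      congr 1
      apply neg_one_pow_congr
      push_cast
      generalize (deg J : ZMod 2) = x, (deg K : ZMod 2) = y, (deg L : ZMod 2) = z,
        (deg P : ZMod 2) = w
      revert x y z w
      decide

/-- Conjugates of odd coderivations under coalgebra automorphisms are odd coderivations. -/
theorem IsOddCoderivation.conj {M M' g : Matrix Mon Mon A} (hM : IsOddEnd X M)
    (hM' : IsOddEnd X M') (hg : IsEvenEnd X g) (hgc : IsCoalgebraHom g) (hu : IsUnit g)
    (h : M' * g = g * M) (hc : IsOddCoderivation M) : IsOddCoderivation M' := by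
  rw [isOddCoderivation_iff] at hc ⊢
  rw [isCoalgebraHom_iff] at hgc
  obtain ⟨u, rfl⟩ := hu
  -- The identity is proved after right multiplication by `g`, where `g` can be moved through;
  -- invertibility then removes it.
  have key : comulMatrix A * M' * (u : Matrix Mon Mon A) =
      oddTensor M' * comulMatrix A * (u : Matrix Mon Mon A) := by
    rw [Matrix.mul_assoc, h, ← Matrix.mul_assoc, hgc, Matrix.mul_assoc, hc, ← Matrix.mul_assoc,
      ← homTensor_comm hX hM hM' hg h, Matrix.mul_assoc, Matrix.mul_assoc, hgc]
  have := congrArg (· * ((u⁻¹ : (Matrix Mon Mon A)ˣ) : Matrix Mon Mon A)) key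
  simpa [Matrix.mul_assoc] using this

/-- The square of an odd coderivation is an even coderivation. -/
theorem IsOddCoderivation.sq {M : Matrix Mon Mon A} (hM : IsOddEnd X M)
    (hc : IsOddCoderivation M) :
    comulMatrix A * (M * M) = evenTensor (M * M) * comulMatrix A := by
  rw [isOddCoderivation_iff] at hc
  rw [← oddTensor_sq hX hM, ← Matrix.mul_assoc, hc, Matrix.mul_assoc, hc, Matrix.mul_assoc]

end Matrices

/-! ### Odd coderivations and odd cochains -/

section Cochains

/-- The coderivation identity is linear in the cochain, so it suffices to check it on each `φ^P_p`
with integer coefficients. -/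
theorem coderCoeff_coderivation : ∀ (P : Mon) (p : Fin 3) (I J K : Mon),
    ∑ L, comul L J K * coderCoeff P p L I =
      ∑ L, comul I L K * ((-1) ^ ((1 + deg J + deg L) * deg K) * coderCoeff P p J L) +
      ∑ L, comul I J L * ((-1) ^ deg J * coderCoeff P p K L) := by
  decide +kernel

variable {A : Type u} [Ring A]

theorem isOddCoderivation_oddCoder (c : Cochain A) : IsOddCoderivation (oddCoder c) := by
  intro I J K
  have key : ∀ P p, ((∑ L, comul L J K * coderCoeff P p L I : ℤ) : A) * c P p =
      ((∑ L, comul I L K * ((-1) ^ ((1 + deg J + deg L) * deg K) * coderCoeff P p J L) : ℤ) : A) *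
          c P p +
        ((∑ L, comul I J L * ((-1) ^ deg J * coderCoeff P p K L) : ℤ) : A) * c P p := by
    intro P p
    rw [coderCoeff_coderivation, Int.cast_add, add_mul]
  have key2 := Finset.sum_congr rfl fun P (_ : P ∈ Finset.univ) =>
    Finset.sum_congr rfl fun p (_ : p ∈ Finset.univ) => key P p
  simp only [Int.cast_sum, Int.cast_mul, Finset.sum_add_distrib,
    Finset.sum_mul, Int.cast_pow, Int.cast_neg, Int.cast_one] at key2
  simp only [oddCoder_eq, Finset.mul_sum]
  have swap : ∀ F : Mon → Mon → Fin 3 → A,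
      ∑ L, ∑ P, ∑ p, F L P p = ∑ P, ∑ p, ∑ L, F L P p := by
    intro F
    rw [Finset.sum_comm]
    exact Finset.sum_congr rfl fun P _ => Finset.sum_comm
  rw [swap, swap, swap]
  simpa only [mul_assoc] using key2

/-- The cochain of an odd coderivation. -/
def cochainOf (M : Matrix Mon Mon A) : Cochain A := fun J j => (-1) ^ deg J * M (single j) J

/-- Both sides are odd coderivations with the same corestriction, so cofreeness applies. -/
theorem oddCoder_cochainOf {M : Matrix Mon Mon A} (h : IsOddCoderivation M) :
    oddCoder (cochainOf M) = M := by
  refine eq_of_isOddCoderivation (isOddCoderivation_oddCoder _) h fun j I => ?_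
  rw [oddCoder_single, cochainOf, ← mul_assoc, ← pow_add, ← two_mul, pow_mul]
  simp

theorem cochainOf_oddCoder (c : Cochain A) : cochainOf (oddCoder c) = c := by
  funext J j
  rw [cochainOf, oddCoder_single, ← mul_assoc, ← pow_add, ← two_mul, pow_mul]
  simp

variable [Algebra ℂ A] {X : BaseData A}

/-- Odd cochains: the coefficient of `φ^J_j` has parity `|J|`. -/
def IsOddCochain (X : BaseData A) (c : Cochain A) : Prop := ∀ J j, c J j ∈ X.part (deg J : ℕ)

theorem coderCoeff_parity : ∀ (J : Mon) (j : Fin 3) (K I : Mon), coderCoeff J j K I ≠ 0 →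
    ((deg J : ℕ) : ZMod 2) = ((1 + deg K + deg I : ℕ) : ZMod 2) := by
  decide +kernel

theorem IsOddCochain.isOddEnd {c : Cochain A} (hc : IsOddCochain X c) :
    IsOddEnd X (oddCoder c) := by
  intro K I
  rw [oddCoder_eq]
  refine Submodule.sum_mem _ fun J _ => Submodule.sum_mem _ fun j _ => ?_
  by_cases h : coderCoeff J j K I = 0
  · simp [h]
  · rw [← coderCoeff_parity J j K I h, ← zsmul_eq_mul]
    exact zsmul_mem (hc J j) _

theorem isOddCochain_cochainOf (hX : X.IsLocalBase) {M : Matrix Mon Mon A} (h : IsOddEnd X M) :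
    IsOddCochain X (cochainOf M) := by
  intro J j
  have e := hX.mul_mem (hX.neg_one_pow_mem (deg J)) (h (single j) J)
  rw [zero_add] at e
  rw [cochainOf]
  convert e using 2
  push_cast [deg_single]
  generalize (deg J : ZMod 2) = x
  revert x
  decide

/-- The square is an even coderivation whose corestriction to `W` is the half bracket, and an even
coderivation with zero corestriction vanishes. -/
theorem oddCoder_sq_eq_zero (hX : X.IsLocalBase) {c : Cochain A} (hc : IsOddCochain X c)
    (h : halfBracket c = 0) : oddCoder c * oddCoder c = 0 :=
  eq_zero_of_evenCoderivation _ (fun j I => congrFun (congrFun h I) j)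
    ((isOddCoderivation_oddCoder c).sq hX hc.isOddEnd)

end Cochains

/-! ## Coordinates on explicit monomials -/

theorem Mon.ne :
    e1 ≠ e2 ∧ e1 ≠ e3 ∧ e1 ≠ e12 ∧ e1 ≠ e13 ∧ e1 ≠ e23 ∧ e1 ≠ e123 ∧ e2 ≠ e1 ∧ e2 ≠ e3 ∧ e2 ≠
    e12 ∧ e2 ≠ e13 ∧ e2 ≠ e23 ∧ e2 ≠ e123 ∧ e3 ≠ e1 ∧ e3 ≠ e2 ∧ e3 ≠ e12 ∧ e3 ≠ e13 ∧ e3 ≠ e23 ∧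
    e3 ≠ e123 ∧ e12 ≠ e1 ∧ e12 ≠ e2 ∧ e12 ≠ e3 ∧ e12 ≠ e13 ∧ e12 ≠ e23 ∧ e12 ≠ e123 ∧ e13 ≠ e1 ∧
    e13 ≠ e2 ∧ e13 ≠ e3 ∧ e13 ≠ e12 ∧ e13 ≠ e23 ∧ e13 ≠ e123 ∧ e23 ≠ e1 ∧ e23 ≠ e2 ∧ e23 ≠ e3 ∧
    e23 ≠ e12 ∧ e23 ≠ e13 ∧ e23 ≠ e123 ∧ e123 ≠ e1 ∧ e123 ≠ e2 ∧ e123 ≠ e3 ∧ e123 ≠ e12 ∧ e123 ≠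
    e13 ∧ e123 ≠ e23 := by
  repeat' constructor
  all_goals decide

theorem forall_fin_three {p : Fin 3 → Prop} (h0 : p 0) (h1 : p 1) (h2 : p 2) (j : Fin 3) : p j := by
  fin_cases j <;> assumption

/-- Each of these pairs of factors occurs in a single coproduct, so the corresponding row of a
coderivation can be read off from rows of lower degree. -/
theorem comul_e1_e2 : ∀ L, comul L e1 e2 = if L = e12 then 1 else 0 := by decide +kernel
theorem comul_e1_e3 : ∀ L, comul L e1 e3 = if L = e13 then 1 else 0 := by decide +kernel
theorem comul_e2_e3 : ∀ L, comul L e2 e3 = if L = e23 then 1 else 0 := by decide +kernel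
theorem comul_e1_e23 : ∀ L, comul L e1 e23 = if L = e123 then 1 else 0 := by decide +kernel
theorem comul_e23_left (L J : Mon) : comul e23 L J =
    if L = e2 ∧ J = e3 then 1 else if L = e3 ∧ J = e2 then -1 else 0 := by
  revert L J; decide +kernel
theorem comul_e123_left (L J : Mon) : comul e123 L J =
    if L = e1 ∧ J = e23 then 1 else if L = e2 ∧ J = e13 then -1 else if L = e3 ∧ J = e12 then 1
    else if L = e12 ∧ J = e3 then 1 else if L = e13 ∧ J = e2 then -1
    else if L = e23 ∧ J = e1 then 1 else 0 := by
  revert L J; decide +kernel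

section

variable {A : Type u}

theorem Cochain.ext_mon {c c' : Cochain A} (h1 : ∀ j, c e1 j = c' e1 j)
    (h2 : ∀ j, c e2 j = c' e2 j) (h3 : ∀ j, c e3 j = c' e3 j) (h12 : ∀ j, c e12 j = c' e12 j)
    (h13 : ∀ j, c e13 j = c' e13 j) (h23 : ∀ j, c e23 j = c' e23 j)
    (h123 : ∀ j, c e123 j = c' e123 j) : c = c' := by
  funext J
  exact Mon.cases (p := fun J => c J = c' J) (funext h1) (funext h2) (funext h3) (funext h12)
    (funext h13) (funext h23) (funext h123) J

variable [Ring A] [Algebra ℂ A]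

omit [Algebra ℂ A] in
theorem deltaCoord_eq (c : Cochain A) : deltaCoord c =
    ![c e12 0 - c e23 2, c e13 0 + c e23 1, -c e13 2, c e12 2, c e13 1, c e2 1 + c e3 2, -c e3 2,
      c e2 0, c e2 2, c e3 0, c e3 1, c e123 1, c e123 2] := rfl

omit [Ring A] [Algebra ℂ A] in
theorem betaCoord_eq (c : Cochain A) :
    betaCoord c = ![c e23 0, c e23 1, c e23 2, c e123 0] := rfl

omit [Algebra ℂ A] in
theorem gammaCoord_eq (c : Cochain A) : gammaCoord c =
    ![c e1 0 - c e2 1 - c e3 2, c e1 1, c e1 2, c e12 1 + c e13 2] := rfl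

/-! ### Normal forms of deformations -/

/-- The cochain with `δ`-coordinates `u` whose `β`-coordinates are those of `d₁` and for which the
`β`-coordinates of the half bracket vanish. -/
def slice (u : Fin 13 → A) : Cochain A := fun J =>
  if J = e1 then ![u 5 - u 0 * u 9 + u 1 * u 7,
    -((u 2 - u 7 * u 11 - u 9 * u 12) * u 9) + u 4 * u 7, -(u 3 * u 9) - u 2 * u 7]
  else if J = e2 then ![u 7, u 5 + u 6, u 8]
  else if J = e3 then ![u 9, u 10, -u 6]
  else if J = e12 then ![u 0, u 2 - u 7 * u 11 - u 9 * u 12, u 3]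
  else if J = e13 then ![u 1, u 4, -u 2]
  else if J = e23 then ![1, 0, 0]
  else ![0, u 11, u 12]

section

variable (u : Fin 13 → A)
omit [Algebra ℂ A]

@[simp] theorem slice_e1 : slice u e1 = ![u 5 - u 0 * u 9 + u 1 * u 7,
    -((u 2 - u 7 * u 11 - u 9 * u 12) * u 9) + u 4 * u 7, -(u 3 * u 9) - u 2 * u 7] := rfl
@[simp] theorem slice_e2 : slice u e2 = ![u 7, u 5 + u 6, u 8] := rfl
@[simp] theorem slice_e3 : slice u e3 = ![u 9, u 10, -u 6] := rfl
@[simp] theorem slice_e12 : slice u e12 = ![u 0, u 2 - u 7 * u 11 - u 9 * u 12, u 3] := rfl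
@[simp] theorem slice_e13 : slice u e13 = ![u 1, u 4, -u 2] := rfl
@[simp] theorem slice_e23 : slice u e23 = ![1, 0, 0] := rfl
@[simp] theorem slice_e123 : slice u e123 = ![0, u 11, u 12] := rfl

/-- The correction terms lie in the `γ`-directions, which the `δ`-coordinates do not see. -/
theorem deltaCoord_slice : deltaCoord (slice u) = u := by
  funext i
  fin_cases i <;> simp [deltaCoord_eq]

end

theorem map_slice {B : Type*} [Ring B] [Algebra ℂ B] (f : A →ₐ[ℂ] B) (u : Fin 13 → A) :
    (fun J j => f (slice u J j)) = slice (fun i => f (u i)) := by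
  apply Cochain.ext_mon <;> intro j <;> fin_cases j <;> simp

/-- The parity of the parameters. -/
def parParity : Fin 13 → ZMod 2 := ![0, 0, 0, 0, 0, 1, 1, 1, 1, 1, 1, 1, 1]

variable {X : BaseData A}

theorem deltaCoord_mem {c : Cochain A} (hc : IsOddCochain X c) (i : Fin 13) :
    deltaCoord c i ∈ X.part (parParity i) := by
  have h1 : ∀ j, c e1 j ∈ X.part 1 := fun j => by simpa using hc e1 j
  have h2 : ∀ j, c e2 j ∈ X.part 1 := fun j => by simpa using hc e2 j
  have h3 : ∀ j, c e3 j ∈ X.part 1 := fun j => by simpa using hc e3 j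
  have h12 : ∀ j, c e12 j ∈ X.part 0 := fun j => hc e12 j
  have h13 : ∀ j, c e13 j ∈ X.part 0 := fun j => hc e13 j
  have h23 : ∀ j, c e23 j ∈ X.part 0 := fun j => hc e23 j
  have h123 : ∀ j, c e123 j ∈ X.part 1 := fun j => hc e123 j
  rw [deltaCoord_eq]
  fin_cases i
  · exact sub_mem (h12 0) (h23 2)
  · exact add_mem (h13 0) (h23 1)
  · exact neg_mem (h13 2)
  · exact h12 2
  · exact h13 1
  · exact add_mem (h2 1) (h3 2)
  · exact neg_mem (h3 2)
  · exact h2 0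
  · exact h2 2
  · exact h3 0
  · exact h3 1
  · exact h123 1
  · exact h123 2

theorem isOddCochain_slice (hX : X.IsLocalBase) {u : Fin 13 → A} (hu : ∀ i, u i ∈ X.part (parParity i)) :
    IsOddCochain X (slice u) := by
  have h0 : ∀ {a b : A}, a ∈ X.part 1 → b ∈ X.part 1 → a * b ∈ X.part 0 :=
    fun ha hb => hX.mul_mem ha hb
  have h1 : ∀ {a b : A}, a ∈ X.part 0 → b ∈ X.part 1 → a * b ∈ X.part 1 :=
    fun ha hb => hX.mul_mem ha hb
  have h2 : u 2 - u 7 * u 11 - u 9 * u 12 ∈ X.part 0 :=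
    sub_mem (sub_mem (hu 2) (h0 (hu 7) (hu 11))) (h0 (hu 9) (hu 12))
  intro J
  refine Mon.cases (p := fun J => ∀ j, slice u J j ∈ X.part (deg J : ℕ)) ?_ ?_ ?_ ?_ ?_ ?_ ?_ J <;>
    intro j <;> fin_cases j
  · exact add_mem (sub_mem (hu 5) (h1 (hu 0) (hu 9))) (h1 (hu 1) (hu 7))
  · exact add_mem (neg_mem (h1 h2 (hu 9))) (h1 (hu 4) (hu 7))
  · exact sub_mem (neg_mem (h1 (hu 3) (hu 9))) (h1 (hu 2) (hu 7))
  · exact hu 7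
  · exact add_mem (hu 5) (hu 6)
  · exact hu 8
  · exact hu 9
  · exact hu 10
  · exact neg_mem (hu 6)
  · exact hu 0
  · exact h2
  · exact hu 3
  · exact hu 1
  · exact hu 4
  · exact neg_mem (hu 2)
  · exact hX.one_mem
  · exact zero_mem _
  · exact zero_mem _
  · exact zero_mem _
  · exact hu 11
  · exact hu 12

variable (hX : X.IsLocalBase)
include hX

/-- An odd cochain with the `β`-coordinates of `d₁` is determined by its `δ`-coordinates as soon as
the `β`-coordinates of its half bracket vanish. -/
theorem eq_slice {c : Cochain A} (hc : IsOddCochain X c) (hb : betaCoord c = ![1, 0, 0, 0])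
    (hh : betaCoord (halfBracket c) = 0) : c = slice (deltaCoord c) := by
  have b0 : c e23 0 = 1 := congrFun hb 0
  have b1 : c e23 1 = 0 := congrFun hb 1
  have b2 : c e23 2 = 0 := congrFun hb 2
  have b3 : c e123 0 = 0 := congrFun hb 3
  have k0 : halfBracket c e23 0 = 0 := congrFun hh 0
  have k1 : halfBracket c e23 1 = 0 := congrFun hh 1
  have k2 : halfBracket c e23 2 = 0 := congrFun hh 2
  have k3 : halfBracket c e123 0 = 0 := congrFun hh 3
  have hcomm : c e12 0 * c e13 0 = c e13 0 * c e12 0 := hX.even_comm (hc e12 0) _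
  rw [halfBracket_e23] at k0 k1 k2
  rw [halfBracket_e123] at k3
  simp only [b0, b1, b2, b3, mul_zero, mul_one, one_mul, zero_mul, add_zero, sub_zero, hcomm] at k0 k1 k2 k3
  -- The four equations are triangular: this one gives the coefficient of `φ^{110}_2`, which enters
  -- the equation `g1` for that of `φ^{100}_2`.
  have g3 : c e12 1 = -c e13 2 - c e2 0 * c e123 1 - c e3 0 * c e123 2 := by
    rw [← sub_eq_zero, ← k3]
    abel
  have g0 : c e1 0 = c e2 1 + c e3 2 - c e12 0 * c e3 0 + c e13 0 * c e2 0 := by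
    rw [← sub_eq_zero, ← neg_eq_zero, ← k0]
    abel
  have g1 : c e1 1 = -(c e12 1 * c e3 0) + c e13 1 * c e2 0 := by
    rw [← sub_eq_zero, ← neg_eq_zero, ← k1]
    abel
  have g2 : c e1 2 = -(c e12 2 * c e3 0) + c e13 2 * c e2 0 := by
    rw [← sub_eq_zero, ← neg_eq_zero, ← k2]
    abel
  rw [g3] at g1
  rw [deltaCoord_eq]
  apply Cochain.ext_mon <;> intro j <;> fin_cases j <;>
    simp [b0, b1, b2, b3, g0, g1, g2, g3, sub_eq_add_neg]

/-- The `γ`-components of `slice` solve these four equations; the only products to be interchanged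
are those of the even `u 0` and `u 1`. -/
theorem betaCoord_halfBracket_slice {u : Fin 13 → A} (hu : ∀ i, u i ∈ X.part (parParity i)) :
    betaCoord (halfBracket (slice u)) = 0 := by
  have hcomm : u 0 * u 1 = u 1 * u 0 := hX.even_comm (hu 0) _
  rw [betaCoord_eq]
  funext i
  fin_cases i
  · simp [halfBracket_e23]
    abel
  · simp [halfBracket_e23]
  · simp [halfBracket_e23]
  · simp [halfBracket_e123, hcomm]
    abel

/-- If the `δ`-coordinates of the half bracket of `slice u` vanish, then so does the half
bracket. -/
theorem halfBracket_slice_eq_zero {u : Fin 13 → A} (hu : ∀ i, u i ∈ X.part (parParity i))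
    (hd : deltaCoord (halfBracket (slice u)) = 0) : halfBracket (slice u) = 0 := by
  set c := slice u with hcdef
  have hc : IsOddCochain X c := isOddCochain_slice hX hu
  have hb := betaCoord_halfBracket_slice hX hu
  rw [← hcdef] at hb
  set h := halfBracket c with hh
  set H := oddCoder c * oddCoder c with hH
  have hHh : ∀ j J, H (single j) J = h J j := fun j J => rfl
  have b0 : h e23 0 = 0 := congrFun hb 0
  have b1 : h e23 1 = 0 := congrFun hb 1
  have b2 : h e23 2 = 0 := congrFun hb 2
  have b3 : h e123 0 = 0 := congrFun hb 3
  rw [deltaCoord_eq] at hd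
  have δ0 : h e12 0 - h e23 2 = 0 := congrFun hd 0
  have δ1 : h e13 0 + h e23 1 = 0 := congrFun hd 1
  have δ2 : -h e13 2 = 0 := congrFun hd 2
  have δ3 : h e12 2 = 0 := congrFun hd 3
  have δ4 : h e13 1 = 0 := congrFun hd 4
  have δ5 : h e2 1 + h e3 2 = 0 := congrFun hd 5
  have δ6 : -h e3 2 = 0 := congrFun hd 6
  have δ7 : h e2 0 = 0 := congrFun hd 7
  have δ8 : h e2 2 = 0 := congrFun hd 8
  have δ9 : h e3 0 = 0 := congrFun hd 9
  have δ10 : h e3 1 = 0 := congrFun hd 10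
  have δ11 : h e123 1 = 0 := congrFun hd 11
  have δ12 : h e123 2 = 0 := congrFun hd 12
  rw [b2, sub_zero] at δ0
  rw [b1, add_zero] at δ1
  rw [neg_eq_zero] at δ2 δ6
  rw [δ6, add_zero] at δ5
  have hcod := (isOddCoderivation_oddCoder c).sq hX hc.isOddEnd
  have hco : ∀ I J K : Mon, ∑ L, (comul L J K : A) * H L I =
      ∑ L, (comul I L K : A) * ((-1) ^ ((deg J + deg L) * deg K) * H J L) +
      ∑ L, (comul I J L : A) * H K L := by
    intro I J K
    rw [← evenTensor_mul_comulMatrix, ← hcod]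
    rfl
  -- The Bianchi identity: a square commutes with its root. Only the values `h e12 1` and `h e1 j`,
  -- which carry the `γ`-coordinates, are still unknown.
  have hcomm : H * oddCoder c = oddCoder c * H := Matrix.mul_assoc _ _ _
  clear_value H h
  have r1 : ∀ J, H e1 J = h J 0 := hHh 0
  have r2 : ∀ J, H e2 J = h J 1 := hHh 1
  have r3 : ∀ J, H e3 J = h J 2 := hHh 2
  -- The coderivation property computes the remaining entries of `H` in the columns of `f₂f₃` and
  -- `f₁f₂f₃` from its corestriction.
  have p1 : H e12 e23 = 0 := by
    have := hco e23 e1 e2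
    simpa [Mon.sum_eq, comul_e1_e2, comul_e23_left, Mon.ne, r1, r2, δ9] using this
  have p2 : H e13 e23 = 0 := by
    have := hco e23 e1 e3
    simpa [Mon.sum_eq, comul_e1_e3, comul_e23_left, Mon.ne, r1, r3, δ7] using this
  have p3 : H e23 e23 = 0 := by
    have := hco e23 e2 e3
    simpa [Mon.sum_eq, comul_e2_e3, comul_e23_left, Mon.ne, r2, r3, δ5, δ6] using this
  have p4 : H e123 e23 = 0 := by
    have := hco e23 e1 e23
    simpa [Mon.sum_eq, comul_e1_e23, comul_e23_left, Mon.ne] using this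
  have q1 : H e12 e123 = 0 := by
    have := hco e123 e1 e2
    simpa [Mon.sum_eq, comul_e1_e2, comul_e123_left, Mon.ne, r1, r2, δ1, b1] using this
  have q2 : H e13 e123 = 0 := by
    have := hco e123 e1 e3
    simpa [Mon.sum_eq, comul_e1_e3, comul_e123_left, Mon.ne, r1, r3, δ0, b2] using this
  have q3 : H e23 e123 = -h e12 1 := by
    have := hco e123 e2 e3
    simpa [Mon.sum_eq, comul_e2_e3, comul_e123_left, Mon.ne, r2, r3, δ2, pow_succ] using this
  -- In this entry of the Bianchi identity all terms vanish but `H e23 e123 = -h e12 1`, multiplied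
  -- by the coefficient 1 of `d₁`.
  have h121 : h e12 1 = 0 := by
    have e := congrFun (congrFun hcomm e1) e123
    simpa [Matrix.mul_apply, Mon.sum_eq, r1, r2, r3, q1, q2, q3, b0, b3, δ0, δ1, δ7, δ9, δ11, δ12, hcdef]
      using e.symm
  -- In the column of `f₂f₃` the coefficient 1 of `d₁` multiplies `h e1 j`, and every other term is
  -- already zero.
  have h1 : ∀ j, h e1 j = 0 := by
    intro j
    have e := congrFun (congrFun hcomm (single j)) e23
    have hb' : h e23 j = 0 :=
      forall_fin_three (p := fun j => h e23 j = 0) b0 b1 b2 j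
    have h12' : h e12 j = 0 :=
      forall_fin_three (p := fun j => h e12 j = 0) δ0 h121 δ3 j
    have h13' : h e13 j = 0 :=
      forall_fin_three (p := fun j => h e13 j = 0) δ1 δ4 δ2 j
    simp only [Matrix.mul_apply, Mon.sum_eq, oddCoder_single] at e
    simpa [hHh, r1, r2, r3, h13', p1, p2, p3, p4, b0, b1, b2, hcdef, hb', h12', oddCoder_single] using e
  apply Cochain.ext_mon
  · exact h1
  · exact forall_fin_three δ7 δ5 δ8
  · exact forall_fin_three δ9 δ10 δ6
  · exact forall_fin_three δ0 h121 δ3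
  · exact forall_fin_three δ1 δ4 δ2
  · exact forall_fin_three b0 b1 b2
  · exact forall_fin_three b3 δ11 δ12

end

/-! ## The adapted basis and the cohomology of `d₁` -/

section

variable {A : Type u} [Ring A]

theorem phi_eq_of_exponents (I : Mon) (i : Fin 3 → ℕ) (hi : ∀ q, i q = if q ∈ I.1 then 1 else 0)
    (j : ℕ) (a : A) (J : Mon) (k : Fin 3) :
    phi i j a J k = if J = I ∧ (k : ℕ) + 1 = j then a else 0 := by
  have : (∀ q, i q = if q ∈ J.1 then 1 else 0) ↔ J = I := by
    constructor
    · intro h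
      apply Subtype.ext
      ext q
      have := (h q).symm.trans (hi q)
      by_cases h1 : q ∈ J.1 <;> by_cases h2 : q ∈ I.1 <;> simp_all
    · rintro rfl
      exact hi
  simp only [phi, this]

variable (j : ℕ) (a : A) (J : Mon) (k : Fin 3)

theorem phi_100 : phi ![1, 0, 0] j a J k = if J = e1 ∧ (k : ℕ) + 1 = j then a else 0 :=
  phi_eq_of_exponents e1 _ (by decide) j a J k
theorem phi_010 : phi ![0, 1, 0] j a J k = if J = e2 ∧ (k : ℕ) + 1 = j then a else 0 :=
  phi_eq_of_exponents e2 _ (by decide) j a J k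
theorem phi_001 : phi ![0, 0, 1] j a J k = if J = e3 ∧ (k : ℕ) + 1 = j then a else 0 :=
  phi_eq_of_exponents e3 _ (by decide) j a J k
theorem phi_110 : phi ![1, 1, 0] j a J k = if J = e12 ∧ (k : ℕ) + 1 = j then a else 0 :=
  phi_eq_of_exponents e12 _ (by decide) j a J k
theorem phi_101 : phi ![1, 0, 1] j a J k = if J = e13 ∧ (k : ℕ) + 1 = j then a else 0 :=
  phi_eq_of_exponents e13 _ (by decide) j a J k
theorem phi_011 : phi ![0, 1, 1] j a J k = if J = e23 ∧ (k : ℕ) + 1 = j then a else 0 :=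
  phi_eq_of_exponents e23 _ (by decide) j a J k
theorem phi_111 : phi ![1, 1, 1] j a J k = if J = e123 ∧ (k : ℕ) + 1 = j then a else 0 :=
  phi_eq_of_exponents e123 _ (by decide) j a J k

end

section

variable {A : Type u} [Ring A] [Algebra ℂ A]

theorem sum_tensor_delta_apply (u : Fin 13 → A) :
    ∑ i, tensor (delta i) (u i) = fun J =>
      if J = e1 then ![u 5, 0, 0]
      else if J = e2 then ![u 7, u 5 + u 6, u 8]
      else if J = e3 then ![u 9, u 10, -u 6]
      else if J = e12 then ![u 0, u 2, u 3]
      else if J = e13 then ![u 1, u 4, -u 2]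
      else if J = e23 then ![0, 0, 0]
      else ![0, u 11, u 12] := by
  apply Cochain.ext_mon <;> intro j <;> fin_cases j <;>
    simp [Fin.sum_univ_succ, delta, tensor, phi_100, phi_010, phi_001, phi_110, phi_101, phi_011,
      phi_111, Mon.ne]

theorem sum_tensor_beta_apply (u : Fin 4 → A) :
    ∑ i, tensor (beta i) (u i) = fun J =>
      if J = e12 then ![u 2, 0, 0]
      else if J = e13 then ![-u 1, 0, 0]
      else if J = e23 then ![u 0, u 1, u 2]
      else if J = e123 then ![u 3, 0, 0]
      else 0 := by
  apply Cochain.ext_mon <;> intro j <;> fin_cases j <;>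
    simp [Fin.sum_univ_succ, beta, tensor, phi_100, phi_010, phi_001, phi_110, phi_101, phi_011,
      phi_111, Mon.ne]

theorem sum_tensor_gamma_apply (u : Fin 4 → A) :
    ∑ i, tensor (gamma i) (u i) = fun J =>
      if J = e1 then ![u 0, u 1, u 2]
      else if J = e12 then ![0, u 3, 0]
      else 0 := by
  apply Cochain.ext_mon <;> intro j <;> fin_cases j <;>
    simp [Fin.sum_univ_succ, gamma, tensor, phi_100, phi_010, phi_001, phi_110, phi_101, phi_011,
      phi_111, Mon.ne]

theorem eq_sum_coord (c : Cochain A) :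
    c = ∑ i, tensor (delta i) (deltaCoord c i) + ∑ k, tensor (beta k) (betaCoord c k) +
      ∑ k, tensor (gamma k) (gammaCoord c k) := by
  rw [sum_tensor_delta_apply, sum_tensor_beta_apply, sum_tensor_gamma_apply, deltaCoord_eq,
    betaCoord_eq, gammaCoord_eq]
  apply Cochain.ext_mon <;> intro j <;> fin_cases j <;> simp [Mon.ne]

end

theorem tensor_complex (c : Cochain ℂ) (a : ℂ) : tensor c a = a • c := by
  funext J j
  simp [tensor, mul_comm]

/-- The coordinate formulas show that these 21 cochains span, and the space has dimension 7 · 3 =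
21. -/
theorem linearIndependent_basis :
    LinearIndependent ℂ (Sum.elim delta (Sum.elim beta gamma)) := by
  apply linearIndependent_of_top_le_span_of_card_eq_finrank
  · intro c _
    rw [eq_sum_coord c]
    simp only [tensor_complex]
    have h : ∀ i, Sum.elim delta (Sum.elim beta gamma) i ∈
        Submodule.span ℂ (Set.range (Sum.elim delta (Sum.elim beta gamma))) :=
      fun i => Submodule.subset_span ⟨i, rfl⟩
    refine add_mem (add_mem ?_ ?_) ?_ <;> refine Submodule.sum_mem _ fun i _ =>
      Submodule.smul_mem _ _ ?_
    · exact h (Sum.inl i)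
    · exact h (Sum.inr (Sum.inl i))
    · exact h (Sum.inr (Sum.inr i))
  · have : Fintype.card Mon = 7 := by decide +kernel
    simp [Module.finrank_pi_fintype, this]

/-- The integer coefficients of `gammaCoord`. -/
def gammaCoeff (k : Fin 4) (J : Mon) (j : Fin 3) : ℤ :=
  ![if J = e1 ∧ j = 0 then 1 else if J = e2 ∧ j = 1 ∨ J = e3 ∧ j = 2 then -1 else 0,
    if J = e1 ∧ j = 1 then 1 else 0, if J = e1 ∧ j = 2 then 1 else 0,
    if J = e12 ∧ j = 1 ∨ J = e13 ∧ j = 2 then 1 else 0] k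

/-- The integer entries of `beta`. -/
def betaEntry (k : Fin 4) (I : Mon) (l : Fin 3) : ℤ :=
  ![if I = e23 ∧ l = 0 then 1 else 0,
    if I = e13 ∧ l = 0 then -1 else if I = e23 ∧ l = 1 then 1 else 0,
    if I = e12 ∧ l = 0 ∨ I = e23 ∧ l = 2 then 1 else 0,
    if I = e123 ∧ l = 0 then 1 else 0] k

theorem bracket_coderBasis_d1 : ∀ (J : Mon) (j : Fin 3) (I : Mon) (l : Fin 3),
    (coderBasis J j * coderBasis e23 0 -
      (-1 : ℤ) ^ ((deg J + 1) * (deg e23 + 1)) • (coderBasis e23 0 * coderBasis J j))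
        (single l) I = ∑ k, gammaCoeff k J j * betaEntry k I l := by
  decide +kernel

theorem gammaCoord_eq_sum (c : Cochain ℂ) (k : Fin 4) :
    gammaCoord c k = ∑ J, ∑ j, c J j * (gammaCoeff k J j : ℂ) := by
  rw [gammaCoord_eq]
  fin_cases k <;> (simp [Mon.sum_eq, Fin.sum_univ_three, gammaCoeff, Mon.ne]; try ring)

theorem beta_apply (k : Fin 4) (I : Mon) (l : Fin 3) : beta k I l = (betaEntry k I l : ℂ) := by
  revert I l
  fin_cases k <;> apply Mon.cases <;> intro l <;> fin_cases l <;>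
    simp [beta, betaEntry, phi_011, phi_101, phi_110, phi_111, Mon.ne]

/-- This displays `D` as an operator of rank four; kernel, image and the pairing of `γ_k` with `β_k`
can all be read from it. -/
theorem coboundary_d1 (c : Cochain ℂ) : coboundary d1 c = ∑ k, gammaCoord c k • beta k := by
  funext I l
  have h : coboundary d1 c I l =
      ∑ J, ∑ j, c J j * ((∑ k, gammaCoeff k J j * betaEntry k I l : ℤ) : ℂ) := by
    change bracket c d1 I l = _
    simp only [bracket]
    refine Finset.sum_congr rfl fun J _ => Finset.sum_congr rfl fun j _ => ?_
    rw [Finset.sum_eq_single e23, Finset.sum_eq_single 0, bracket_coderBasis_d1]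
    · simp [d1, phi_011]
    · intro k _ hk
      have : (k : ℕ) ≠ 0 := fun h => hk (Fin.ext h)
      simp [d1, phi_011, this]
    · simp
    · intro K _ hK
      simp [d1, phi_011, hK]
    · simp
  rw [h, Finset.sum_apply, Finset.sum_apply]
  simp only [Pi.smul_apply, smul_eq_mul, beta_apply, gammaCoord_eq_sum, Finset.sum_mul,
    Int.cast_sum, Int.cast_mul, Finset.mul_sum, mul_assoc]
  rw [Finset.sum_comm (s := (Finset.univ : Finset (Fin 4)))]
  exact Finset.sum_congr rfl fun J _ => Finset.sum_comm

theorem gammaCoord_delta (i : Fin 13) : gammaCoord (delta i) = 0 := by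
  rw [gammaCoord_eq]
  funext k
  fin_cases i <;> fin_cases k <;>
    simp [delta, phi_100, phi_010, phi_001, phi_110, phi_101, phi_011, phi_111, Mon.ne]

theorem gammaCoord_beta (i : Fin 4) : gammaCoord (beta i) = 0 := by
  rw [gammaCoord_eq]
  funext k
  fin_cases i <;> fin_cases k <;>
    simp [beta, phi_100, phi_010, phi_001, phi_110, phi_101, phi_011, phi_111, Mon.ne]

theorem gammaCoord_gamma (i : Fin 4) : gammaCoord (gamma i) = Pi.single i 1 := by
  rw [gammaCoord_eq]
  funext k
  fin_cases i <;> fin_cases k <;>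
    simp [gamma, phi_100, phi_010, phi_001, phi_110, phi_101, phi_011, phi_111, Mon.ne]

theorem deltaCoord_beta (i : Fin 4) : deltaCoord (beta i) = 0 := by
  rw [deltaCoord_eq]
  funext k
  fin_cases i <;> fin_cases k <;>
    simp [beta, phi_100, phi_010, phi_001, phi_110, phi_101, phi_011, phi_111, Mon.ne]

theorem deltaCoord_delta (i : Fin 13) : deltaCoord (delta i) = Pi.single i 1 := by
  have h : delta i = ∑ j, tensor (delta j) ((Pi.single i 1 : Fin 13 → ℂ) j) := by
    simp [tensor_complex, Pi.single_apply]
  rw [h, sum_tensor_delta_apply, deltaCoord_eq]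
  generalize (Pi.single i 1 : Fin 13 → ℂ) = u
  funext k
  fin_cases k <;> simp [Mon.ne]

theorem coboundary_delta (i : Fin 13) : coboundary d1 (delta i) = 0 := by
  simp [coboundary_d1, gammaCoord_delta]

theorem coboundary_gamma (k : Fin 4) : coboundary d1 (gamma k) = beta k := by
  simp [coboundary_d1, gammaCoord_gamma, Pi.single_apply]

theorem coboundary_beta (k : Fin 4) : coboundary d1 (beta k) = 0 := by
  simp [coboundary_d1, gammaCoord_beta]

/-- The degree of `δ_i`. -/
def deltaDeg : Fin 13 → ℕ := ![2, 2, 2, 2, 2, 1, 1, 1, 1, 1, 1, 3, 3]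

/-- The degree of `β_k`. -/
def betaDeg : Fin 4 → ℕ := ![2, 2, 2, 3]

theorem mem_cochains_iff {n : ℕ} {c : Cochain ℂ} :
    c ∈ cochains n ↔ ∀ J j, deg J ≠ n → c J j = 0 := Iff.rfl

theorem delta_mem (i : Fin 13) : delta i ∈ cochains (deltaDeg i) := by
  rw [mem_cochains_iff]
  fin_cases i <;> apply Mon.cases <;> intro j h <;>
    simp [delta, deltaDeg, phi_100, phi_010, phi_001, phi_110, phi_101, phi_011, phi_111,
      Mon.ne] at h ⊢

theorem gamma_mem (k : Fin 4) : gamma k ∈ cochains (betaDeg k - 1) := by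
  rw [mem_cochains_iff]
  fin_cases k <;> apply Mon.cases <;> intro j h <;>
    simp [gamma, betaDeg, phi_100, phi_010, phi_001, phi_110, phi_101, phi_011, phi_111,
      Mon.ne] at h ⊢

theorem deltaCoord_eq_zero {n : ℕ} {c : Cochain ℂ} (hc : c ∈ cochains n) {i : Fin 13}
    (hi : deltaDeg i ≠ n) : deltaCoord c i = 0 := by
  rw [mem_cochains_iff] at hc
  rw [deltaCoord_eq]
  fin_cases i <;> first
    | simp [hc e12 _ hi, hc e13 _ hi, hc e23 _ hi]
    | simp [hc e2 _ hi, hc e3 _ hi]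
    | simp [hc e123 _ hi]

theorem betaCoord_eq_zero {n : ℕ} {c : Cochain ℂ} (hc : c ∈ cochains n) {k : Fin 4}
    (hi : betaDeg k ≠ n) : betaCoord c k = 0 := by
  rw [mem_cochains_iff] at hc
  rw [betaCoord_eq]
  fin_cases k <;> first
    | simp [hc e23 _ hi]
    | simp [hc e123 _ hi]

theorem gammaCoord_eq_zero_of_mem_ker {c : Cochain ℂ} (hc : coboundary d1 c = 0) :
    gammaCoord c = 0 := by
  have hli : LinearIndependent ℂ beta :=
    (linearIndependent_basis.comp (Sum.inr ∘ Sum.inl)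
      (Sum.inr_injective.comp Sum.inl_injective))
  rw [coboundary_d1] at hc
  exact funext (Fintype.linearIndependent_iff.1 hli _ hc)

/-- The `δ`-coordinates as a linear map. -/
def deltaCoordLinear : Cochain ℂ →ₗ[ℂ] (Fin 13 → ℂ) where
  toFun := deltaCoord
  map_add' a b := by
    rw [deltaCoord_eq, deltaCoord_eq, deltaCoord_eq]
    funext i
    fin_cases i <;> simp <;> ring
  map_smul' r a := by
    rw [deltaCoord_eq, deltaCoord_eq]
    funext i
    fin_cases i <;> simp <;> ring

/-- A cocycle has no `γ`-part and its `β`-part is exact, so its class is given by its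
`δ`-coordinates in degree `n`, which are arbitrary. -/
theorem finrank_cohomology (n : ℕ) :
    Module.finrank ℂ (Cohomology d1 n) = Fintype.card {i // deltaDeg i = n} := by
  let φ : cocycles d1 n →ₗ[ℂ] ({i // deltaDeg i = n} → ℂ) :=
    (LinearMap.funLeft ℂ ℂ Subtype.val ∘ₗ deltaCoordLinear) ∘ₗ (cocycles d1 n).subtype
  have hsurj : Function.Surjective φ := by
    intro a
    refine ⟨⟨∑ i, a i • delta i.1, ?_, ?_⟩, ?_⟩
    · refine Submodule.sum_mem _ fun i _ => ?_
      have hm := delta_mem i.1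
      rw [i.2] at hm
      exact Submodule.smul_mem _ _ hm
    · exact Submodule.sum_mem _ fun i _ =>
        Submodule.smul_mem _ _ (coboundary_delta i.1)
    · funext i
      change deltaCoordLinear (∑ i, a i • delta i.1) i.1 = a i
      rw [map_sum, Finset.sum_apply, Finset.sum_eq_single i]
      · rw [map_smul]
        change a i * deltaCoord (delta i.1) i.1 = a i
        simp [deltaCoord_delta]
      · intro j _ hj
        rw [map_smul]
        change a j * deltaCoord (delta j.1) i.1 = 0
        rw [deltaCoord_delta, Pi.single_eq_of_ne (fun h => hj (Subtype.ext h.symm)), mul_zero]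
      · simp
  have hker : (coboundaries d1 n).submoduleOf (cocycles d1 n) = LinearMap.ker φ := by
    ext ⟨c, hc, hk⟩
    rw [Submodule.submoduleOf, Submodule.mem_comap, LinearMap.mem_ker]
    constructor
    · rintro ⟨x, hx, hxc⟩
      change coboundary d1 x = c at hxc
      funext i
      change deltaCoordLinear c i.1 = 0
      rw [← hxc, coboundary_d1, map_sum, Finset.sum_apply]
      refine Finset.sum_eq_zero fun k _ => ?_
      rw [map_smul]
      change _ * deltaCoord (beta k) i.1 = 0
      simp [deltaCoord_beta]
    · intro h
      have hd : ∀ i, deltaCoord c i = 0 := by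
        intro i
        by_cases hi : deltaDeg i = n
        · exact congrFun h ⟨i, hi⟩
        · exact deltaCoord_eq_zero hc hi
      have hg := gammaCoord_eq_zero_of_mem_ker hk
      -- The primitive replaces each `β_k` by `γ_k`; it has degree `n - 1` because the
      -- `β`-coordinates in degrees other than `n` vanish.
      refine ⟨∑ k, betaCoord c k • gamma k, ?_, ?_⟩
      · refine Submodule.sum_mem _ fun k _ => ?_
        by_cases hi : betaDeg k = n
        · have hm := gamma_mem k
          rw [hi] at hm
          exact Submodule.smul_mem _ _ hm
        · rw [betaCoord_eq_zero hc hi, zero_smul]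
          exact zero_mem _
      · change coboundary d1 _ = c
        conv_rhs => rw [eq_sum_coord c]
        simp [hd, hg, tensor_complex, map_sum, coboundary_gamma]
  change Module.finrank ℂ (cocycles d1 n ⧸ (coboundaries d1 n).submoduleOf (cocycles d1 n)) = _
  rw [hker, (φ.quotKerEquivOfSurjective hsurj).finrank_eq, Module.finrank_pi]

/-! ## The construction of `d₁³` -/

section

variable {A : Type u} [Ring A] [Algebra ℂ A]

theorem nextOrder_eq (x : Cochain A) : nextOrder x = x + fun J =>
    if J = e1 then ![halfBracket x e23 0, halfBracket x e23 1, halfBracket x e23 2]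
    else if J = e12 then ![0, -halfBracket x e123 0, 0] else 0 := by
  rw [nextOrder, sum_tensor_gamma_apply]
  simp [gammaParity, betaCoord_eq]

theorem nextOrder_eq_self {x : Cochain A} (h : betaCoord (halfBracket x) = 0) :
    nextOrder x = x := by
  have h0 : ∀ k, tensor (gamma k) (0 : A) = 0 := by
    intro k
    funext J j
    simp [tensor]
  simp [nextOrder, h, h0]

end

theorem d1_ord1_eq : d1_ord1 = fun J =>
    if J = e1 then ![θ₁, 0, 0]
    else if J = e2 then ![θ₃, θ₁ + θ₂, θ₄]
    else if J = e3 then ![θ₅, θ₆, -θ₂]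
    else if J = e12 then ![t₁, t₃, t₄]
    else if J = e13 then ![t₂, t₅, -t₃]
    else if J = e23 then ![1, 0, 0]
    else ![0, θ₇, θ₈] := by
  rw [d1_ord1, sum_tensor_delta_apply]
  apply Cochain.ext_mon <;> intro j <;> fin_cases j <;>
    simp [tensor, d1, phi_011, Mon.ne, par]

theorem d1_ord2_eq : d1_ord2 = fun J =>
    if J = e1 then ![θ₁ - t₁ * θ₅ + t₂ * θ₃, -(t₃ * θ₅) + t₅ * θ₃, -(t₃ * θ₃) - t₄ * θ₅]
    else if J = e2 then ![θ₃, θ₁ + θ₂, θ₄]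
    else if J = e3 then ![θ₅, θ₆, -θ₂]
    else if J = e12 then ![t₁, t₃ - θ₃ * θ₇ - θ₅ * θ₈, t₄]
    else if J = e13 then ![t₂, t₅, -t₃]
    else if J = e23 then ![1, 0, 0]
    else ![0, θ₇, θ₈] := by
  rw [d1_ord2, d1_ord1_eq]
  apply Cochain.ext_mon <;> intro j <;>
    simp only [Pi.add_apply, Pi.sub_apply, phi_100, phi_110] <;> fin_cases j <;>
    simp [Mon.ne] <;> abel

theorem evenPar_comm (i : Fin 5) (a : Par) : evenPar i * a = a * evenPar i :=
  Algebra.commutes _ _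

theorem oddPar_comm (i j : Fin 8) : oddPar i * oddPar j = -(oddPar j * oddPar i) :=
  eq_neg_of_add_eq_zero_left (ExteriorAlgebra.ι_add_mul_swap _ _)

theorem oddPar_sq (i : Fin 8) : oddPar i * oddPar i = 0 := ExteriorAlgebra.ι_sq_zero _

/-- The cubic term of `d₁³` is the product of `-θ₃θ₇`, from the coefficient of `φ^{110}_2`, with
`θ₅`; the companion term `θ₅θ₈θ₅` is zero. -/
theorem slice_par_eq : d1_ord3 = slice par := by
  rw [d1_ord3, d1_ord2_eq]
  have h1 : θ₃ * θ₇ * θ₅ = -(θ₃ * θ₅ * θ₇) := by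
    rw [mul_assoc, θ₇, θ₅, oddPar_comm 6 4, mul_neg, mul_assoc]
  have h2 : θ₅ * θ₈ * θ₅ = 0 := by
    rw [mul_assoc, θ₈, θ₅, oddPar_comm 7 4, mul_neg, ← mul_assoc, oddPar_sq, zero_mul, neg_zero]
  apply Cochain.ext_mon <;> intro j <;> fin_cases j <;>
    simp [phi_100, Mon.ne, par, sub_mul, h1, h2] <;> abel

theorem nextOrder_d1_ord1 : nextOrder d1_ord1 = d1_ord2 := by
  have h : t₁ * t₂ = t₂ * t₁ := evenPar_comm 0 _
  rw [nextOrder_eq, halfBracket_e23, halfBracket_e23, halfBracket_e23, halfBracket_e123,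
    d1_ord1_eq, d1_ord2_eq]
  apply Cochain.ext_mon <;> intro j <;> fin_cases j <;>
    simp [Mon.ne, h] <;> abel

theorem nextOrder_d1_ord2 : nextOrder d1_ord2 = d1_ord3 := by
  have h : t₁ * t₂ = t₂ * t₁ := evenPar_comm 0 _
  rw [slice_par_eq, nextOrder_eq, halfBracket_e23, halfBracket_e23, halfBracket_e23,
    halfBracket_e123, d1_ord2_eq]
  apply Cochain.ext_mon <;> intro j <;> fin_cases j <;>
    simp [Mon.ne, h, par] <;> abel

/-- The 3 × 3 minor in the third, fifth and seventh coordinates is an alternating form with value 1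
on these three vectors. -/
theorem oddPar_mul_ne_zero : θ₃ * θ₅ * θ₇ ≠ 0 := by
  let f : (Fin 8 → PowS) [⋀^Fin 3]→ₗ[PowS] PowS :=
    (Matrix.detRowAlternating (R := PowS) (n := Fin 3)).compLinearMap
      (LinearMap.funLeft PowS PowS ![2, 4, 6])
  -- A linear form on the whole exterior algebra needs an alternating form in every degree; it is
  -- zero outside degree three.
  let F : ∀ i, (Fin 8 → PowS) [⋀^Fin i]→ₗ[PowS] PowS := fun i =>
    if h : i = 3 then h ▸ f else 0
  have h1 : θ₃ * θ₅ * θ₇ = ExteriorAlgebra.ιMulti PowS 3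
      ![Pi.single 2 1, Pi.single 4 1, Pi.single 6 1] := by
    simp [ExteriorAlgebra.ιMulti_apply, θ₃, θ₅, θ₇, oddPar, mul_assoc, List.ofFn_succ]
  intro h0
  have h2 := ExteriorAlgebra.liftAlternating_apply_ιMulti F
    (![Pi.single 2 1, Pi.single 4 1, Pi.single 6 1] : Fin 3 → Fin 8 → PowS)
  rw [← h1, h0, map_zero] at h2
  have h3 : F 3 = f := by simp [F]
  rw [h3] at h2
  have h4 : f (![Pi.single 2 1, Pi.single 4 1, Pi.single 6 1] : Fin 3 → Fin 8 → PowS) = 1 := by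
    change Matrix.det (Matrix.of fun i => LinearMap.funLeft PowS PowS ![2, 4, 6]
      ((![Pi.single 2 1, Pi.single 4 1, Pi.single 6 1] : Fin 3 → Fin 8 → PowS) i)) = 1
    rw [Matrix.det_fin_three]
    simp [LinearMap.funLeft_apply, Pi.single_apply]
  exact one_ne_zero (h4.symm.trans h2.symm)

theorem d1_ord3_ne : d1_ord3 ≠ d1_ord2 := by
  intro h
  have := congrFun (congrFun h e1) 1
  simp [d1_ord3, phi_100] at this
  exact oddPar_mul_ne_zero this

theorem ignoreOdd_evenPar (i : Fin 5) : ignoreOdd (evenPar i) = MvPowerSeries.X i := by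
  simp [ignoreOdd, evenPar, ExteriorAlgebra.algebraMapInv]

theorem ignoreOdd_oddPar (i : Fin 8) : ignoreOdd (oddPar i) = 0 := by
  simp [ignoreOdd, oddPar, ExteriorAlgebra.algebraMapInv]

theorem ignoreOdd_secondOrder (i : Fin 13) :
    ignoreOdd (deltaCoord (halfBracket d1_ord1) i) =
      ![0, 0, 0, 0, 0, 0, 0, 0, 0, 0, 0,
        MvPowerSeries.X 0 * MvPowerSeries.X 4 - MvPowerSeries.X 1 * MvPowerSeries.X 2,
        -(MvPowerSeries.X 0 * MvPowerSeries.X 2) - MvPowerSeries.X 1 * MvPowerSeries.X 3] i := by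
  rw [deltaCoord_eq]
  fin_cases i <;>
    simp [halfBracket_e2, halfBracket_e3, halfBracket_e12, halfBracket_e13, halfBracket_e23,
      halfBracket_e123, d1_ord1_eq, Mon.ne, t₁, t₂, t₃, t₄, t₅, θ₁, θ₂, θ₃, θ₄, θ₅, θ₆, θ₇, θ₈,
      ignoreOdd_evenPar, ignoreOdd_oddPar] <;> ring

/-! ## The exterior algebra as a superalgebra -/

section Exterior

open CliffordAlgebra

variable {R : Type*} [CommRing R] {V : Type*} [AddCommGroup V] [Module R V]

/-- Moving a vector past `b` costs one sign per factor, which the parity involution records. -/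
theorem mul_exterior_ι (b : ExteriorAlgebra R V) (v : V) :
    b * ExteriorAlgebra.ι R v = ExteriorAlgebra.ι R v * involute b := by
  induction b using ExteriorAlgebra.induction with
  | algebraMap r => rw [AlgHom.commutes, Algebra.commutes]
  | ι w =>
    have h : (involute : ExteriorAlgebra R V →ₐ[R] _) (ExteriorAlgebra.ι R w) =
      -ExteriorAlgebra.ι R w := involute_ι w
    rw [h, mul_neg, eq_neg_iff_add_eq_zero, ExteriorAlgebra.ι_add_mul_swap]
  | mul a b ha hb => rw [map_mul, mul_assoc, hb, ← mul_assoc, ha, mul_assoc]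
  | add a b ha hb => rw [map_add, add_mul, mul_add, ha, hb]

/-- Homogeneous elements are built up two vectors at a time, and applying the involution twice has
no effect. -/
theorem mul_exterior_evenOdd (n : ZMod 2) {a : ExteriorAlgebra R V}
    (ha : a ∈ evenOdd (0 : QuadraticForm R V) n) (b : ExteriorAlgebra R V) :
    b * a = a * (if n = 0 then b else involute b) := by
  have h1 (v : V) (b : ExteriorAlgebra R V) :
      b * CliffordAlgebra.ι (0 : QuadraticForm R V) v =
        CliffordAlgebra.ι (0 : QuadraticForm R V) v * involute b := mul_exterior_ι b v
  refine evenOdd_induction (0 : QuadraticForm R V) n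
    (motive := fun a _ => ∀ b : ExteriorAlgebra R V,
      b * a = a * (if n = 0 then b else involute b)) ?_ ?_ ?_ a ha b
  · intro v hv b
    obtain rfl | rfl := (by decide : ∀ i : ZMod 2, i = 0 ∨ i = 1) n
    · rw [ZMod.val_zero, pow_zero] at hv
      obtain ⟨r, rfl⟩ := Submodule.mem_one.1 hv
      rw [if_pos rfl]
      exact (Algebra.commutes' r b).symm
    · rw [ZMod.val_one, pow_one] at hv
      obtain ⟨v, rfl⟩ := hv
      rw [if_neg one_ne_zero]
      exact h1 v b
  · intro x y hx hy ihx ihy b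
    rw [mul_add, add_mul, ihx, ihy]
  · intro v w x hx ih b
    rw [← mul_assoc, ← mul_assoc, h1 v, mul_assoc (CliffordAlgebra.ι _ v) (involute b), h1 w,
      involute_involute, ← mul_assoc, mul_assoc _ b, ih, ← mul_assoc]

theorem exterior_supercomm (i j : ZMod 2) {a b : ExteriorAlgebra R V}
    (ha : a ∈ evenOdd (0 : QuadraticForm R V) i) (hb : b ∈ evenOdd (0 : QuadraticForm R V) j) :
    b * a = (-1) ^ (i * j).val * (a * b) := by
  rw [mul_exterior_evenOdd i ha]
  obtain rfl | rfl := (by decide : ∀ i : ZMod 2, i = 0 ∨ i = 1) i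
  · simp
  · obtain rfl | rfl := (by decide : ∀ i : ZMod 2, i = 0 ∨ i = 1) j
    · rw [involute_eq_of_mem_even hb]
      simp
    · rw [involute_eq_of_mem_odd hb]
      simp [ZMod.val_one]

variable (R V)

/-- The ideal generated by the vectors, as a submodule. -/
def vectorIdeal : Submodule R (ExteriorAlgebra R V) :=
  LinearMap.range (ExteriorAlgebra.ι R : V →ₗ[R] ExteriorAlgebra R V) * ⊤

variable {R V}

theorem top_mul_range_ι :
    ⊤ * LinearMap.range (ExteriorAlgebra.ι R : V →ₗ[R] ExteriorAlgebra R V) ≤ vectorIdeal R V := by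
  rw [Submodule.mul_le]
  rintro b - _ ⟨v, rfl⟩
  rw [mul_exterior_ι]
  exact Submodule.mul_mem_mul ⟨v, rfl⟩ trivial

/-- Vectors can be collected on the left, so a product of `n` elements of the ideal begins with `n`
vectors. -/
theorem vectorIdeal_pow_le (n : ℕ) : vectorIdeal R V ^ n ≤
    LinearMap.range (ExteriorAlgebra.ι R : V →ₗ[R] ExteriorAlgebra R V) ^ n * ⊤ := by
  induction n with
  | zero => rw [pow_zero, pow_zero, one_mul]; exact le_top
  | succ n ih =>
    rw [pow_succ, pow_succ]
    calc _ ≤ _ := mul_le_mul' ih le_rfl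
      _ ≤ LinearMap.range (ExteriorAlgebra.ι R : V →ₗ[R] ExteriorAlgebra R V) ^ n *
          (⊤ * LinearMap.range (ExteriorAlgebra.ι R : V →ₗ[R] ExteriorAlgebra R V) * ⊤) := by
        rw [vectorIdeal, mul_assoc, mul_assoc]
      _ ≤ LinearMap.range (ExteriorAlgebra.ι R : V →ₗ[R] ExteriorAlgebra R V) ^ n *
          (vectorIdeal R V * ⊤) := mul_le_mul' le_rfl (mul_le_mul' top_mul_range_ι le_rfl)
      _ ≤ _ := by
        rw [vectorIdeal, mul_assoc, mul_assoc]
        exact mul_le_mul' le_rfl (mul_le_mul' le_rfl le_top)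

theorem sub_algebraMapInv_mem (x : ExteriorAlgebra R V) :
    x - algebraMap R _ (ExteriorAlgebra.algebraMapInv x) ∈ vectorIdeal R V := by
  induction x using ExteriorAlgebra.induction with
  | algebraMap r => simp
  | ι v =>
    have h : ExteriorAlgebra.algebraMapInv (R := R) (M := V) (ExteriorAlgebra.ι R v) = 0 := by
      simp [ExteriorAlgebra.algebraMapInv]
    rw [h, map_zero, sub_zero, ← mul_one (ExteriorAlgebra.ι R v)]
    exact Submodule.mul_mem_mul ⟨v, rfl⟩ trivial
  | mul a b ha hb =>
    have h : a * b - algebraMap R _ (ExteriorAlgebra.algebraMapInv (a * b)) =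
        (a - algebraMap R _ (ExteriorAlgebra.algebraMapInv a)) * b +
          ExteriorAlgebra.algebraMapInv a •
            (b - algebraMap R _ (ExteriorAlgebra.algebraMapInv b)) := by
      rw [map_mul, map_mul, Algebra.smul_def, sub_mul, mul_sub]
      abel
    rw [h]
    refine add_mem ?_ (Submodule.smul_mem _ _ hb)
    have := Submodule.mul_mem_mul ha (show b ∈ (⊤ : Submodule R (ExteriorAlgebra R V)) from trivial)
    rw [vectorIdeal, mul_assoc] at this
    exact (mul_le_mul' le_rfl le_top :
      LinearMap.range (ExteriorAlgebra.ι R : V →ₗ[R] ExteriorAlgebra R V) * (⊤ * ⊤) ≤ _) this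
  | add a b ha hb =>
    have h : a + b - algebraMap R _ (ExteriorAlgebra.algebraMapInv (a + b)) =
        (a - algebraMap R _ (ExteriorAlgebra.algebraMapInv a)) +
            (b - algebraMap R _ (ExteriorAlgebra.algebraMapInv b)) := by
      rw [map_add, map_add]
      abel
    rw [h]
    exact add_mem ha hb

/-- A basis of the `n`-th exterior power is indexed by the `n`-element subsets of a set with `k`
elements; there are none. -/
theorem vectorIdeal_pow_eq_bot {k n : ℕ} (h : k < n) : vectorIdeal R (Fin k → R) ^ n = ⊥ := by
  have h0 : LinearMap.range (ExteriorAlgebra.ι R : (Fin k → R) →ₗ[R] _) ^ n = ⊥ := by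
    have b := (Pi.basisFun R (Fin k)).exteriorPower n
    have : IsEmpty (Set.powersetCard (Fin k) n) :=
      ⟨fun s => by have := s.1.card_le_univ; have := s.2; simp at *; omega⟩
    have := b.repr.toEquiv.subsingleton
    exact Submodule.subsingleton_iff_eq_bot.1 this
  have := vectorIdeal_pow_le (R := R) (V := Fin k → R) n
  rwa [h0, Submodule.bot_mul, le_bot_iff] at this

end Exterior

/-! ## The base of parameters -/

/-- The part without odd parameters is an invertible power series, and the rest is nilpotent. -/
theorem isUnit_par (a : Par) (ha : parAug a ≠ 0) : IsUnit a := by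
  have hn : IsNilpotent (a - algebraMap PowS Par (ignoreOdd a)) := by
    -- Nine exceeds the number of odd parameters.
    refine ⟨9, ?_⟩
    have h := Submodule.pow_mem_pow _ (sub_algebraMapInv_mem (R := PowS) (V := Fin 8 → PowS) a) 9
    rw [vectorIdeal_pow_eq_bot (by decide)] at h
    exact h
  have hu : IsUnit (algebraMap PowS Par (ignoreOdd a)) :=
    (MvPowerSeries.isUnit_iff_constantCoeff.2 (isUnit_iff_ne_zero.2 ha)).map _
  have := hn.isUnit_add_left_of_commute hu (Algebra.commutes _ _).symm
  rwa [add_sub_cancel] at this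

theorem parBase_isLocalBase : parBase.IsLocalBase where
  graded :=
    { one_mem := (CliffordAlgebra.evenOdd.gradedMonoid _).one_mem
      mul_mem := fun _ _ _ _ ha hb => (CliffordAlgebra.evenOdd.gradedMonoid _).mul_mem ha hb }
  internal := by
    rw [DirectSum.isInternal_submodule_iff_isCompl parBase.part (i := 0) (j := 1) (by decide)
      (by ext i; simpa using (by decide : ∀ i : ZMod 2, i = 0 ∨ i = 1) i)]
    have h := CliffordAlgebra.evenOdd_isCompl (Q := (0 : QuadraticForm PowS (Fin 8 → PowS)))
    constructor
    · rw [Submodule.disjoint_def]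
      exact fun x => Submodule.disjoint_def.1 h.disjoint x
    · rw [codisjoint_iff, Submodule.eq_top_iff']
      intro x
      obtain ⟨y, hy, z, hz, hx⟩ := Submodule.mem_sup.1
        (show x ∈ _ from h.sup_eq_top ▸ Submodule.mem_top)
      exact Submodule.mem_sup.2 ⟨y, hy, z, hz, hx⟩
  supercomm i j a ha b hb := exterior_supercomm i j ha hb
  isUnit := isUnit_par

theorem evenPar_mem (i : Fin 5) : evenPar i ∈ parBase.part 0 :=
  CliffordAlgebra.one_le_evenOdd_zero _ (Submodule.mem_one.2 ⟨_, rfl⟩)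

theorem oddPar_mem (i : Fin 8) : oddPar i ∈ parBase.part 1 :=
  CliffordAlgebra.ι_mem_evenOdd_one _ _

theorem par_mem (i : Fin 13) : par i ∈ parBase.part (parParity i) := by
  fin_cases i <;> first | exact evenPar_mem _ | exact oddPar_mem _

/-! ## The base of the relations -/

section

variable {A : Type u} [Ring A] [Algebra ℂ A] {X : BaseData A}

theorem halfBracket_mem (hX : X.IsLocalBase) {c : Cochain A} (hc : IsOddCochain X c) (J : Mon)
    (j : Fin 3) : halfBracket c J j ∈ X.part ((deg J : ZMod 2) + 1) := by
  rw [halfBracket, Matrix.mul_apply]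
  refine Submodule.sum_mem _ fun K _ => ?_
  have e := hX.mul_mem (hc.isOddEnd (single j) K) (hc.isOddEnd K J)
  convert e using 2
  push_cast [deg_single]
  generalize (deg J : ZMod 2) = x
  generalize (deg K : ZMod 2) = y
  revert x y
  decide

theorem deltaCoord_halfBracket_mem (hX : X.IsLocalBase) {c : Cochain A} (hc : IsOddCochain X c)
    (i : Fin 13) : deltaCoord (halfBracket c) i ∈ X.part (parParity i + 1) :=
  -- The half bracket is an odd cochain for the grading shifted by one.
  deltaCoord_mem (X := ⟨fun k => X.part (k + 1), X.aug⟩) (fun J j => halfBracket_mem hX hc J j) i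

end

/-- The parity automorphism of the parameter algebra. -/
noncomputable def parInvolute : Par →ₐ[ℂ] Par :=
  (CliffordAlgebra.involute (Q := (0 : QuadraticForm PowS (Fin 8 → PowS)))).restrictScalars ℂ

theorem parInvolute_even {a : Par} (ha : a ∈ parBase.part 0) : parInvolute a = a :=
  CliffordAlgebra.involute_eq_of_mem_even ha

theorem parInvolute_odd {a : Par} (ha : a ∈ parBase.part 1) : parInvolute a = -a :=
  CliffordAlgebra.involute_eq_of_mem_odd ha

/-- The relations are homogeneous, so the involution only changes their signs. -/
theorem parInvolute_mem_relIdeal {x : Cochain Par} (hx : IsOddCochain parBase x) {a : Par}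
    (ha : a ∈ relIdeal x) : parInvolute a ∈ relIdeal x := by
  have hle : TwoSidedIdeal.span (Set.range (deltaCoord (halfBracket x))) ≤
      (TwoSidedIdeal.span (Set.range (deltaCoord (halfBracket x)))).comap parInvolute := by
    rw [TwoSidedIdeal.span_le]
    rintro _ ⟨i, rfl⟩
    have h := deltaCoord_halfBracket_mem parBase_isLocalBase hx i
    have hs : deltaCoord (halfBracket x) i ∈
        TwoSidedIdeal.span (Set.range (deltaCoord (halfBracket x))) :=
      TwoSidedIdeal.subset_span ⟨i, rfl⟩
    rw [SetLike.mem_coe, TwoSidedIdeal.mem_comap]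
    obtain hp | hp := (by decide : ∀ i : ZMod 2, i = 0 ∨ i = 1) (parParity i + 1)
    · rw [hp] at h
      rwa [parInvolute_even h]
    · rw [hp] at h
      rw [parInvolute_odd h]
      exact neg_mem hs
  exact (TwoSidedIdeal.mem_comap _).1 (hle ha)

/-- The even part of an element is half its sum with its image under the involution. Thus the ideal
of relations is graded. -/
theorem mem_relIdeal_of_add_mem {x : Cochain Par} (hx : IsOddCochain parBase x) {a b : Par}
    (ha : a ∈ parBase.part 0) (hb : b ∈ parBase.part 1) (h : a + b ∈ relIdeal x) :
    a ∈ relIdeal x := by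
  have h' := parInvolute_mem_relIdeal hx h
  rw [map_add, parInvolute_even ha, parInvolute_odd hb] at h'
  have h2 := add_mem h h'
  have e : a = ((1 / 2 : ℂ) • (1 : Par)) * (a + b + (a + -b)) := by
    rw [smul_mul_assoc, one_mul, add_add_add_comm, add_neg_cancel, add_zero, ← two_smul ℂ a,
      smul_smul]
    norm_num
  rw [e]
  exact Ideal.mul_mem_left _ _ h2

theorem isOddCochain_d1_ord3 : IsOddCochain parBase d1_ord3 := by
  rw [slice_par_eq]
  exact isOddCochain_slice parBase_isLocalBase par_mem

/-- The projection to the base of the relations. -/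
noncomputable abbrev miniMk : Par →ₐ[ℂ] MiniBase := Ideal.Quotient.mkₐ ℂ (relIdeal d1_ord3)

theorem miniMk_surjective : Function.Surjective miniMk := Ideal.Quotient.mk_surjective

theorem miniMk_eq_zero_iff {a : Par} : miniMk a = 0 ↔ a ∈ relIdeal d1_ord3 :=
  Ideal.Quotient.eq_zero_iff_mem

theorem miniMk_mem {i : ZMod 2} {a : Par} (h : a ∈ parBase.part i) :
    miniMk a ∈ miniBase.part i := Submodule.mem_map_of_mem h

theorem miniBase_aug_miniMk (a : Par) : miniBase.aug (miniMk a) = parAug a :=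
  Ideal.Quotient.liftₐ_apply _ _ _ _

theorem miniBase_isLocalBase : miniBase.IsLocalBase where
  graded :=
    { one_mem := ⟨1, parBase_isLocalBase.one_mem, map_one miniMk⟩
      mul_mem := by
        rintro i j _ _ ⟨a, ha, rfl⟩ ⟨b, hb, rfl⟩
        exact ⟨a * b, parBase_isLocalBase.mul_mem ha hb, map_mul miniMk a b⟩ }
  internal := by
    rw [DirectSum.isInternal_submodule_iff_isCompl miniBase.part (i := 0) (j := 1) (by decide)
      (by ext i; simpa using (by decide : ∀ i : ZMod 2, i = 0 ∨ i = 1) i)]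
    constructor
    · rw [Submodule.disjoint_def]
      rintro _ ⟨a, ha, rfl⟩ ⟨b, hb, hab⟩
      -- A class that is both even and odd has lifts of both parities; their difference is a
      -- relation, and so is its even part.
      have h : a + -b ∈ relIdeal d1_ord3 := by
        rw [← miniMk_eq_zero_iff, map_add, map_neg, ← sub_eq_add_neg, sub_eq_zero]
        exact hab.symm
      exact miniMk_eq_zero_iff.2 (mem_relIdeal_of_add_mem isOddCochain_d1_ord3 ha (neg_mem hb) h)
    · rw [codisjoint_iff, Submodule.eq_top_iff']
      intro x
      obtain ⟨a, rfl⟩ := miniMk_surjective x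
      obtain ⟨b, hb, c, hc, rfl⟩ := parBase_isLocalBase.exists_add a
      exact Submodule.mem_sup.2 ⟨_, miniMk_mem hb, _, miniMk_mem hc, (map_add miniMk b c).symm⟩
  supercomm := by
    rintro i j _ ⟨a, ha, rfl⟩ _ ⟨b, hb, rfl⟩
    have h := congrArg miniMk (parBase_isLocalBase.supercomm i j a ha b hb)
    simpa using h
  isUnit := by
    intro x hx
    obtain ⟨a, rfl⟩ := miniMk_surjective x
    exact (isUnit_par a (by rwa [miniBase_aug_miniMk] at hx)).map _

/-- The parameters, modulo the relations. -/
noncomputable def miniPar (i : Fin 13) : MiniBase := miniMk (par i)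

theorem miniPar_mem (i : Fin 13) : miniPar i ∈ miniBase.part (parParity i) := miniMk_mem (par_mem i)

theorem map_miniMk_d1_ord3 : (fun J j => miniMk (d1_ord3 J j)) = slice miniPar :=
  (congrArg (fun c : Cochain Par => fun J j => miniMk (c J j)) slice_par_eq).trans
    (map_slice miniMk par)

/-- Only the `δ`-coordinates are killed by construction; the other coefficients follow from the
Bianchi argument, applied over the quotient. -/
theorem halfBracket_slice_miniPar : halfBracket (slice miniPar) = 0 := by
  refine halfBracket_slice_eq_zero miniBase_isLocalBase miniPar_mem ?_
  funext i
  have h : (fun J j => miniMk (halfBracket d1_ord3 J j)) = halfBracket (slice miniPar) := by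
    funext J j
    rw [map_halfBracket, map_miniMk_d1_ord3]
  rw [← h, ← map_deltaCoord]
  exact miniMk_eq_zero_iff.2 (TwoSidedIdeal.mem_asIdeal.2 (TwoSidedIdeal.subset_span ⟨i, rfl⟩))

theorem halfBracket_d1_ord3_mem (J : Mon) (j : Fin 3) :
    halfBracket d1_ord3 J j ∈ relIdeal d1_ord3 := by
  rw [← miniMk_eq_zero_iff, map_halfBracket, map_miniMk_d1_ord3, halfBracket_slice_miniPar]
  rfl

theorem nextOrder_d1_ord3 : nextOrder d1_ord3 = d1_ord3 := by
  refine nextOrder_eq_self ?_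
  rw [slice_par_eq]
  exact betaCoord_halfBracket_slice parBase_isLocalBase par_mem

theorem map_oddCoder {A B : Type*} [Ring A] [Algebra ℂ A] [Ring B] [Algebra ℂ B] (f : A →ₐ[ℂ] B)
    (c : Cochain A) : (oddCoder c).map f = oddCoder fun J j => f (c J j) := by
  ext K I
  simp [oddCoder]

theorem miniversalDef_eq : miniversalDef = oddCoder (slice miniPar) := by
  rw [miniversalDef, map_oddCoder, map_miniMk_d1_ord3]

theorem isDeformation_miniversalDef : IsDeformation d1 miniBase miniversalDef where
  odd := by
    rw [miniversalDef_eq]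
    exact (isOddCochain_slice miniBase_isLocalBase miniPar_mem).isOddEnd
  coder := by
    rw [miniversalDef_eq]
    exact isOddCoderivation_oddCoder _
  square := by
    rw [miniversalDef_eq]
    exact oddCoder_sq_eq_zero miniBase_isLocalBase
      (isOddCochain_slice miniBase_isLocalBase miniPar_mem) halfBracket_slice_miniPar
  aug := by
    rw [miniversalDef, Matrix.map_map, ← parAug_d1_ord3, ← map_oddCoder]
    ext K I
    exact miniBase_aug_miniMk _

/-! ## Powers of the augmentation ideal -/

namespace BaseData

variable {A : Type u} [Ring A] [Algebra ℂ A] {X : BaseData A}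

theorem mem_m {a : A} : a ∈ X.m ↔ X.aug a = 0 := Iff.rfl

theorem m_mul_top : X.m * ⊤ ≤ X.m := by
  rw [Submodule.mul_le]
  intro a ha b _
  rw [mem_m, map_mul, mem_m.1 ha, zero_mul]

theorem top_mul_m : ⊤ * X.m ≤ X.m := by
  rw [Submodule.mul_le]
  intro a _ b hb
  rw [mem_m, map_mul, mem_m.1 hb, mul_zero]

/-- The exponent is positive because the zeroth power of a subspace is the line of scalars, not the
whole algebra. -/
theorem m_pow_mul_mem {n : ℕ} {a : A} (ha : a ∈ X.m ^ (n + 1)) (b : A) :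
    a * b ∈ X.m ^ (n + 1) := by
  have h : X.m ^ (n + 1) * ⊤ ≤ X.m ^ (n + 1) := by
    rw [pow_succ, mul_assoc]
    exact mul_le_mul' le_rfl m_mul_top
  exact h (Submodule.mul_mem_mul ha trivial)

theorem mul_m_pow_mem {n : ℕ} {a : A} (ha : a ∈ X.m ^ (n + 1)) (b : A) :
    b * a ∈ X.m ^ (n + 1) := by
  have h : ⊤ * X.m ^ (n + 1) ≤ X.m ^ (n + 1) := by
    rw [pow_succ', ← mul_assoc]
    exact mul_le_mul' top_mul_m le_rfl
  exact h (Submodule.mul_mem_mul trivial ha)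

theorem m_pow_le {k n : ℕ} (h : k ≤ n) : X.m ^ (n + 1) ≤ X.m ^ (k + 1) := by
  induction n, h using Nat.le_induction with
  | base => exact le_rfl
  | succ n _ ih =>
    refine le_trans ?_ ih
    rw [pow_succ (X.m) (n + 1), pow_succ (X.m) n, mul_assoc]
    exact mul_le_mul' le_rfl ((mul_le_mul' le_rfl le_top).trans m_mul_top)

/-- Partial sums of a series whose terms lie in the powers of the augmentation ideal. -/
theorem sub_mem_m_pow {s : ℕ → A} (hs : ∀ n, s (n + 1) - s n ∈ X.m ^ (n + 1)) {k n : ℕ}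
    (h : k ≤ n) : s n - s k ∈ X.m ^ (k + 1) := by
  induction n, h using Nat.le_induction with
  | base => rw [sub_self]; exact zero_mem _
  | succ n hn ih =>
    rw [← sub_add_sub_cancel (s (n + 1)) (s n)]
    exact add_mem (m_pow_le hn (hs n)) ih

end BaseData

/-! ## Completeness of modules over power series -/

section Complete

variable {S : Type*} [CommRing S] (I : Ideal S) [IsAdicComplete I S]

/-- The sequence is lifted to a free module of finite rank, where limits exist coordinatewise. -/
theorem exists_adic_limit (N : Type*) [AddCommGroup N] [Module S N] [Module.Finite S N]
    (x : ℕ → N) (hx : ∀ n, x (n + 1) - x n ∈ (I ^ n • ⊤ : Submodule S N)) :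
    ∃ a, ∀ n, a - x n ∈ (I ^ n • ⊤ : Submodule S N) := by
  obtain ⟨k, f, hf⟩ := Module.Finite.exists_fin' S N
  have hmap (n : ℕ) : (I ^ n • ⊤ : Submodule S N) = (I ^ n • ⊤ : Submodule S (Fin k → S)).map f := by
    rw [Submodule.map_smul'', Submodule.map_top, LinearMap.range_eq_top.2 hf]
  have hcoord (n : ℕ) (y : Fin k → S) :
      y ∈ (I ^ n • ⊤ : Submodule S (Fin k → S)) ↔ ∀ i, y i ∈ I ^ n := by
    constructor
    · intro h i
      have h1 : y i ∈ (I ^ n • ⊤ : Submodule S (Fin k → S)).map (LinearMap.proj i) :=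
        ⟨y, h, rfl⟩
      rw [Submodule.map_smul''] at h1
      have h2 := Submodule.smul_mono (le_refl (I ^ n)) le_top h1
      rwa [smul_eq_mul, Ideal.mul_top] at h2
    · intro h
      rw [pi_eq_sum_univ' y]
      exact Submodule.sum_mem _ fun i _ => Submodule.smul_mem_smul (h i) trivial
  choose d hd hfd using fun n => (hmap n ▸ hx n : x (n + 1) - x n ∈ Submodule.map f _)
  obtain ⟨y0, hy0⟩ := hf (x 0)
  -- Lifting the differences instead of the terms makes the lifted sequence a Cauchy sequence.
  let y : ℕ → Fin k → S := fun n => y0 + ∑ j ∈ Finset.range n, d j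
  have hy (n : ℕ) : f (y n) = x n := by
    simp only [y, map_add, map_sum, hy0, hfd, Finset.sum_range_sub, add_sub_cancel]
  have hlim (i : Fin k) : ∃ L : S, ∀ n, L - y n i ∈ I ^ n := by
    obtain ⟨L, hL⟩ := IsPrecomplete.prec (I := I) (M := S) inferInstance (f := fun n => y n i) (by
      intro m n hmn
      rw [SModEq.sub_mem, smul_eq_mul, Ideal.mul_top]
      induction n, hmn using Nat.le_induction with
      | base => simp
      | succ n hn ih =>
        rw [← sub_add_sub_cancel _ (y n i)]
        refine add_mem ih ?_
        have := (hcoord n _).1 (hd n) i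
        rw [show y n i - y (n + 1) i = -d n i by simp [y, Finset.sum_range_succ]]
        exact neg_mem (Ideal.pow_le_pow_right hn this))
    refine ⟨L, fun n => ?_⟩
    have := hL n
    rw [SModEq.sub_mem, smul_eq_mul, Ideal.mul_top] at this
    rw [← neg_sub]
    exact neg_mem this
  choose L hL using hlim
  refine ⟨f L, fun n => ?_⟩
  rw [← hy, ← map_sub, hmap]
  exact ⟨_, (hcoord n _).2 fun i => hL i n, rfl⟩

end Complete

/-- Every nonconstant monomial is assigned to its smallest variable; this writes `p` as a finite sum
of series `q i` divisible by `X i`. -/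
theorem MvPowerSeries.mem_span_X {σ R : Type*} [Fintype σ] [LinearOrder σ] [CommRing R]
    {p : MvPowerSeries σ R} (h : MvPowerSeries.constantCoeff p = 0) :
    p ∈ Ideal.span (Set.range (MvPowerSeries.X : σ → MvPowerSeries σ R)) := by
  classical
  let q : σ → MvPowerSeries σ R := fun i d =>
    if d i ≠ 0 ∧ ∀ j < i, d j = 0 then MvPowerSeries.coeff d p else 0
  have hq (i : σ) (d : σ →₀ ℕ) : MvPowerSeries.coeff d (q i) =
    if d i ≠ 0 ∧ ∀ j < i, d j = 0 then MvPowerSeries.coeff d p else 0 := rfl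
  have hp : p = ∑ i, q i := by
    ext d
    rw [map_sum]
    simp only [hq]
    by_cases hd : d = 0
    · subst hd
      simpa using h
    · have hne : (Finset.univ.filter fun i => d i ≠ 0).Nonempty := by
        obtain ⟨i, hi⟩ := Finsupp.ne_iff.1 hd
        exact ⟨i, by simpa using hi⟩
      obtain ⟨i, hi, hmin⟩ := Finset.exists_minimal hne
      have hi' : d i ≠ 0 := by simpa using hi
      have hmin' (j : σ) (hj : j < i) : d j = 0 := by
        by_contra hj0
        exact absurd (hmin (by simpa using hj0) hj.le) (not_le.2 hj)
      rw [Finset.sum_eq_single i, if_pos ⟨hi', hmin'⟩]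
      · intro j _ hj
        refine if_neg fun ⟨h1, h2⟩ => ?_
        rcases lt_or_gt_of_ne hj with hlt | hgt
        · exact h1 (hmin' j hlt)
        · exact hi' (h2 i hgt)
      · simp
  rw [hp]
  refine Ideal.sum_mem _ fun i _ => ?_
  have : (MvPowerSeries.X i : MvPowerSeries σ R) ∣ q i := by
    rw [MvPowerSeries.X_dvd_iff]
    intro d hd
    rw [hq, if_neg (fun h => h.1 hd)]
  exact Ideal.mem_of_dvd _ this (Ideal.subset_span ⟨i, rfl⟩)

/-! ## Completeness of the base of the relations -/

/-- The ideal of power series without constant term. -/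
noncomputable abbrev varIdeal : Ideal PowS := Ideal.span (Set.range MvPowerSeries.X)

/-- In the expanded power, every product except the pure one has a factor with coefficients in the
ideal of variables. -/
theorem smul_top_sup_vectorIdeal_pow_le (n : ℕ) :
    ((varIdeal • ⊤ ⊔ vectorIdeal PowS (Fin 8 → PowS)) ^ n : Submodule PowS Par) ≤
      varIdeal • ⊤ ⊔ vectorIdeal PowS (Fin 8 → PowS) ^ n := by
  have hl (P : Submodule PowS Par) : varIdeal • ⊤ * P ≤ varIdeal • ⊤ := by
    rw [Submodule.mul_le]
    intro a ha b _
    induction ha using Submodule.smul_induction_on' with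
    | smul r hr x _ =>
      rw [smul_mul_assoc]
      exact Submodule.smul_mem_smul hr trivial
    | add x _ y _ hx hy => rw [add_mul]; exact add_mem hx hy
  have hr (P : Submodule PowS Par) : P * varIdeal • ⊤ ≤ varIdeal • ⊤ := by
    rw [Submodule.mul_le]
    intro b _ a ha
    induction ha using Submodule.smul_induction_on' with
    | smul r hr x _ =>
      rw [mul_smul_comm]
      exact Submodule.smul_mem_smul hr trivial
    | add x _ y _ hx hy => rw [mul_add]; exact add_mem hx hy
  induction n with
  | zero => simp
  | succ n ih =>
    rw [pow_succ, pow_succ]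
    refine (mul_le_mul' ih le_rfl).trans ?_
    rw [Submodule.sup_mul, Submodule.mul_sup (vectorIdeal _ _ ^ n)]
    exact sup_le ((hl _).trans le_sup_left)
      (sup_le ((hr _).trans le_sup_left) le_sup_right)

theorem smul_top_pow_le (n : ℕ) :
    (varIdeal • ⊤ : Submodule PowS Par) ^ n ≤ varIdeal ^ n • ⊤ := by
  induction n with
  | zero => simp
  | succ n ih =>
    rw [pow_succ, pow_succ]
    refine (mul_le_mul' ih le_rfl).trans ?_
    rw [Submodule.mul_le]
    intro a ha b hb
    induction ha using Submodule.smul_induction_on' with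
    | smul r hr x _ =>
      induction hb using Submodule.smul_induction_on' with
      | smul s hs y _ =>
        rw [smul_mul_smul_comm]
        exact Submodule.smul_mem_smul (Ideal.mul_mem_mul hr hs) trivial
      | add x _ y _ hx hy => rw [mul_add]; exact add_mem hx hy
    | add x _ y _ hx hy => rw [add_mul]; exact add_mem hx hy

/-- The powers of `m` are taken over `ℂ`, while the comparison ideals are modules over the power
series. -/
theorem mem_pow_of_mem_pow {K S A : Type*} [CommSemiring K] [CommSemiring S] [Semiring A] [Algebra K S]
    [Algebra K A] [Algebra S A] [IsScalarTower K S A] {N : Submodule K A} {P : Submodule S A}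
    (h : ∀ a ∈ N, a ∈ P) {k : ℕ} {a : A} (ha : a ∈ N ^ k) : a ∈ P ^ k := by
  induction k generalizing a with
  | zero =>
    rw [pow_zero] at ha ⊢
    obtain ⟨r, rfl⟩ := Submodule.mem_one.1 ha
    exact Submodule.mem_one.2 ⟨algebraMap K S r, (IsScalarTower.algebraMap_apply K S A r).symm⟩
  | succ k ih =>
    rw [pow_succ] at ha ⊢
    refine Submodule.mul_induction_on ha (fun x hx y hy => ?_) fun x y hx hy => add_mem hx hy
    exact Submodule.mul_mem_mul (ih hx) (h y hy)

/-- Among nine factors from `m` at least one must contribute a variable `t_i`, since a product of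
nine vectors vanishes. -/
theorem parBase_m_pow_le {n k : ℕ} (h : 9 * n ≤ k) :
    parBase.m ^ k ≤ (varIdeal ^ n • ⊤ : Submodule PowS Par).restrictScalars ℂ := by
  set P : Submodule PowS Par := varIdeal • ⊤ ⊔ vectorIdeal PowS (Fin 8 → PowS) with hP
  have h1 : ∀ a ∈ parBase.m, a ∈ P := by
    intro a ha
    have ha' : MvPowerSeries.constantCoeff (ignoreOdd a) = 0 := ha
    rw [← sub_add_cancel a (algebraMap PowS Par (ignoreOdd a))]
    refine add_mem (Submodule.mem_sup_right (sub_algebraMapInv_mem a)) (Submodule.mem_sup_left ?_)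
    rw [Algebra.algebraMap_eq_smul_one]
    exact Submodule.smul_mem_smul (MvPowerSeries.mem_span_X ha') trivial
  have h3 : P ^ 9 ≤ varIdeal • ⊤ := by
    refine (smul_top_sup_vectorIdeal_pow_le 9).trans ?_
    rw [vectorIdeal_pow_eq_bot (by decide), sup_bot_eq]
  have h4 : P ^ k ≤ varIdeal ^ n • ⊤ := by
    obtain ⟨l, rfl⟩ := Nat.exists_eq_add_of_le h
    rw [pow_add, pow_mul]
    refine (mul_le_mul' ((pow_le_pow_left' h3 n).trans (smul_top_pow_le n)) le_top).trans ?_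
    rw [Submodule.mul_le]
    intro a ha b _
    induction ha using Submodule.smul_induction_on' with
    | smul r hr x _ =>
      rw [smul_mul_assoc]
      exact Submodule.smul_mem_smul hr trivial
    | add x _ y _ hx hy => rw [add_mul]; exact add_mem hx hy
  exact fun a ha => h4 (mem_pow_of_mem_pow h1 ha)

/-- The converse comparison: together the two show that both filtrations define the same topology.
-/
theorem algebraMap_mem_parBase_m_pow (n : ℕ) {p : PowS} (hp : p ∈ varIdeal ^ (n + 1)) :
    algebraMap PowS Par p ∈ parBase.m ^ (n + 1) := by
  have h1 {p : PowS} (hp : p ∈ varIdeal) : algebraMap PowS Par p ∈ parBase.m := by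
    induction hp using Submodule.span_induction with
    | mem x hx =>
      obtain ⟨i, rfl⟩ := hx
      exact parAug_evenPar i
    | zero => rw [map_zero]; exact zero_mem _
    | add x y _ _ hx hy => rw [map_add]; exact add_mem hx hy
    | smul a x _ hx =>
      rw [smul_eq_mul, map_mul]
      exact BaseData.top_mul_m (Submodule.mul_mem_mul trivial hx)
  induction n generalizing p with
  | zero => rw [zero_add, pow_one] at hp ⊢; exact h1 hp
  | succ n ih =>
    rw [pow_succ] at hp ⊢
    refine Submodule.mul_induction_on hp ?_ ?_
    · intro a ha b hb
      rw [map_mul]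
      exact Submodule.mul_mem_mul (ih ha) (h1 hb)
    · intro a b ha hb
      rw [map_add]
      exact add_mem ha hb

/-- The projection to the base of the relations, as a map of modules over the power series. -/
noncomputable def miniMkLinear : Par →ₗ[PowS] MiniBase :=
  (Ideal.Quotient.mkₐ PowS (relIdeal d1_ord3)).toLinearMap

theorem miniMkLinear_surjective : Function.Surjective miniMkLinear := Ideal.Quotient.mk_surjective

instance : Module.Finite PowS Par :=
  .of_basis (Pi.basisFun PowS (Fin 8)).ExteriorAlgebra

instance : Module.Finite PowS MiniBase := .of_surjective miniMkLinear miniMkLinear_surjective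

theorem miniBase_m_eq : miniBase.m = parBase.m.map miniMk.toLinearMap := by
  ext x
  obtain ⟨a, rfl⟩ := miniMk_surjective x
  rw [BaseData.mem_m, miniBase_aug_miniMk]
  constructor
  · exact fun h => ⟨a, h, rfl⟩
  · rintro ⟨b, hb, h⟩
    have := congrArg miniBase.aug h
    rw [AlgHom.toLinearMap_apply, miniBase_aug_miniMk, miniBase_aug_miniMk] at this
    rw [← this]
    exact hb

theorem miniBase_m_pow_eq (n : ℕ) : miniBase.m ^ n = (parBase.m ^ n).map miniMk.toLinearMap := by
  rw [miniBase_m_eq, Submodule.map_pow]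

theorem mem_smul_top_of_mem_m_pow {n k : ℕ} (h : 9 * n ≤ k) {x : MiniBase}
    (hx : x ∈ miniBase.m ^ k) : x ∈ (varIdeal ^ n • ⊤ : Submodule PowS MiniBase) := by
  rw [miniBase_m_pow_eq] at hx
  obtain ⟨a, ha, rfl⟩ := hx
  have h1 : a ∈ (varIdeal ^ n • ⊤ : Submodule PowS Par) := parBase_m_pow_le h ha
  have h2 := Submodule.mem_map_of_mem (f := miniMkLinear) h1
  rw [Submodule.map_smul''] at h2
  exact Submodule.smul_mono le_rfl le_top h2

theorem mem_m_pow_of_mem_smul_top (n : ℕ) {x : MiniBase}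
    (hx : x ∈ (varIdeal ^ (n + 1) • ⊤ : Submodule PowS MiniBase)) :
    x ∈ miniBase.m ^ (n + 1) := by
  induction hx using Submodule.smul_induction_on' with
  | smul r hr x _ =>
    obtain ⟨a, rfl⟩ := miniMkLinear_surjective x
    have h := BaseData.m_pow_mul_mem (algebraMap_mem_parBase_m_pow n hr) a
    rw [← Algebra.smul_def] at h
    rw [miniBase_m_pow_eq, ← map_smul]
    exact ⟨_, h, rfl⟩
  | add x _ y _ hx hy => exact add_mem hx hy

/-- The two filtrations are cofinal, so completeness comes from that of finite modules over power
series, and separation from Krull's intersection theorem. -/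
theorem miniBase_isFormalBase : miniBase.IsFormalBase where
  toIsLocalBase := miniBase_isLocalBase
  complete := by
    intro s hs
    -- Along the indices `9 * n` the sequence is Cauchy for the ideal of variables.
    obtain ⟨a, ha⟩ := exists_adic_limit varIdeal MiniBase (fun n => s (9 * n)) (by
      intro n
      cases n with
      | zero => simp
      | succ n =>
        exact mem_smul_top_of_mem_m_pow (by omega)
          (BaseData.sub_mem_m_pow hs (k := 9 * (n + 1)) (n := 9 * (n + 1 + 1)) (by omega)))
    refine ⟨a, fun n => ?_, fun b hb => ?_⟩
    · rw [← sub_add_sub_cancel a (s (9 * (n + 1)))]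
      exact add_mem (mem_m_pow_of_mem_smul_top n (ha (n + 1)))
        (BaseData.sub_mem_m_pow hs (by omega))
    · have : IsHausdorff varIdeal MiniBase := by
        -- The ideal of variables is proper because the augmentation does not kill 1.
        refine IsHausdorff.of_isLocalRing _ _ fun h => ?_
        have h1 : (1 : PowS) ∈ varIdeal ^ (0 + 1) := by
          rw [zero_add, pow_one, h]
          trivial
        have h2 := algebraMap_mem_parBase_m_pow 0 h1
        rw [zero_add, pow_one, map_one, BaseData.mem_m, map_one] at h2
        exact one_ne_zero h2
      rw [← sub_eq_zero]
      refine this.haus _ fun n => ?_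
      rw [SModEq.zero]
      cases n with
      | zero => simp
      | succ n =>
        rw [← sub_sub_sub_cancel_right b a (s (9 * (n + 1)))]
        exact sub_mem (mem_smul_top_of_mem_m_pow (by omega) (hb (9 * (n + 1)))) (ha (n + 1))

/-! ## Evaluation of power series in formal bases -/

namespace BaseData.IsLocalBase

variable {B : Type u} [Ring B] [Algebra ℂ B] {Y : BaseData B} (hY : Y.IsLocalBase)
include hY

theorem mul_even {a b : B} (ha : a ∈ Y.part 0) (hb : b ∈ Y.part 0) : a * b ∈ Y.part 0 :=
  hY.mul_mem ha hb

theorem odd_mul_odd {a b : B} (ha : a ∈ Y.part 1) (hb : b ∈ Y.part 1) : a * b ∈ Y.part 0 :=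
  hY.mul_mem ha hb

theorem even_mul_odd {a b : B} (ha : a ∈ Y.part 0) (hb : b ∈ Y.part 1) : a * b ∈ Y.part 1 := by
  have h := hY.mul_mem ha hb
  rwa [zero_add] at h

theorem odd_mul_even {a b : B} (ha : a ∈ Y.part 1) (hb : b ∈ Y.part 0) : a * b ∈ Y.part 1 := by
  have h := hY.mul_mem ha hb
  rwa [add_zero] at h

/-- The powers of the augmentation ideal are graded. -/
theorem exists_add_m_pow {n : ℕ} {a : B} (ha : a ∈ Y.m ^ (n + 1)) :
    ∃ b ∈ Y.part 0, ∃ c ∈ Y.part 1, b ∈ Y.m ^ (n + 1) ∧ c ∈ Y.m ^ (n + 1) ∧ b + c = a := by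
  have h1 {a : B} (ha : a ∈ Y.m) :
      ∃ b ∈ Y.part 0, ∃ c ∈ Y.part 1, b ∈ Y.m ∧ c ∈ Y.m ∧ b + c = a := by
    obtain ⟨b, hb, c, hc, rfl⟩ := hY.exists_add a
    -- The augmentation kills odd elements, so the even part of an element of `m` lies in `m` as
    -- well.
    have hc' : c ∈ Y.m := hY.aug_odd hc
    exact ⟨b, hb, c, hc, by simpa using sub_mem ha hc', hc', rfl⟩
  induction n generalizing a with
  | zero => rw [zero_add, pow_one] at ha ⊢; exact h1 ha
  | succ n ih =>
    rw [pow_succ] at ha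
    rw [pow_succ]
    refine Submodule.mul_induction_on ha ?_ ?_
    · intro x hx y hy
      obtain ⟨x0, hx0, x1, hx1, hm0, hm1, rfl⟩ := ih hx
      obtain ⟨y0, hy0, y1, hy1, hn0, hn1, rfl⟩ := h1 hy
      refine ⟨x0 * y0 + x1 * y1, add_mem (hY.mul_even hx0 hy0) (hY.odd_mul_odd hx1 hy1),
        x0 * y1 + x1 * y0, add_mem (hY.even_mul_odd hx0 hy1) (hY.odd_mul_even hx1 hy0),
        add_mem (Submodule.mul_mem_mul hm0 hn0) (Submodule.mul_mem_mul hm1 hn1),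
        add_mem (Submodule.mul_mem_mul hm0 hn1) (Submodule.mul_mem_mul hm1 hn0), ?_⟩
      rw [add_mul, mul_add, mul_add]
      abel
    · rintro _ _ ⟨x0, hx0, x1, hx1, hm0, hm1, rfl⟩ ⟨y0, hy0, y1, hy1, hn0, hn1, rfl⟩
      exact ⟨x0 + y0, add_mem hx0 hy0, x1 + y1, add_mem hx1 hy1, add_mem hm0 hn0,
        add_mem hm1 hn1, by abel⟩

end BaseData.IsLocalBase

namespace BaseData.IsFormalBase

variable {B : Type u} [Ring B] [Algebra ℂ B] {Y : BaseData B} (hY : Y.IsFormalBase)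
include hY

/-- Both elements are limits of the constant sequence `b`, and limits are unique. -/
theorem eq_of_sub_mem {a b : B} (h : ∀ n, a - b ∈ Y.m ^ (n + 1)) : a = b := by
  obtain ⟨c, -, hc⟩ := hY.complete (fun _ => b) (fun n => by rw [sub_self]; exact zero_mem _)
  rw [hc a h, hc b fun n => by rw [sub_self]; exact zero_mem _]

/-- The odd part of the limit equals the odd part of each `a - s n`, hence lies in all powers of
`m`. -/
theorem even_of_limit {a : B} {s : ℕ → B} (hs : ∀ n, s n ∈ Y.part 0)
    (h : ∀ n, a - s n ∈ Y.m ^ (n + 1)) : a ∈ Y.part 0 := by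
  obtain ⟨b, hb, c, hc, rfl⟩ := hY.exists_add a
  have hc0 : c = 0 := by
    refine hY.eq_of_sub_mem fun n => ?_
    obtain ⟨x, hx, y, hy, -, hym, hxy⟩ := hY.exists_add_m_pow (h n)
    have he : c - y = x - (b - s n) := by
      have hc' : c = x + y - b + s n := by rw [hxy]; abel
      rw [hc']
      abel
    have hcy : c - y = 0 := hY.eq_zero_of_mem
      (he ▸ sub_mem hx (sub_mem hb (hs n))) (sub_mem hc hy)
    rw [sub_zero, sub_eq_zero.1 hcy]
    exact hym
  rwa [hc0, add_zero]

/-- The value at `p` is the limit of the values at the truncations of `p`; additivity and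
multiplicativity hold modulo every power of `m`. -/
theorem exists_powerSeries_hom {b : Fin 5 → B} (hb : ∀ i, b i ∈ Y.part 0)
    (hm : ∀ i, b i ∈ Y.m) : ∃ f : PowS →ₐ[ℂ] B, (∀ i, f (MvPowerSeries.X i) = b i) ∧
      (∀ p, f p ∈ Y.part 0) ∧ ∀ p, Y.aug (f p) = MvPowerSeries.constantCoeff p := by
  -- Polynomials are evaluated in the center, a commutative algebra that contains the even elements.
  let φ : MvPolynomial (Fin 5) ℂ →ₐ[ℂ] B := (Subalgebra.center ℂ B).val.comp
    (MvPolynomial.aeval fun i => ⟨b i, Subalgebra.mem_center_iff.2 fun x =>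
      (hY.even_comm (hb i) x).symm⟩)
  have hφX (i : Fin 5) : φ (MvPolynomial.X i) = b i := by simp [φ]
  have hφeven (q : MvPolynomial (Fin 5) ℂ) : φ q ∈ Y.part 0 := by
    induction q using MvPolynomial.induction_on with
    | C r =>
      rw [← MvPolynomial.algebraMap_eq, AlgHom.commutes, Algebra.algebraMap_eq_smul_one]
      exact Submodule.smul_mem _ _ hY.one_mem
    | add p q hp hq => rw [map_add]; exact add_mem hp hq
    | mul_X p i hp => rw [map_mul, hφX]; exact hY.mul_even hp (hb i)
  have hφaug (q : MvPolynomial (Fin 5) ℂ) : Y.aug (φ q) = MvPolynomial.constantCoeff q := by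
    induction q using MvPolynomial.induction_on with
    | C r => rw [← MvPolynomial.algebraMap_eq, AlgHom.commutes, AlgHom.commutes]; simp
    | add p q hp hq => rw [map_add, map_add, hp, hq, map_add]
    | mul_X p i hp => rw [map_mul, map_mul, hφX, BaseData.mem_m.1 (hm i)]; simp
  have hφm (n : ℕ) {q : MvPolynomial (Fin 5) ℂ}
      (hq : q ∈ MvPolynomial.idealOfVars (Fin 5) ℂ ^ (n + 1)) : φ q ∈ Y.m ^ (n + 1) := by
    have h1 {q : MvPolynomial (Fin 5) ℂ} (hq : q ∈ MvPolynomial.idealOfVars (Fin 5) ℂ) :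
        φ q ∈ Y.m := by
      induction hq using Submodule.span_induction with
      | mem x hx =>
        obtain ⟨i, rfl⟩ := hx
        rw [hφX]
        exact hm i
      | zero => rw [map_zero]; exact zero_mem _
      | add x y _ _ hx hy => rw [map_add]; exact add_mem hx hy
      | smul a x _ hx =>
        rw [smul_eq_mul, map_mul]
        exact BaseData.top_mul_m (Submodule.mul_mem_mul trivial hx)
    induction n generalizing q with
    | zero => rw [zero_add, pow_one] at hq ⊢; exact h1 hq
    | succ n ih =>
      rw [pow_succ] at hq ⊢
      refine Submodule.mul_induction_on hq (fun x hx y hy => ?_) fun x y hx hy => ?_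
      · rw [map_mul]
        exact Submodule.mul_mem_mul (ih hx) (h1 hy)
      · rw [map_add]
        exact add_mem hx hy
  choose f hf _ using fun p : PowS => hY.complete
    (fun n => φ (MvPowerSeries.truncTotal (n + 1) p)) (fun n => by
      rw [← map_sub]
      exact hφm n (MvPowerSeries.truncTotal_sub_truncTotal_mem_pow_idealOfVars
        (by omega) (by omega) p))
  have hadd (p q : PowS) : f (p + q) = f p + f q := by
    refine hY.eq_of_sub_mem fun n => ?_
    have h := sub_mem (sub_mem (hf (p + q) n) (hf p n)) (hf q n)
    rw [map_add, map_add] at h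
    convert h using 1
    abel
  have hmul (p q : PowS) : f (p * q) = f p * f q := by
    refine hY.eq_of_sub_mem fun n => ?_
    have h1 := hφm n (MvPowerSeries.truncTotal_mul_sub_mul_truncTotal_mem_pow_idealOfVars p q)
    rw [map_sub, map_mul φ] at h1
    have h2 := m_pow_mul_mem (hf p n) (f q)
    have h3 := mul_m_pow_mem (hf q n) (φ (MvPowerSeries.truncTotal (n + 1) p))
    have h := sub_mem (sub_mem (add_mem (hf (p * q) n) h1) h2) h3
    convert h using 1
    noncomm_ring
  have hcoe (q : MvPolynomial (Fin 5) ℂ) (hq : q.totalDegree ≤ 1) : f q = φ q := by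
    refine hY.eq_of_sub_mem fun n => ?_
    -- At index `n + 1` the truncation keeps all degrees up to `n + 1`, in particular degree one.
    have h := hf q (n + 1)
    rw [(MvPowerSeries.truncTotal_coe_eq_self_iff q (by omega)).2 (by omega)] at h
    exact m_pow_le (Nat.le_succ n) h
  have hone : f 1 = 1 := by
    have h := hcoe 1 (by simp)
    rwa [map_one, MvPolynomial.coe_one] at h
  have hzero : f 0 = 0 := by
    have h := hcoe 0 (by simp)
    rwa [map_zero, MvPolynomial.coe_zero] at h
  let F : PowS →ₐ[ℂ] B :=
    { toFun := f
      map_one' := hone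
      map_mul' := hmul
      map_zero' := hzero
      map_add' := hadd
      commutes' := fun r => by
        have h := hcoe (MvPolynomial.C r) (by simp)
        rw [MvPolynomial.coe_C, ← MvPolynomial.algebraMap_eq, AlgHom.commutes] at h
        exact h }
  refine ⟨F, fun i => ?_, fun p => ?_, fun p => ?_⟩
  · have h := hcoe (MvPolynomial.X i) (by simp)
    rw [MvPolynomial.coe_X, hφX] at h
    exact h
  · exact hY.even_of_limit (fun n => hφeven _) (hf p)
  · have h := hf p 0
    rw [zero_add, pow_one, mem_m, map_sub, hφaug, MvPowerSeries.constantCoeff_truncTotal_eq_ite,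
      if_pos zero_lt_one, sub_eq_zero] at h
    exact h

end BaseData.IsFormalBase

/-! ## Morphisms from the parameter algebra -/

section

variable {B : Type u} [Ring B] [Algebra ℂ B]

/-- The extension of an algebra morphism of power series with central values by images of the
odd parameters. -/
theorem exists_par_lift (f : PowS →ₐ[ℂ] B) (hf : ∀ p b, f p * b = b * f p) (w : Fin 8 → B)
    (hw : ∀ v : Fin 8 → PowS, (∑ i, f (v i) * w i) * ∑ i, f (v i) * w i = 0) :
    ∃ F : Par →ₐ[ℂ] B, (∀ p, F (algebraMap PowS Par p) = f p) ∧
      ∀ v, F (ExteriorAlgebra.ι PowS v) = ∑ i, f (v i) * w i := by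
  let _ : Algebra PowS B := f.toRingHom.toAlgebra' hf
  have hsmul (p : PowS) (b : B) : p • b = f p * b := rfl
  have _ : IsScalarTower ℂ PowS B := IsScalarTower.of_algebraMap_eq fun r => (f.commutes r).symm
  let L : (Fin 8 → PowS) →ₗ[PowS] B := Fintype.linearCombination PowS w
  have hL (v : Fin 8 → PowS) : L v = ∑ i, f (v i) * w i := Fintype.linearCombination_apply ..
  let G : Par →ₐ[PowS] B := ExteriorAlgebra.lift PowS ⟨L, fun v => by rw [hL]; exact hw v⟩
  refine ⟨G.restrictScalars ℂ, fun p => G.commutes p, fun v => ?_⟩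
  rw [← hL]
  exact ExteriorAlgebra.lift_ι_apply PowS L _ v

/-- An algebra morphism with even values on power series and odd values on vectors is a morphism
of superalgebras. -/
theorem isBaseHom_of_par {Y : BaseData B} (hY : Y.IsLocalBase) {F : Par →ₐ[ℂ] B}
    (h0 : ∀ p, F (algebraMap PowS Par p) ∈ Y.part 0)
    (h1 : ∀ v, F (ExteriorAlgebra.ι PowS v) ∈ Y.part 1)
    (haug : ∀ p, Y.aug (F (algebraMap PowS Par p)) = MvPowerSeries.constantCoeff p) :
    IsBaseHom parBase Y F where
  part i a ha := by
    refine CliffordAlgebra.evenOdd_induction (0 : QuadraticForm PowS (Fin 8 → PowS)) i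
      (motive := fun a _ => F a ∈ Y.part i) ?_ ?_ ?_ a ha
    · intro v hv
      obtain rfl | rfl := (by decide : ∀ i : ZMod 2, i = 0 ∨ i = 1) i
      · rw [ZMod.val_zero, pow_zero] at hv
        obtain ⟨r, rfl⟩ := Submodule.mem_one.1 hv
        exact h0 r
      · rw [ZMod.val_one, pow_one] at hv
        obtain ⟨v, rfl⟩ := hv
        exact h1 v
    · intro x y _ _ hx hy
      rw [map_add]
      exact add_mem hx hy
    · intro v w x _ hx
      have h := hY.mul_mem (hY.odd_mul_odd (h1 v) (h1 w)) hx
      rw [zero_add, ← map_mul, ← map_mul] at h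
      exact h
  aug a := by
    have hι (v : Fin 8 → PowS) : parAug (ExteriorAlgebra.ι PowS v) = 0 :=
      parBase_isLocalBase.aug_odd (CliffordAlgebra.ι_mem_evenOdd_one _ v)
    have hp (p : PowS) : parAug (algebraMap PowS Par p) = MvPowerSeries.constantCoeff p := by
      simp [parAug, ignoreOdd, ExteriorAlgebra.algebraMapInv]
    change Y.aug (F a) = parAug a
    induction a using ExteriorAlgebra.induction with
    | algebraMap r => rw [haug, hp]
    | ι v => rw [hY.aug_odd (h1 v), hι]
    | mul a b ha hb => rw [map_mul, map_mul, map_mul, ha, hb]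
    | add a b ha hb => rw [map_add, map_add, map_add, ha, hb]

/-- The parameters of a formal base can be prescribed. -/
theorem exists_par_hom {Y : BaseData B} (hY : Y.IsFormalBase) {u : Fin 13 → B}
    (hu : ∀ i, u i ∈ Y.part (parParity i)) (hm : ∀ i, u i ∈ Y.m) :
    ∃ F : Par →ₐ[ℂ] B, IsBaseHom parBase Y F ∧ ∀ i, F (par i) = u i := by
  have h0 : ∀ i : Fin 5, parParity (Fin.castAdd 8 i) = 0 := by decide
  have h1 : ∀ i : Fin 8, parParity (Fin.natAdd 5 i) = 1 := by decide
  obtain ⟨f, hfX, hf0, hfaug⟩ := hY.exists_powerSeries_hom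
    (b := fun i : Fin 5 => u (Fin.castAdd 8 i)) (fun i => h0 i ▸ hu _)
    fun i => hm _
  let w : Fin 8 → B := fun i => u (Fin.natAdd 5 i)
  have hw (i : Fin 8) : w i ∈ Y.part 1 := h1 i ▸ hu _
  -- Even coefficients keep the combination odd, so its square is zero, as the universal property of
  -- the exterior algebra requires.
  have hodd (v : Fin 8 → PowS) : ∑ i, f (v i) * w i ∈ Y.part 1 :=
    Submodule.sum_mem _ fun i _ => hY.even_mul_odd (hf0 _) (hw i)
  obtain ⟨F, hFp, hFι⟩ := exists_par_lift f (fun p b => hY.even_comm (hf0 p) b) w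
    fun v => hY.odd_sq (hodd v)
  refine ⟨F, isBaseHom_of_par hY.toIsLocalBase (fun p => ?_) (fun v => ?_) (fun p => ?_), ?_⟩
  · rw [hFp]
    exact hf0 p
  · rw [hFι]
    exact hodd v
  · rw [hFp, hfaug]
  · have he (i : Fin 5) : F (evenPar i) = u (Fin.castAdd 8 i) := by rw [evenPar, hFp, hfX]
    have ho (i : Fin 8) : F (oddPar i) = u (Fin.natAdd 5 i) := by
      rw [oddPar, hFι, Finset.sum_eq_single i]
      · rw [Pi.single_eq_same, map_one, one_mul]
      · intro j _ hj
        rw [Pi.single_eq_of_ne hj, map_zero, zero_mul]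
      · simp
    intro i
    fin_cases i <;> first | exact he _ | exact ho _

/-- A morphism from the parameter algebra which satisfies the relations factors through the base
of the relations. -/
theorem exists_mini_lift {Y : BaseData B} {F : Par →ₐ[ℂ] B} (hF : IsBaseHom parBase Y F)
    (h : ∀ i, F (deltaCoord (halfBracket d1_ord3) i) = 0) :
    ∃ f : MiniBase →ₐ[ℂ] B, IsBaseHom miniBase Y f ∧ ∀ a, f (miniMk a) = F a := by
  have hker (a : Par) (ha : a ∈ relIdeal d1_ord3) : F a = 0 := by
    have hle : TwoSidedIdeal.span (Set.range (deltaCoord (halfBracket d1_ord3))) ≤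
        TwoSidedIdeal.ker F.toRingHom := by
      rw [TwoSidedIdeal.span_le]
      rintro _ ⟨i, rfl⟩
      exact (TwoSidedIdeal.mem_ker _).2 (h i)
    exact (TwoSidedIdeal.mem_ker _).1 (hle (TwoSidedIdeal.mem_asIdeal.1 ha))
  have hf (a : Par) : Ideal.Quotient.liftₐ (relIdeal d1_ord3) F hker (miniMk a) = F a :=
    Ideal.Quotient.liftₐ_apply _ _ _ _
  refine ⟨Ideal.Quotient.liftₐ (relIdeal d1_ord3) F hker, ⟨?_, ?_⟩, hf⟩
  · rintro i _ ⟨a, ha, rfl⟩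
    rw [AlgHom.toLinearMap_apply, hf]
    exact hF.part i a ha
  · intro x
    obtain ⟨a, rfl⟩ := miniMk_surjective x
    rw [hf, hF.aug, miniBase_aug_miniMk]
    rfl

/-- Morphisms from the base of the relations to an infinitesimal base are determined by the
images of the parameters. -/
theorem mini_hom_ext {Y : BaseData B} (hY : Y.IsInfinitesimalBase) {f f' : MiniBase →ₐ[ℂ] B}
    (hf : IsBaseHom miniBase Y f) (hf' : IsBaseHom miniBase Y f')
    (h : ∀ i, f (miniPar i) = f' (miniPar i)) : f = f' := by
  have hm (g : MiniBase →ₐ[ℂ] B) (hg : IsBaseHom miniBase Y g) (a : Par) (ha : parAug a = 0) :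
      g (miniMk a) ∈ Y.m := by
    rw [BaseData.mem_m, hg.aug, miniBase_aug_miniMk, ha]
  have hX (i : Fin 5) : f (miniMk (evenPar i)) = f' (miniMk (evenPar i)) := by
    fin_cases i
    exacts [h 0, h 1, h 2, h 3, h 4]
  have hθ (i : Fin 8) : f (miniMk (oddPar i)) = f' (miniMk (oddPar i)) := by
    fin_cases i
    exacts [h 5, h 6, h 7, h 8, h 9, h 10, h 11, h 12]
  -- No continuity is assumed: a series without constant term is a finite combination of the
  -- variables, and `m² = 0` leaves only the constant terms of its coefficients.
  have hvar {p : PowS} (hp : p ∈ varIdeal) :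
      f (miniMk (algebraMap PowS Par p)) = f' (miniMk (algebraMap PowS Par p)) := by
    induction hp using Submodule.span_induction with
    | mem x hx =>
      obtain ⟨i, rfl⟩ := hx
      exact hX i
    | zero => simp
    | add x y _ _ hx hy => simp only [map_add, hx, hy]
    | smul a x hx' hx =>
      have hx0 : algebraMap PowS Par x ∈ parBase.m := by
        have := algebraMap_mem_parBase_m_pow 0 (p := x) (by rw [zero_add, pow_one]; exact hx')
        rwa [zero_add, pow_one] at this
      have ha : a = algebraMap ℂ PowS (MvPowerSeries.constantCoeff a) +
        (a - algebraMap ℂ PowS (MvPowerSeries.constantCoeff a)) := by ring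
      have ha0 : parAug (algebraMap PowS Par
          (a - algebraMap ℂ PowS (MvPowerSeries.constantCoeff a))) = 0 := by
        simp [parAug, ignoreOdd, ExteriorAlgebra.algebraMapInv, MvPowerSeries.algebraMap_apply]
      have key (g : MiniBase →ₐ[ℂ] B) (hg : IsBaseHom miniBase Y g) :
          g (miniMk (algebraMap PowS Par (a • x))) = algebraMap ℂ B
            (MvPowerSeries.constantCoeff a) * g (miniMk (algebraMap PowS Par x)) := by
        have h2 := hY.sq_zero _ (hm g hg _ ha0) _ (hm g hg _ hx0)
        rw [smul_eq_mul, map_mul, map_mul, map_mul]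
        nth_rw 1 [ha]
        rw [map_add, map_add, map_add, add_mul, h2, add_zero,
          ← IsScalarTower.algebraMap_apply ℂ PowS Par, AlgHom.commutes, AlgHom.commutes]
      rw [key f hf, key f' hf', hx]
  have hpow (p : PowS) : f (miniMk (algebraMap PowS Par p)) = f' (miniMk (algebraMap PowS Par p)) := by
    have hp : p = algebraMap ℂ PowS (MvPowerSeries.constantCoeff p) +
      (p - algebraMap ℂ PowS (MvPowerSeries.constantCoeff p)) := by ring
    have hp0 : p - algebraMap ℂ PowS (MvPowerSeries.constantCoeff p) ∈ varIdeal :=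
      MvPowerSeries.mem_span_X (by simp [MvPowerSeries.algebraMap_apply])
    have h1 := hvar hp0
    rw [hp, map_add, map_add, map_add, map_add, h1,
      ← IsScalarTower.algebraMap_apply ℂ PowS Par, AlgHom.commutes, AlgHom.commutes,
      AlgHom.commutes]
  have hι (v : Fin 8 → PowS) : f (miniMk (ExteriorAlgebra.ι PowS v)) =
      f' (miniMk (ExteriorAlgebra.ι PowS v)) := by
    have hv : ExteriorAlgebra.ι PowS v = ∑ i, algebraMap PowS Par (v i) * oddPar i := by
      conv_lhs => rw [pi_eq_sum_univ' v, map_sum]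
      refine Finset.sum_congr rfl fun i _ => ?_
      rw [map_smul, Algebra.smul_def, oddPar]
    rw [hv]
    simp only [map_sum, map_mul, hpow, hθ]
  apply AlgHom.ext
  intro x
  obtain ⟨a, rfl⟩ := miniMk_surjective x
  induction a using ExteriorAlgebra.induction with
  | algebraMap r => exact hpow r
  | ι v => exact hι v
  | mul a b ha hb => rw [map_mul, map_mul, map_mul, ha, hb]
  | add a b ha hb => rw [map_add, map_add, map_add, ha, hb]

end

/-! ## Coalgebra automorphisms which normalize a deformation -/

/-- The matrices of the coefficients of `1, a, b, c, η` in the coalgebra endomorphism with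
`f₁ ↦ f₁ a + f₂ b + f₃ c`, `f₂ ↦ f₂`, `f₃ ↦ f₃` and the quadratic term `f₁ f₂ ↦ f₂ η`. -/
def gaugeCoeff : Fin 5 → Mon → Mon → ℤ :=
  ![fun K I => if K = I ∧ 0 ∉ I.1 then 1 else 0,
    fun K I => if K = I ∧ 0 ∈ I.1 then 1 else 0,
    fun K I => if K = e2 ∧ I = e1 ∨ K = e23 ∧ I = e13 then 1 else 0,
    fun K I => if K = e3 ∧ I = e1 then 1 else if K = e23 ∧ I = e12 then -1 else 0,
    fun K I => if K = e2 ∧ I = e12 then 1 else if K = e23 ∧ I = e123 then -1 else 0]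

/-- Every parameter sits on an input containing `f₁`, and only one tensor factor contains `f₁`. So
the quadratic identity of coalgebra maps is linear in the parameters. -/
theorem gaugeCoeff_comul : ∀ (p : Fin 5) (I J K : Mon), ∑ L, comul L J K * gaugeCoeff p L I =
    ∑ L, ∑ N, comul I L N * ((-1) ^ ((deg J + deg L) * deg K) *
      (if p = 0 then gaugeCoeff 0 J L * gaugeCoeff 0 K N
      else gaugeCoeff 0 J L * gaugeCoeff p K N + gaugeCoeff p J L * gaugeCoeff 0 K N)) := by
  decide +kernel

theorem gaugeCoeff_mem : ∀ (p : Fin 5) (K I : Mon), p ≠ 0 → gaugeCoeff p K I ≠ 0 → 0 ∈ I.1 := by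
  decide +kernel

theorem comul_disjoint : ∀ I L N : Mon, comul I L N ≠ 0 → 0 ∈ L.1 → 0 ∉ N.1 := by
  decide +kernel

theorem gaugeCoeff_parity : ∀ (p : Fin 5) (K I : Mon), gaugeCoeff p K I ≠ 0 →
    ((deg K + deg I : ℕ) : ZMod 2) = if p = 4 then 1 else 0 := by
  decide +kernel

section

variable {A : Type u} [Ring A]

/-- The coalgebra endomorphism with `f₁ ↦ f₁ a + f₂ b + f₃ c`, `f₂ ↦ f₂`, `f₃ ↦ f₃` and the
quadratic term `f₁ f₂ ↦ f₂ η`. -/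
def gauge (a b c η : A) : Matrix Mon Mon A := fun K I =>
  ∑ p, (gaugeCoeff p K I : A) * (![1, a, b, c, η] : Fin 5 → A) p

/-- In each product at most one factor is not an integer, so no commutation between the parameters
is needed. -/
theorem isCoalgebraHom_gauge (a b c η : A) : IsCoalgebraHom (gauge a b c η) := by
  intro I J K
  set w : Fin 5 → A := ![1, a, b, c, η] with hw
  have hw0 : w 0 = 1 := rfl
  have hterm (L N : Mon) : (comul I L N : A) * ((-1) ^ ((deg J + deg L) * deg K) *
      (gauge a b c η J L * gauge a b c η K N)) =
      ∑ p, ((comul I L N * ((-1) ^ ((deg J + deg L) * deg K) *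
        (if p = 0 then gaugeCoeff 0 J L * gaugeCoeff 0 K N
        else gaugeCoeff 0 J L * gaugeCoeff p K N + gaugeCoeff p J L * gaugeCoeff 0 K N)) : ℤ) : A) *
          w p := by
    by_cases hc : comul I L N = 0
    · simp [hc]
    have hJ (p : Fin 5) (hp : p ≠ 0) (h0 : 0 ∉ L.1) : gaugeCoeff p J L = 0 := by
      by_contra h
      exact h0 (gaugeCoeff_mem p J L hp h)
    have hK (p : Fin 5) (hp : p ≠ 0) (h0 : 0 ∉ N.1) : gaugeCoeff p K N = 0 := by
      by_contra h
      exact h0 (gaugeCoeff_mem p K N hp h)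
    simp only [gauge, ← hw]
    have hexp : (∑ p, (gaugeCoeff p J L : A) * w p) * ∑ p, (gaugeCoeff p K N : A) * w p =
        ∑ p, ((if p = 0 then gaugeCoeff 0 J L * gaugeCoeff 0 K N
          else gaugeCoeff 0 J L * gaugeCoeff p K N +
            gaugeCoeff p J L * gaugeCoeff 0 K N : ℤ) : A) * w p := by
      by_cases hL : 0 ∈ L.1
      · have hN := comul_disjoint I L N hc hL
        rw [Finset.sum_eq_single_of_mem (f := fun p => (gaugeCoeff p K N : A) * w p) 0
          (Finset.mem_univ _) (fun p _ hp => by rw [hK p hp hN, Int.cast_zero, zero_mul]), hw0,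
          mul_one, Finset.sum_mul]
        refine Finset.sum_congr rfl fun p _ => ?_
        rw [mul_assoc, ← (Int.cast_commute (gaugeCoeff 0 K N) (w p)).eq, ← mul_assoc,
          ← Int.cast_mul]
        split_ifs with hp
        · rw [hp]
        · rw [hK p hp hN, mul_zero, zero_add]
      · rw [Finset.sum_eq_single_of_mem (f := fun p => (gaugeCoeff p J L : A) * w p) 0
          (Finset.mem_univ _) (fun p _ hp => by rw [hJ p hp hL, Int.cast_zero, zero_mul]), hw0,
          mul_one, Finset.mul_sum]
        refine Finset.sum_congr rfl fun p _ => ?_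
        rw [← mul_assoc, ← Int.cast_mul]
        split_ifs with hp
        · rw [hp]
        · rw [hJ p hp hL, zero_mul, add_zero]
    rw [hexp, Finset.mul_sum, Finset.mul_sum]
    refine Finset.sum_congr rfl fun p _ => ?_
    push_cast
    rw [mul_assoc, mul_assoc]
  have hl : ∑ L, (comul L J K : A) * gauge a b c η L I =
      ∑ p, ((∑ L, comul L J K * gaugeCoeff p L I : ℤ) : A) * w p := by
    simp only [gauge, ← hw, Finset.mul_sum, Int.cast_sum, Finset.sum_mul]
    rw [Finset.sum_comm]
    refine Finset.sum_congr rfl fun p _ => Finset.sum_congr rfl fun L _ => ?_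
    rw [Int.cast_mul, mul_assoc]
  rw [hl]
  simp only [hterm, gaugeCoeff_comul, Int.cast_sum, Finset.sum_mul]
  rw [Finset.sum_comm]
  refine Finset.sum_congr rfl fun L _ => ?_
  rw [Finset.sum_comm]

variable (a b c η : A)

theorem gauge_apply (K I : Mon) : gauge a b c η K I = gaugeCoeff 0 K I + gaugeCoeff 1 K I * a +
    gaugeCoeff 2 K I * b + gaugeCoeff 3 K I * c + gaugeCoeff 4 K I * η := by
  rw [gauge, Fin.sum_univ_five]
  simp

theorem gauge_one : gauge (1 : A) 0 0 0 = 1 := by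
  have h : ∀ K I, gaugeCoeff 0 K I + gaugeCoeff 1 K I = if K = I then 1 else 0 := by decide +kernel
  ext K I
  rw [gauge_apply, mul_zero, mul_zero, mul_zero, add_zero, add_zero, add_zero, mul_one,
    ← Int.cast_add, h, Matrix.one_apply]
  split_ifs <;> simp

/-- These maps are closed under composition, and the composition law yields inverses as soon as `a`
is invertible. -/
theorem gauge_mul (a' b' c' η' : A) : gauge a b c η * gauge a' b' c' η' =
    gauge (a * a') (b * a' + b') (c * a' + c') (η * a' + η') := by
  have h : ∀ (p q : Fin 5) (K I : Mon), ∑ L, gaugeCoeff p K L * gaugeCoeff q L I =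
      if q = 0 then (if p = 0 then gaugeCoeff 0 K I else 0) else if q = 1 then
        (if p = 0 then 0 else gaugeCoeff p K I) else if p = 0 then gaugeCoeff q K I else 0 := by
    decide +kernel
  ext K I
  set w : Fin 5 → A := ![1, a, b, c, η] with hw
  set w' : Fin 5 → A := ![1, a', b', c', η'] with hw'
  have hexp : (gauge a b c η * gauge a' b' c' η') K I =
      ∑ p, ∑ q, ((∑ L, gaugeCoeff p K L * gaugeCoeff q L I : ℤ) : A) * (w p * w' q) := by
    simp only [Matrix.mul_apply, gauge, ← hw, ← hw', Finset.sum_mul, Finset.mul_sum, Int.cast_sum]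
    conv_rhs => rw [Finset.sum_comm]
    rw [Finset.sum_comm]
    refine Finset.sum_congr rfl fun q _ => ?_
    rw [Finset.sum_comm]
    refine Finset.sum_congr rfl fun p _ => Finset.sum_congr rfl fun L _ => ?_
    rw [Int.cast_mul, mul_assoc, mul_assoc, ← mul_assoc (w p),
      ← (Int.cast_commute (gaugeCoeff q L I) (w p)).eq, mul_assoc]
  rw [hexp, gauge_apply]
  simp only [h, Fin.sum_univ_five]
  simp [hw, hw']
  noncomm_ring

end

section

variable {A : Type u} [Ring A] [Algebra ℂ A] {X : BaseData A}

theorem isEvenEnd_gauge (hX : X.IsLocalBase) {a b c η : A} (ha : a ∈ X.part 0) (hb : b ∈ X.part 0)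
    (hc : c ∈ X.part 0) (hη : η ∈ X.part 1) : IsEvenEnd X (gauge a b c η) := by
  intro K I
  refine Submodule.sum_mem _ fun p _ => ?_
  by_cases h : gaugeCoeff p K I = 0
  · simp [h]
  · rw [gaugeCoeff_parity p K I h, ← zsmul_eq_mul]
    refine zsmul_mem ?_ _
    fin_cases p
    exacts [hX.one_mem, ha, hb, hc, hη]

theorem IsOddEnd.even_mul (hX : X.IsLocalBase) {g M : Matrix Mon Mon A} (hg : IsEvenEnd X g)
    (hM : IsOddEnd X M) : IsOddEnd X (g * M) := by
  intro K I
  rw [Matrix.mul_apply]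
  refine Submodule.sum_mem _ fun L _ => ?_
  convert hX.mul_mem (hg K L) (hM L I) using 2
  push_cast
  generalize (deg K : ZMod 2) = x
  generalize (deg L : ZMod 2) = y
  generalize (deg I : ZMod 2) = z
  revert x y z
  decide

theorem IsOddEnd.mul_even (hX : X.IsLocalBase) {g M : Matrix Mon Mon A} (hg : IsEvenEnd X g)
    (hM : IsOddEnd X M) : IsOddEnd X (M * g) := by
  intro K I
  rw [Matrix.mul_apply]
  refine Submodule.sum_mem _ fun L _ => ?_
  convert hX.mul_mem (hM K L) (hg L I) using 2
  push_cast
  generalize (deg K : ZMod 2) = x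
  generalize (deg L : ZMod 2) = y
  generalize (deg I : ZMod 2) = z
  revert x y z
  decide

end

section

variable {A : Type u} [Ring A] (a b c η : A) (w : Mon → A)

theorem gauge_e1_sum : ∑ L, gauge a b c η e1 L * w L = a * w e1 := by
  have h : ∀ p L, gaugeCoeff p e1 L = if p = 1 ∧ L = e1 then 1 else 0 := by decide +kernel
  simp [gauge_apply, h]

theorem gauge_e2_sum : ∑ L, gauge a b c η e2 L * w L = b * w e1 + w e2 + η * w e12 := by
  have h : ∀ p L, gaugeCoeff p e2 L =
    if p = 2 ∧ L = e1 ∨ p = 0 ∧ L = e2 ∨ p = 4 ∧ L = e12 then 1 else 0 := by decide +kernel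
  simp [gauge_apply, h, add_mul, Finset.sum_add_distrib]
  abel

theorem gauge_e3_sum : ∑ L, gauge a b c η e3 L * w L = c * w e1 + w e3 := by
  have h : ∀ p L, gaugeCoeff p e3 L =
    if p = 3 ∧ L = e1 ∨ p = 0 ∧ L = e3 then 1 else 0 := by decide +kernel
  simp [gauge_apply, h, add_mul, Finset.sum_add_distrib]
  abel

theorem sum_gauge_e23 : ∑ L, w L * gauge a b c η L e23 = w e23 := by
  have h : ∀ p L, gaugeCoeff p L e23 = if p = 0 ∧ L = e23 then 1 else 0 := by decide +kernel
  simp [gauge_apply, h]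

theorem sum_gauge_e123 : ∑ L, w L * gauge a b c η L e123 = w e123 * a - w e23 * η := by
  have h : ∀ p L, gaugeCoeff p L e123 =
    if p = 1 ∧ L = e123 then 1 else if p = 4 ∧ L = e23 then -1 else 0 := by decide +kernel
  simp [gauge_apply, h, mul_add, Finset.sum_add_distrib, sub_eq_add_neg]

end

theorem gauge_mul_gauge_inv {B : Type u} [Ring B] {a a' : B} (b c η : B) (h : a * a' = 1)
    (h' : a' * a = 1) :
    gauge a b c η * gauge a' (-(b * a')) (-(c * a')) (-(η * a')) = 1 ∧
      gauge a' (-(b * a')) (-(c * a')) (-(η * a')) * gauge a b c η = 1 := by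
  rw [gauge_mul, gauge_mul, h, h', neg_mul, neg_mul, neg_mul, mul_assoc, mul_assoc, mul_assoc, h']
  simp [gauge_one]

theorem d1_eq (J : Mon) (j : Fin 3) : d1 J j = if J = e23 ∧ j = 0 then 1 else 0 := d1_apply J j

theorem d1_eq_slice : d1 = slice 0 := by
  apply Cochain.ext_mon <;> intro j <;> fin_cases j <;> simp [d1_eq, Mon.ne]

theorem deltaCoord_d1 : deltaCoord d1 = 0 := by
  rw [d1_eq_slice, deltaCoord_slice]

section

variable {B : Type u} [Ring B] [Algebra ℂ B] {Y : BaseData B}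

/-- Every deformation is equivalent to one in normal form. -/
theorem IsDeformation.exists_slice (hY : Y.IsLocalBase) {N : Matrix Mon Mon B}
    (hN : IsDeformation d1 Y N) : ∃ u : Fin 13 → B, (∀ i, u i ∈ Y.part (parParity i)) ∧
      (∀ i, u i ∈ Y.m) ∧ halfBracket (slice u) = 0 ∧ Equivalent Y (oddCoder (slice u)) N := by
  have haug (K I : Mon) : Y.aug (N K I) = oddCoder d1 K I := congrFun (congrFun hN.aug K) I
  obtain ⟨⟨α, a, hαa, haα⟩, hα⟩ := hY.isUnit (N e1 e23) (by
    rw [haug, oddCoder_e1]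
    simp [d1_eq])
  simp only at hα
  subst hα
  have hα0 : N e1 e23 ∈ Y.part 0 := hN.odd e1 e23
  -- The inverse of an even unit is even: the unit annihilates the odd part of its inverse.
  have ha : a ∈ Y.part 0 := by
    obtain ⟨x, hx, y, hy, rfl⟩ := hY.exists_add a
    have h1 : N e1 e23 * y = 0 := by
      refine hY.eq_zero_of_mem ?_ (hY.even_mul_odd hα0 hy)
      have : N e1 e23 * y = 1 - N e1 e23 * x := by rw [← hαa]; noncomm_ring
      rw [this]
      exact sub_mem hY.one_mem (hY.mul_even hα0 hx)
    have h2 : y = 0 := by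
      have := congrArg ((x + y) * ·) h1
      simpa only [← mul_assoc, haα, one_mul, mul_zero] using this
    rw [h2, add_zero]
    exact hx
  have haug_a : Y.aug a = 1 := by
    have h1 := congrArg Y.aug hαa
    rw [map_mul, haug, map_one, oddCoder_e1] at h1
    simpa [d1_eq] using h1
  -- With `M g = g N`, the four parameters are forced by the four `β`-coordinates: `a` normalizes
  -- the coefficient of `φ^{011}_1` to 1, while `b`, `c` and `η` kill those of `φ^{011}_2`,
  -- `φ^{011}_3` and `φ^{111}_1`.
  set η : B := -(a * N e1 e123) with hη_def
  set b : B := -((N e2 e23 + η * N e12 e23) * a) with hb_def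
  set c : B := -(N e3 e23 * a) with hc_def
  have hη : η ∈ Y.part 1 := neg_mem (hY.even_mul_odd ha (hN.odd e1 e123))
  have hb : b ∈ Y.part 0 := neg_mem (hY.mul_even
    (add_mem (hN.odd e2 e23) (hY.odd_mul_odd hη (hN.odd e12 e23))) ha)
  have hc : c ∈ Y.part 0 := neg_mem (hY.mul_even (hN.odd e3 e23) ha)
  have hηm : Y.aug η = 0 := hY.aug_odd hη
  have hbm : Y.aug b = 0 := by
    rw [hb_def, map_neg, map_mul, map_add, map_mul, hηm, haug, oddCoder_e2]
    simp [d1_eq]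
  have hcm : Y.aug c = 0 := by
    rw [hc_def, map_neg, map_mul, haug, oddCoder_e3]
    simp [d1_eq]
  set g := gauge a b c η with hg
  set g' := gauge (N e1 e23) (-(b * N e1 e23)) (-(c * N e1 e23)) (-(η * N e1 e23)) with hg'
  obtain ⟨hgg', hg'g⟩ : g * g' = 1 ∧ g' * g = 1 := gauge_mul_gauge_inv b c η haα hαa
  have hge : IsEvenEnd Y g := isEvenEnd_gauge hY ha hb hc hη
  have hg'e : IsEvenEnd Y g' := isEvenEnd_gauge hY hα0 (neg_mem (hY.mul_even hb hα0))
    (neg_mem (hY.mul_even hc hα0)) (neg_mem (hY.odd_mul_even hη hα0))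
  have hgu : IsUnit g := ⟨⟨g, g', hgg', hg'g⟩, rfl⟩
  have hgm : g.map Y.aug = 1 := by
    rw [← gauge_one]
    ext K I
    rw [Matrix.map_apply, hg, gauge_apply, gauge_apply]
    simp [haug_a, hbm, hcm, hηm]
  set M := g * N * g' with hM
  have hMg : M * g = g * N := by rw [hM, Matrix.mul_assoc, hg'g, Matrix.mul_one]
  have hMo : IsOddEnd Y M := IsOddEnd.mul_even hY hg'e (IsOddEnd.even_mul hY hge hN.odd)
  have hMc : IsOddCoderivation M :=
    IsOddCoderivation.conj hY hN.odd hMo hge (isCoalgebraHom_gauge a b c η) hgu hMg hN.coder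
  have hMs : M * M = 0 := by
    have h1 : M * M = g * (N * N) * g' := by
      nth_rw 2 [hM]
      rw [← Matrix.mul_assoc, ← Matrix.mul_assoc, hMg, Matrix.mul_assoc g]
    rw [h1, hN.square, Matrix.mul_zero, Matrix.zero_mul]
  have hMa : M.map Y.aug = oddCoder d1 := by
    have h1 := congrArg (fun Z : Matrix Mon Mon B => Z.map (Y.aug : B →+* ℂ)) hMg
    simp only [Matrix.map_mul] at h1
    have h2 : g.map (Y.aug : B →+* ℂ) = 1 := hgm
    rw [h2, Matrix.mul_one, Matrix.one_mul] at h1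
    exact h1.trans hN.aug
  have hcoder : oddCoder (cochainOf M) = M := oddCoder_cochainOf hMc
  have ho : IsOddCochain Y (cochainOf M) := isOddCochain_cochainOf hY hMo
  have hh : halfBracket (cochainOf M) = 0 := by
    funext J j
    rw [halfBracket, hcoder, hMs]
    rfl
  have hM23 (K : Mon) : M K e23 = ∑ L, g K L * N L e23 := by
    rw [← sum_gauge_e23 a b c η (M K)]
    exact congrFun (congrFun hMg K) e23
  have hM1 : M e1 e23 = 1 := by rw [hM23, hg, gauge_e1_sum, haα]
  have hM2 : M e2 e23 = 0 := by
    rw [hM23, hg, gauge_e2_sum, hb_def, neg_mul, mul_assoc, haα, mul_one, add_assoc,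
      neg_add_cancel]
  have hM3 : M e3 e23 = 0 := by
    rw [hM23, hg, gauge_e3_sum, hc_def, neg_mul, mul_assoc, haα, mul_one, neg_add_cancel]
  have hM4 : M e1 e123 = 0 := by
    have h1 : M e1 e123 * a - M e1 e23 * η = a * N e1 e123 := by
      rw [← sum_gauge_e123 a b c η (M e1), ← gauge_e1_sum a b c η fun L => N L e123]
      exact congrFun (congrFun hMg e1) e123
    rw [hM1, one_mul, hη_def, sub_neg_eq_add, add_eq_right] at h1
    have h2 := congrArg (· * N e1 e23) h1
    simpa only [mul_assoc, haα, mul_one, zero_mul] using h2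
  have hbeta : betaCoord (cochainOf M) = ![1, 0, 0, 0] := by
    rw [betaCoord_eq]
    simp only [cochainOf]
    have s1 : single 0 = e1 := rfl
    have s2 : single 1 = e2 := rfl
    have s3 : single 2 = e3 := rfl
    rw [s1, s2, s3, hM1, hM2, hM3, hM4]
    simp
  have hslice : cochainOf M = slice (deltaCoord (cochainOf M)) := by
    refine eq_slice hY ho hbeta ?_
    rw [hh]
    funext k
    fin_cases k <;> rfl
  refine ⟨deltaCoord (cochainOf M), deltaCoord_mem ho, fun i => ?_, ?_, ?_⟩
  · rw [BaseData.mem_m, map_deltaCoord]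
    have h1 : (fun J j => Y.aug (cochainOf M J j)) = d1 := by
      rw [← cochainOf_oddCoder d1, ← hMa]
      funext J j
      simp [cochainOf]
    rw [h1, deltaCoord_d1]
    rfl
  · rw [← hslice, hh]
  · rw [← hslice, hcoder]
    exact ⟨g, hge, isCoalgebraHom_gauge a b c η, hgu, hgm, hMg⟩

end

/-! ## Uniqueness over infinitesimal bases -/

section

variable {B : Type u} [Ring B]

/-- Generators are primitive: their reduced coproduct is zero. -/
theorem IsCoalgebraHom.e23_e2 {g : Matrix Mon Mon B} (h : IsCoalgebraHom g) : g e23 e2 = 0 := by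
  have e := h e2 e2 e3
  have h1 : ∀ L N, comul e2 L N = 0 := by decide +kernel
  simpa [comul_e2_e3, h1] using e

theorem IsCoalgebraHom.e23_e3 {g : Matrix Mon Mon B} (h : IsCoalgebraHom g) : g e23 e3 = 0 := by
  have e := h e3 e2 e3
  have h1 : ∀ L N, comul e3 L N = 0 := by decide +kernel
  simpa [comul_e2_e3, h1] using e

/-- On monomials of degree two, the quadratic part of a coalgebra map consists of 2 × 2 minors of
its linear part. -/
theorem IsCoalgebraHom.e23_e12 {g : Matrix Mon Mon B} (h : IsCoalgebraHom g) :
    g e23 e12 = g e2 e1 * g e3 e2 - g e2 e2 * g e3 e1 := by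
  have e := h e12 e2 e3
  have h1 : ∀ L N, comul e12 L N = if L = e1 then if N = e2 then 1 else 0 else
    if L = e2 then if N = e1 then -1 else 0 else 0 := by decide +kernel
  simpa [comul_e2_e3, h1, Mon.sum_eq, Mon.ne, sub_eq_add_neg] using e

theorem IsCoalgebraHom.e23_e13 {g : Matrix Mon Mon B} (h : IsCoalgebraHom g) :
    g e23 e13 = g e2 e1 * g e3 e3 - g e2 e3 * g e3 e1 := by
  have e := h e13 e2 e3
  have h1 : ∀ L N, comul e13 L N = if L = e1 then if N = e3 then 1 else 0 else
    if L = e3 then if N = e1 then -1 else 0 else 0 := by decide +kernel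
  simpa [comul_e2_e3, h1, Mon.sum_eq, Mon.ne, sub_eq_add_neg] using e

theorem oddCoder_slice_zero (K I : Mon) :
    oddCoder (slice (0 : Fin 13 → B)) K I = if K = e1 ∧ I = e23 then 1 else 0 := by
  have h1 : ∀ (J : Mon) (j : Fin 3), slice (0 : Fin 13 → B) J j =
      if J = e23 then if j = 0 then 1 else 0 else 0 := by
    intro J j
    revert J
    fin_cases j <;> refine Mon.cases ?_ ?_ ?_ ?_ ?_ ?_ ?_ <;> simp [Mon.ne]
  have h2 : ∀ K I, coderCoeff e23 0 K I = if K = e1 ∧ I = e23 then 1 else 0 := by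
    decide +kernel
  rw [oddCoder_eq]
  simp [h1, h2]

variable [Algebra ℂ B] {Y : BaseData B}

/-- Over an infinitesimal base, an equivalence is determined to first order by a commutator with
the codifferential. -/
theorem Equivalent.exists_commutator (hY : Y.IsInfinitesimalBase) {u : Fin 13 → B}
    (hu : ∀ i, u i ∈ Y.m) {N : Matrix Mon Mon B} (hN : IsDeformation d1 Y N)
    (h : Equivalent Y (oddCoder (slice u)) N) : ∃ g : Matrix Mon Mon B,
      g e23 e2 = 0 ∧ g e23 e3 = 0 ∧ g e23 e12 = -g e3 e1 ∧ g e23 e13 = g e2 e1 ∧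
      ∀ K I, oddCoder (slice u) K I + (if K = e1 then g e23 I else 0) =
        N K I + if I = e23 then g K e1 else 0 := by
  obtain ⟨g, -, hgc, -, hgm, hg⟩ := h
  set d : Matrix Mon Mon B := oddCoder (slice 0) with hd
  have haug {v : Fin 13 → B} (hv : ∀ i, v i ∈ Y.m) (K I : Mon) :
      Y.aug (oddCoder (slice v) K I) = oddCoder d1 K I := by
    have h1 := congrFun (congrFun (map_oddCoder Y.aug (slice v)) K) I
    rw [map_slice, show (fun i => Y.aug (v i)) = 0 from funext hv, ← d1_eq_slice] at h1
    exact h1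
  have hd_aug (K I : Mon) : Y.aug (d K I) = oddCoder d1 K I :=
    haug (v := 0) (fun _ => zero_mem _) K I
  have hM (K I : Mon) : (oddCoder (slice u) - d) K I ∈ Y.m := by
    rw [Matrix.sub_apply, BaseData.mem_m, map_sub, haug hu, hd_aug, sub_self]
  have hN' (K I : Mon) : (N - d) K I ∈ Y.m := by
    rw [Matrix.sub_apply, BaseData.mem_m, map_sub, hd_aug, ← hN.aug,
      Matrix.map_apply, sub_self]
  have hg' (K I : Mon) : (g - 1) K I ∈ Y.m := by
    have h1 : Y.aug (g K I) = (1 : Matrix Mon Mon ℂ) K I := congrFun (congrFun hgm K) I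
    rw [Matrix.sub_apply, BaseData.mem_m, map_sub, h1, Matrix.one_apply, Matrix.one_apply]
    split_ifs <;> simp
  have hmul {P Q : Matrix Mon Mon B} (hP : ∀ K I, P K I ∈ Y.m) (hQ : ∀ K I, Q K I ∈ Y.m) :
      P * Q = 0 := by
    ext K I
    rw [Matrix.mul_apply]
    exact Finset.sum_eq_zero fun L _ => hY.sq_zero _ (hP K L) _ (hQ L I)
  -- The products `(M - d)(g - 1)` and `(g - 1)(N - d)` vanish because `m² = 0`; with `M g = g N`
  -- this leaves `M - N = g d - d g`.
  have h0 : oddCoder (slice u) + d * g = N + g * d := by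
    have e1 := hmul hM hg'
    have e2 := hmul hg' hN'
    rw [Matrix.sub_mul, Matrix.mul_sub, Matrix.mul_sub, hg, Matrix.mul_one, Matrix.mul_one] at e1
    rw [Matrix.sub_mul, Matrix.mul_sub, Matrix.mul_sub, Matrix.one_mul, Matrix.one_mul] at e2
    rw [← sub_eq_zero, ← sub_zero (0 : Matrix Mon Mon B)]
    nth_rw 1 [← e2]
    rw [← e1]
    abel
  have hm {K I : Mon} (hne : K ≠ I) : g K I ∈ Y.m := by
    have h1 := hg' K I
    rwa [Matrix.sub_apply, Matrix.one_apply_ne hne, sub_zero] at h1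
  -- Diagonal entries of `g` are congruent to 1 modulo `m`, so they act trivially on `m`.
  have hone (K : Mon) {x : B} (hx : x ∈ Y.m) : g K K * x = x := by
    have h1 := hY.sq_zero _ (hg' K K) _ hx
    rwa [Matrix.sub_apply, Matrix.one_apply_eq, sub_mul, one_mul, sub_eq_zero] at h1
  have hone' (K : Mon) {x : B} (hx : x ∈ Y.m) : x * g K K = x := by
    have h1 := hY.sq_zero _ hx _ (hg' K K)
    rwa [Matrix.sub_apply, Matrix.one_apply_eq, mul_sub, mul_one, sub_eq_zero] at h1
  refine ⟨g, hgc.e23_e2, hgc.e23_e3, ?_, ?_, fun K I => ?_⟩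
  · rw [hgc.e23_e12, hY.sq_zero _ (hm (by simp [Mon.ne])) _ (hm (by simp [Mon.ne])),
      hone _ (hm (by simp [Mon.ne])), zero_sub]
  · rw [hgc.e23_e13, hY.sq_zero _ (hm (K := e2) (I := e3) (by simp [Mon.ne])) _
      (hm (by simp [Mon.ne])), hone' _ (hm (by simp [Mon.ne])), sub_zero]
  · have h1 := congrFun (congrFun h0 K) I
    rw [Matrix.add_apply, Matrix.add_apply, Matrix.mul_apply, Matrix.mul_apply] at h1
    simpa [hd, oddCoder_slice_zero, ite_and] using h1

/-- Over an infinitesimal base, equivalent deformations in normal form are equal. -/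
theorem slice_parameters_unique (hY : Y.IsInfinitesimalBase) {u u' : Fin 13 → B}
    (hu : ∀ i, u i ∈ Y.m) (hu' : ∀ i, u' i ∈ Y.m) {N : Matrix Mon Mon B}
    (hN : IsDeformation d1 Y N) (h : Equivalent Y (oddCoder (slice u)) N)
    (h' : Equivalent Y (oddCoder (slice u')) N) : u = u' := by
  obtain ⟨g, a1, a2, a3, a4, hg⟩ := h.exists_commutator hY hu hN
  obtain ⟨g', b1, b2, b3, b4, hg'⟩ := h'.exists_commutator hY hu' hN
  -- Both normal forms differ from `N` by a commutator with `d₁`, whose matrix has the single entry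
  -- 1 from `f₂f₃` to `f₁`.
  have key (J : Mon) (j : Fin 3) : slice u J j - slice u' J j =
      (-1) ^ deg J * ((if J = e23 then g (single j) e1 - g' (single j) e1 else 0) -
        if single j = e1 then g e23 J - g' e23 J else 0) := by
    have k1 := hg (single j) J
    have k2 := hg' (single j) J
    rw [← cochainOf_oddCoder (slice u), ← cochainOf_oddCoder (slice u')]
    rw [← eq_sub_iff_add_eq] at k1 k2
    rw [cochainOf, cochainOf, ← mul_sub, k1, k2]
    congr 1
    split_ifs <;> abel
  have hcoord (i : Fin 13) : u i - u' i = deltaCoord (fun J j => slice u J j - slice u' J j) i := by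
    nth_rw 1 [← deltaCoord_slice u]
    nth_rw 1 [← deltaCoord_slice u']
    rw [deltaCoord_eq, deltaCoord_eq, deltaCoord_eq]
    fin_cases i <;> simp <;> abel
  have s1 : single 0 = e1 := rfl
  have s2 : single 1 = e2 := rfl
  have s3 : single 2 = e3 := rfl
  funext i
  rw [← sub_eq_zero, hcoord, deltaCoord_eq]
  simp only [key]
  -- Commutators have no `δ`-coordinates: in the first two, the contributions from `φ^{011}_3` and
  -- `φ^{011}_2` cancel those from `φ^{110}_1` and `φ^{101}_1`, by the formulas for the minors.
  fin_cases i <;> simp [s1, s2, s3, Mon.ne, a1, a2, a3, a4, b1, b2, b3, b4]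
  abel

end

/-! ## The miniversal deformation -/

theorem map_miniversalDef {B : Type u} [Ring B] [Algebra ℂ B] (f : MiniBase →ₐ[ℂ] B) :
    miniversalDef.map f = oddCoder (slice fun i => f (miniPar i)) := by
  rw [miniversalDef_eq, map_oddCoder, map_slice]

/-- The normal form of a deformation supplies values for the parameters, and its square being zero
says that these values satisfy the relations. -/
theorem isMiniversal_miniversalDef : IsMiniversal.{u, 0} d1 miniBase miniversalDef where
  formal := miniBase_isFormalBase
  deformation := isDeformation_miniversalDef
  induces B _ _ Y hY N hN := by
    obtain ⟨u, hu, hm, hh, he⟩ := hN.exists_slice hY.toIsLocalBase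
    obtain ⟨F, hF, hFu⟩ := exists_par_hom hY hu hm
    have hFd : (fun J j => F (d1_ord3 J j)) = slice u := by
      rw [slice_par_eq, map_slice, funext hFu]
    obtain ⟨f, hf, hfF⟩ := exists_mini_lift hF (fun i => by
      have h1 : (fun J j => F (halfBracket d1_ord3 J j)) = 0 := by
        funext J j
        rw [map_halfBracket, hFd, hh]
      rw [map_deltaCoord, h1]
      fin_cases i <;> simp [deltaCoord, coeffAt])
    refine ⟨f, hf, ?_⟩
    rwa [map_miniversalDef, show (fun i => f (miniPar i)) = u from
      funext fun i => (hfF _).trans (hFu i)]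
  unique B _ _ Y hY N hN f f' hf hf' h h' := by
    rw [map_miniversalDef] at h h'
    have hm (g : MiniBase →ₐ[ℂ] B) (hg : IsBaseHom miniBase Y g) (i : Fin 13) :
        g (miniPar i) ∈ Y.m := by
      rw [BaseData.mem_m, hg.aug, miniPar, miniBase_aug_miniMk, parAug_par]
    exact mini_hom_ext hY hf hf'
      (congrFun (slice_parameters_unique hY (hm f hf) (hm f' hf') hN h h'))

end HeisenbergDef

/-! ### The main theorem -/

theorem mainTheorem5 :
    -- the dimensions `h₁`, `h₂`, `h₃` of the cohomology of `d₁`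
    (Module.finrank ℂ (HeisenbergDef.Cohomology HeisenbergDef.d1 1) = 6 ∧
      Module.finrank ℂ (HeisenbergDef.Cohomology HeisenbergDef.d1 2) = 5 ∧
      Module.finrank ℂ (HeisenbergDef.Cohomology HeisenbergDef.d1 3) = 2) ∧
    -- `δ_i`, `β_k`, `γ_k` form a basis of the cochains, the `δ_i` are cocycles, `D(γ_k) = β_k`,
    -- and the coordinates are those of this basis
    (((∀ i, HeisenbergDef.coboundary HeisenbergDef.d1 (HeisenbergDef.delta i) = 0) ∧
      (∀ k, HeisenbergDef.coboundary HeisenbergDef.d1 (HeisenbergDef.gamma k) =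
        HeisenbergDef.beta k) ∧
      (∀ k, HeisenbergDef.coboundary HeisenbergDef.d1 (HeisenbergDef.beta k) = 0)) ∧
      LinearIndependent ℂ (Sum.elim HeisenbergDef.delta
        (Sum.elim HeisenbergDef.beta HeisenbergDef.gamma)) ∧
      ∀ c : HeisenbergDef.Cochain HeisenbergDef.Par,
        c = ∑ i, HeisenbergDef.tensor (HeisenbergDef.delta i) (HeisenbergDef.deltaCoord c i) +
          ∑ k, HeisenbergDef.tensor (HeisenbergDef.beta k) (HeisenbergDef.betaCoord c k) +
          ∑ k, HeisenbergDef.tensor (HeisenbergDef.gamma k) (HeisenbergDef.gammaCoord c k)) ∧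
    -- the second order relations without odd parameters: two equations in the `t_i`
    ((∀ i : Fin 13, i ≠ 11 → i ≠ 12 → HeisenbergDef.ignoreOdd
        (HeisenbergDef.deltaCoord (HeisenbergDef.halfBracket HeisenbergDef.d1_ord1) i) = 0) ∧
      HeisenbergDef.ignoreOdd
        (HeisenbergDef.deltaCoord (HeisenbergDef.halfBracket HeisenbergDef.d1_ord1) 11) =
          MvPowerSeries.X 0 * MvPowerSeries.X 4 - MvPowerSeries.X 1 * MvPowerSeries.X 2 ∧
      HeisenbergDef.ignoreOdd
        (HeisenbergDef.deltaCoord (HeisenbergDef.halfBracket HeisenbergDef.d1_ord1) 12) =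
          -(MvPowerSeries.X 0 * MvPowerSeries.X 2) - MvPowerSeries.X 1 * MvPowerSeries.X 3) ∧
    -- the construction reaches `d₁³` in the third order and stops there
    (HeisenbergDef.nextOrder HeisenbergDef.d1_ord1 = HeisenbergDef.d1_ord2 ∧
      HeisenbergDef.nextOrder HeisenbergDef.d1_ord2 = HeisenbergDef.d1_ord3 ∧
      HeisenbergDef.d1_ord3 ≠ HeisenbergDef.d1_ord2 ∧
      HeisenbergDef.nextOrder HeisenbergDef.d1_ord3 = HeisenbergDef.d1_ord3 ∧
      ∀ J j, HeisenbergDef.halfBracket HeisenbergDef.d1_ord3 J j ∈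
        HeisenbergDef.relIdeal HeisenbergDef.d1_ord3) ∧
    -- `d₁³` is a miniversal deformation of `d₁`
    HeisenbergDef.IsMiniversal.{u, 0} HeisenbergDef.d1 HeisenbergDef.miniBase
      HeisenbergDef.miniversalDef := by
  refine ⟨⟨?_, ?_, ?_⟩, ⟨⟨HeisenbergDef.coboundary_delta, HeisenbergDef.coboundary_gamma,
    HeisenbergDef.coboundary_beta⟩, HeisenbergDef.linearIndependent_basis,
    HeisenbergDef.eq_sum_coord⟩, ⟨fun i h11 h12 => ?_, ?_, ?_⟩,
    ⟨HeisenbergDef.nextOrder_d1_ord1, HeisenbergDef.nextOrder_d1_ord2, HeisenbergDef.d1_ord3_ne,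
      HeisenbergDef.nextOrder_d1_ord3, HeisenbergDef.halfBracket_d1_ord3_mem⟩,
    HeisenbergDef.isMiniversal_miniversalDef⟩
  · rw [HeisenbergDef.finrank_cohomology]
    decide
  · rw [HeisenbergDef.finrank_cohomology]
    decide
  · rw [HeisenbergDef.finrank_cohomology]
    decide
  · rw [HeisenbergDef.ignoreOdd_secondOrder]
    fin_cases i <;> simp at h11 h12 ⊢
  · rw [HeisenbergDef.ignoreOdd_secondOrder]
    rfl
  · rw [HeisenbergDef.ignoreOdd_secondOrder]
    rfl
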